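/- **Setting.** Let $k$ be a (commutative) local ring in which $2$ is invertible. A *moment graph* on a lattice $Y\cong\mathbb Z^r$ is a directed graph without directed cycles or multiple edges, with a partial order on its vertices such that $x\le y$ for every edge $x\to y$, and with a label $l(E)\in Y\setminus\{0\}$ for every edge $E$. Put $Y_k=Y\otimes_{\mathbb Z}k$ and $S_k=\mathrm{Sym}(Y_k)$, graded with $Y_k$ in degree $2$; all $S_k$-modules are finitely generated and $\mathbb Z$-graded, and all morphisms have degree $0$. A moment graph and $k$ form a *GKM pair* if any two distinct edges with a common vertex have labels that are $k$-linearly independent in $Y_k$. A *$k$-sheaf* $\mathcal F$ consists of $S_k$-modules $\mathcal F^x$ (for vertices $x$) and $\mathcal F^E$ with $l(E)\mathcal F^E=0$ (for edges $E$), and of homomorphisms $\rho_{x,E}:\mathcal F^x\to\mathcal F^E$ for $x$ in the boundary of $E$. A section over a set $I$ of vertices is a family $(m_x)\in\prod_{x\in I}\mathcal F^x$ with $\rho_{x,E}(m_x)=\rho_{y,E}(m_y)$ for all edges $E$ between vertices $x,y\in I$, and $\mathcal F^{\delta x}\subseteq\bigoplus_{E:x\to y}\mathcal F^E$ is the image of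 the sections over $\{y\mid y>x\}$ under $(m_y)\mapsto(\rho_{y,E}(m_y))_{E:x\to y}$. On a finite moment graph with highest vertex $w$, the *canonical (Braden–MacPherson) sheaf* is the indecomposable $k$-sheaf $\mathcal B$, unique up to isomorphism, with (i) $\mathcal B^w\cong S_k$; (ii) for every edge $E:x\to y$, $\rho_{y,E}$ is surjective with kernel $l(E)\mathcal B^y$; (iii) for every vertex $x$ with an outgoing edge, $(\rho_{x,E})_{E:x\to y}:\mathcal B^x\to\mathcal B^{\delta x}$ is a projective cover of graded $S_k$-modules. Let $\mathcal W$ be the Weyl group of a symmetrisable generalised Cartan matrix, with set of simple reflections $\mathcal S$, length $\ell$, Bruhat order $\le$ and coroot lattice $\check Q$. For $J\subseteq\mathcal S$ let $\mathcal W_J=\langle J\rangle$, and let $\mathcal W^J$ be the set of minimal length representatives of the cosets in $\mathcal W/\mathcal W_J$. The *Bruhat graph* $\mathcal G^J$ is the moment graph on $\check Q$ with vertex set $\mathcal W^J$ ordered by $\le$, with an edge $x\to y$ whenever $x<y$ and $yux^{-1}=s_\alpha$ for some $u\in\mathcal W_J$ and some positive real root $\alpha$, and with label $\check\alpha$ on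 this edge. For $w\in\mathcal W^J$ let $\mathcal G^J_w$ be its full subgraph on $\{x\in\mathcal W^J\mid x\le w\}$, and $\mathcal B^J_w$ a canonical sheaf on it. For $J=\emptyset$ write $\mathcal G_w$ and $\mathcal B_w$. **Theorem.** Let $J\subseteq\mathcal S$ be such that $\mathcal W_J$ is finite, with longest element $w_J$, let $y,w\in\mathcal W^J$ with $y\le w$, and assume that $(\mathcal G_{ww_J},k)$ is a GKM pair. Then $yw_J\le ww_J$, and there is an isomorphism of (graded) $S_k$-modules $$(\mathcal B_{ww_J})^{yw_J}\cong(\mathcal B^J_w)^y .$$ -/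

import Mathlib

open scoped TensorProduct

universe u

namespace MomentSheaf

/-! ### Moment graphs on a lattice -/

/-- A moment graph on a lattice `Y` of finite rank, with partially ordered vertex set `V`.
Edges are given by a relation, so there are no multiple edges.  An edge `x → y` requires
`x ≤ y`, and the absence of directed cycles (in particular of loops) then amounts to `x < y`. -/
structure MomentGraph (Y : Type*) [AddCommGroup Y] [Module.Free ℤ Y] [Module.Finite ℤ Y]
    (V : Type*) [PartialOrder V] where
  /-- `Adj x y` : there is an edge `x → y` -/
  Adj : V → V → Prop
  lt_of_adj : ∀ {x y : V}, Adj x y → x < y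
  /-- the label function -/
  label : ∀ {x y : V}, Adj x y → Y
  label_ne_zero : ∀ {x y : V} (h : Adj x y), label h ≠ 0

section Graph

variable {Y : Type*} [AddCommGroup Y] [Module.Free ℤ Y] [Module.Finite ℤ Y]
  {V : Type*} [PartialOrder V]

/-- The full subgraph on a set of vertices. -/
def MomentGraph.restrict (G : MomentGraph Y V) (I : Set V) : MomentGraph Y I where
  Adj x y := G.Adj x y
  lt_of_adj h := G.lt_of_adj h
  label h := G.label h
  label_ne_zero h := G.label_ne_zero h

/-- `(G, k)` is a GKM pair: any two distinct edges with a common vertex have labels that are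
`k`-linearly independent in `k ⊗ Y`. -/
def MomentGraph.IsGKM (G : MomentGraph Y V) (k : Type*) [CommRing k] : Prop :=
  ∀ {x y x' y' : V} (h : G.Adj x y) (h' : G.Adj x' y'), (x, y) ≠ (x', y') →
    (x = x' ∨ x = y' ∨ y = x' ∨ y = y') →
    LinearIndependent k ![(1 : k) ⊗ₜ[ℤ] G.label h, (1 : k) ⊗ₜ[ℤ] G.label h']

end Graph

/-! ### Graded modules over the symmetric algebra -/

/-- The symmetric algebra `S_k` of `Y_k = k ⊗ Y`. -/
abbrev SymAlg (k : Type u) [CommRing k] (Y : Type u) [AddCommGroup Y] : Type u :=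
  SymmetricAlgebra k (k ⊗[ℤ] Y)

/-- The image in `S_k` of a lattice element. -/
noncomputable def linForm (k : Type u) [CommRing k] {Y : Type u} [AddCommGroup Y] (l : Y) :
    SymAlg k Y :=
  SymmetricAlgebra.ι k (k ⊗[ℤ] Y) ((1 : k) ⊗ₜ[ℤ] l)

/-- The `ℤ`-grading of `S_k` for which `Y_k` is the part of degree `2`: the part of degree `2 n`
consists of the sums of `n`-fold products of elements of `Y_k`, the other parts are zero. -/
noncomputable def symGrading (k : Type u) [CommRing k] (Y : Type u) [AddCommGroup Y] (i : ℤ) :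
    Submodule k (SymAlg k Y) :=
  ⨆ (n : ℕ) (_ : i = 2 * n), LinearMap.range (SymmetricAlgebra.ι k (k ⊗[ℤ] Y)) ^ n

/-- A finitely generated `ℤ`-graded `S_k`-module. -/
structure GrMod (k : Type u) [CommRing k] (Y : Type u) [AddCommGroup Y] where
  carrier : Type u
  [addCommGroup : AddCommGroup carrier]
  [module : Module (SymAlg k Y) carrier]
  [finite : Module.Finite (SymAlg k Y) carrier]
  /-- the homogeneous components -/
  grading : ℤ → AddSubgroup carrier
  [decomposition : DirectSum.Decomposition grading]
  smul_mem : ∀ {i j : ℤ} {s : SymAlg k Y} {m : carrier},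
    s ∈ symGrading k Y i → m ∈ grading j → s • m ∈ grading (i + j)

section GradedModules

variable {k : Type u} [CommRing k] {Y : Type u} [AddCommGroup Y]

instance : CoeSort (GrMod k Y) (Type u) := ⟨GrMod.carrier⟩

instance (M : GrMod k Y) : AddCommGroup M := M.addCommGroup
instance (M : GrMod k Y) : Module (SymAlg k Y) M := M.module
instance (M : GrMod k Y) : Module.Finite (SymAlg k Y) M := M.finite
instance (M : GrMod k Y) : DirectSum.Decomposition M.grading := M.decomposition

/-- Morphisms of graded `S_k`-modules: `S_k`-linear maps of degree zero. -/
structure GrHom (M N : GrMod k Y) where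
  toLinearMap : M →ₗ[SymAlg k Y] N
  map_mem : ∀ {i : ℤ} {m : M}, m ∈ M.grading i → toLinearMap m ∈ N.grading i

instance (M N : GrMod k Y) : CoeFun (GrHom M N) (fun _ => M → N) := ⟨fun f => f.toLinearMap⟩

/-- Isomorphisms of graded `S_k`-modules (of degree zero). -/
structure GrIso (M N : GrMod k Y) where
  toLinearEquiv : M ≃ₗ[SymAlg k Y] N
  map_mem_iff : ∀ {i : ℤ} {m : M}, toLinearEquiv m ∈ N.grading i ↔ m ∈ M.grading i

/-- `M ≅ S_k` as graded modules. -/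
def GrMod.IsoSym (M : GrMod k Y) : Prop :=
  ∃ e : SymAlg k Y ≃ₗ[SymAlg k Y] M, ∀ (i : ℤ) (s : SymAlg k Y),
    e s ∈ M.grading i ↔ s ∈ symGrading k Y i

/-- Projective objects of the category of (finitely generated) graded `S_k`-modules. -/
def GrMod.IsProjective (P : GrMod k Y) : Prop :=
  ∀ (M N : GrMod k Y) (g : GrHom M N) (f : GrHom P N), Function.Surjective g →
    ∃ f' : GrHom P M, ∀ p : P, g (f' p) = f p

/-- `d : P → D` is a projective cover of the submodule `D` of `Q`: the graded module `P` is
projective, `d` maps it onto `D`, and the kernel of `d` is superfluous, that is, a graded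
submodule `N` of `P` with `N + ker d = P` is all of `P`. -/
def GrMod.IsProjectiveCover (P : GrMod k Y) {Q : Type*} [AddCommGroup Q] [Module (SymAlg k Y) Q]
    (d : P →ₗ[SymAlg k Y] Q) (D : Submodule (SymAlg k Y) Q) : Prop :=
  P.IsProjective ∧ LinearMap.range d = D ∧
    ∀ N : Submodule (SymAlg k Y) P, N.IsHomogeneous P.grading → N ⊔ LinearMap.ker d = ⊤ → N = ⊤

end GradedModules

/-! ### Sheaves on moment graphs -/

section Sheaves

variable {Y : Type u} [AddCommGroup Y] [Module.Free ℤ Y] [Module.Finite ℤ Y]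
  {V : Type*} [PartialOrder V]

/-- A `k`-sheaf on the moment graph `G`. -/
structure KSheaf (k : Type u) [CommRing k] (G : MomentGraph Y V) where
  stalk : V → GrMod k Y
  edge : ∀ {x y : V}, G.Adj x y → GrMod k Y
  label_smul : ∀ {x y : V} (h : G.Adj x y) (m : edge h), linForm k (G.label h) • m = 0
  /-- the map `ρ_{x,E}` for an edge `E : x → y` -/
  srcMap : ∀ {x y : V} (h : G.Adj x y), GrHom (stalk x) (edge h)
  /-- the map `ρ_{y,E}` for an edge `E : x → y` -/
  tgtMap : ∀ {x y : V} (h : G.Adj x y), GrHom (stalk y) (edge h)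

variable {k : Type u} [CommRing k] {G : MomentGraph Y V}

namespace KSheaf

/-- The module of local sections over a set of vertices. -/
def sections (F : KSheaf k G) (I : Set V) : Submodule (SymAlg k Y) (∀ x : I, F.stalk x) where
  carrier := {m | ∀ (x y : I) (h : G.Adj x y), F.srcMap h (m x) = F.tgtMap h (m y)}
  add_mem' := by
    intro a b ha hb x y h
    simp [ha x y h, hb x y h]
  zero_mem' := by
    intro x y h
    simp
  smul_mem' := by
    intro c a ha x y h
    simp [ha x y h]

/-- The map `d_x` from the stalk at `x` to the sum of the modules on the edges starting at `x`
(in a finite graph the product below is a direct sum). -/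
def d (F : KSheaf k G) (x : V) :
    F.stalk x →ₗ[SymAlg k Y] (∀ E : {y : V // G.Adj x y}, F.edge E.2) :=
  LinearMap.pi fun E => (F.srcMap E.2).toLinearMap

/-- The map `u_x` from the sections over `{y | x < y}` to the sum of the modules on the edges
starting at `x`. -/
def u (F : KSheaf k G) (x : V) :
    F.sections (Set.Ioi x) →ₗ[SymAlg k Y] (∀ E : {y : V // G.Adj x y}, F.edge E.2) :=
  LinearMap.pi fun E => (F.tgtMap E.2).toLinearMap ∘ₗ
    LinearMap.proj (⟨E.1, G.lt_of_adj E.2⟩ : Set.Ioi x) ∘ₗ (F.sections (Set.Ioi x)).subtype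

/-- The module `F^{δx}`. -/
def delta (F : KSheaf k G) (x : V) :
    Submodule (SymAlg k Y) (∀ E : {y : V // G.Adj x y}, F.edge E.2) :=
  LinearMap.range (F.u x)

/-- A graded subsheaf. -/
structure Sub (F : KSheaf k G) where
  stalk : ∀ x : V, Submodule (SymAlg k Y) (F.stalk x)
  edge : ∀ {x y : V} (h : G.Adj x y), Submodule (SymAlg k Y) (F.edge h)
  stalk_homogeneous : ∀ x : V, (stalk x).IsHomogeneous (F.stalk x).grading
  edge_homogeneous : ∀ {x y : V} (h : G.Adj x y), (edge h).IsHomogeneous (F.edge h).grading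
  src_mem : ∀ {x y : V} (h : G.Adj x y) {m : F.stalk x}, m ∈ stalk x → F.srcMap h m ∈ edge h
  tgt_mem : ∀ {x y : V} (h : G.Adj x y) {m : F.stalk y}, m ∈ stalk y → F.tgtMap h m ∈ edge h

/-- The zero subsheaf, as a property. -/
def Sub.IsZero {F : KSheaf k G} (P : F.Sub) : Prop :=
  (∀ x : V, P.stalk x = ⊥) ∧ ∀ {x y : V} (h : G.Adj x y), P.edge h = ⊥

/-- `F` is the direct sum of its subsheaves `P` and `Q`. -/
def Sub.IsDirectSum {F : KSheaf k G} (P Q : F.Sub) : Prop :=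
  (∀ x : V, IsCompl (P.stalk x) (Q.stalk x)) ∧
    ∀ {x y : V} (h : G.Adj x y), IsCompl (P.edge h) (Q.edge h)

/-- `F` is indecomposable: it is not zero, and in every decomposition of `F` as a direct sum of
two subsheaves one summand is zero. -/
def IsIndecomposable (F : KSheaf k G) : Prop :=
  ((∃ x : V, Nontrivial (F.stalk x)) ∨ ∃ (x y : V) (h : G.Adj x y), Nontrivial (F.edge h)) ∧
    ∀ P Q : F.Sub, P.IsDirectSum Q → P.IsZero ∨ Q.IsZero

/-- `F` is the canonical (Braden-MacPherson) sheaf on a finite moment graph with highest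
vertex `w`. -/
structure IsCanonical (F : KSheaf k G) (w : V) : Prop where
  indecomposable : F.IsIndecomposable
  stalk_top : (F.stalk w).IsoSym
  tgtMap_surjective : ∀ {x y : V} (h : G.Adj x y), Function.Surjective (F.tgtMap h)
  tgtMap_eq_zero_iff : ∀ {x y : V} (h : G.Adj x y) (m : F.stalk y),
    F.tgtMap h m = 0 ↔ ∃ m' : F.stalk y, m = linForm k (G.label h) • m'
  projectiveCover : ∀ {x y : V}, G.Adj x y → (F.stalk x).IsProjectiveCover (F.d x) (F.delta x)

end KSheaf

end Sheaves

/-! ### Weyl groups of symmetrisable generalised Cartan matrices -/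

/-- A symmetrisable generalised Cartan matrix. -/
structure SymGCM (n : ℕ) where
  A : Matrix (Fin n) (Fin n) ℤ
  diag : ∀ i, A i i = 2
  nonpos : ∀ i j, i ≠ j → A i j ≤ 0
  zero_symm : ∀ i j, A i j = 0 → A j i = 0
  symmetrisable : ∃ (e : Fin n → ℚ) (B : Matrix (Fin n) (Fin n) ℚ),
    (∀ i, e i ≠ 0) ∧ B.IsSymm ∧ A.map (Int.cast : ℤ → ℚ) = Matrix.diagonal e * B

/-- A realization of the matrix over `ℂ`: the space `H` is the Cartan subalgebra of the associated
Kac-Moody algebra, with its simple roots and simple coroots. -/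
structure Realization {n : ℕ} (C : SymGCM n) (H : Type u) [AddCommGroup H] [Module ℂ H] where
  root : Fin n → Module.Dual ℂ H
  coroot : Fin n → H
  root_linearIndependent : LinearIndependent ℂ root
  coroot_linearIndependent : LinearIndependent ℂ coroot
  pairing : ∀ i j, root j (coroot i) = C.A i j
  finite : Module.Finite ℂ H
  finrank_add_rank : Module.finrank ℂ H + (C.A.map (Int.cast : ℤ → ℂ)).rank = 2 * n

namespace Realization

variable {n : ℕ} {C : SymGCM n} {H : Type u} [AddCommGroup H] [Module ℂ H]
  (R : Realization C H)

lemma root_coroot_self (i : Fin n) : R.root i (R.coroot i) = 2 := by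
  rw [R.pairing, C.diag]; norm_num

/-- The simple reflection `v ↦ v - ⟨α_i, v⟩ α_i^∨` of `H`. -/
noncomputable def simpleReflection (i : Fin n) : H ≃ₗ[ℂ] H :=
  Module.reflection (R.root_coroot_self i)

/-- The Weyl group, as a group of automorphisms of `H`. -/
def weylGroup : Subgroup (H ≃ₗ[ℂ] H) :=
  Subgroup.closure (Set.range R.simpleReflection)

/-- The simple reflections as elements of the Weyl group. -/
noncomputable def s (i : Fin n) : R.weylGroup :=
  ⟨R.simpleReflection i, Subgroup.subset_closure (Set.mem_range_self i)⟩

/-- The length with respect to the simple reflections. -/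
noncomputable def length (w : R.weylGroup) : ℕ :=
  sInf {m : ℕ | ∃ l : List (Fin n), l.length = m ∧ (l.map R.s).prod = w}

/-- The reflections: the conjugates of the simple reflections. -/
def IsReflection (t : R.weylGroup) : Prop :=
  ∃ (w : R.weylGroup) (i : Fin n), t = w * R.s i * w⁻¹

/-- An elementary step in the Bruhat order. -/
def BruhatStep (x y : R.weylGroup) : Prop :=
  ∃ t : R.weylGroup, R.IsReflection t ∧ y = t * x ∧ R.length x < R.length y

lemma BruhatStep.length_le {x y : R.weylGroup} (h : Relation.ReflTransGen R.BruhatStep x y) :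
    x = y ∨ R.length x < R.length y := by
  induction h with
  | refl => exact Or.inl rfl
  | tail _ hs ih =>
    obtain ⟨_, _, _, hl⟩ := hs
    rcases ih with rfl | ih
    · exact Or.inr hl
    · exact Or.inr (ih.trans hl)

/-- The Bruhat order. -/
instance : PartialOrder R.weylGroup where
  le := Relation.ReflTransGen R.BruhatStep
  le_refl _ := Relation.ReflTransGen.refl
  le_trans _ _ _ := Relation.ReflTransGen.trans
  le_antisymm x y hxy hyx := by
    rcases BruhatStep.length_le R hxy with h | h
    · exact h
    · rcases BruhatStep.length_le R hyx with h' | h'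
      · exact h'.symm
      · omega

/-- The standard parabolic subgroup `W_J`. -/
def parabolic (J : Set (Fin n)) : Subgroup R.weylGroup :=
  Subgroup.closure (R.s '' J)

/-- `u` is a longest element of `W_J`. -/
def IsLongest (J : Set (Fin n)) (u : R.weylGroup) : Prop :=
  u ∈ R.parabolic J ∧ ∀ v ∈ R.parabolic J, R.length v ≤ R.length u

/-- The set `W^J` of minimal length representatives of the cosets `x W_J`. -/
def minReps (J : Set (Fin n)) : Set R.weylGroup :=
  {x | ∀ u ∈ R.parabolic J, R.length x ≤ R.length (x * u)}

lemma mem_minReps_empty (x : R.weylGroup) : x ∈ R.minReps ∅ := by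
  intro u hu
  have : u = 1 := by simpa [parabolic] using hu
  simp [this]

/-- `x` as an element of `W^∅ = W`. -/
def toMinRepsEmpty (x : R.weylGroup) : R.minReps ∅ := ⟨x, R.mem_minReps_empty x⟩

/-- The coroot lattice. -/
def corootLattice : Submodule ℤ H := Submodule.span ℤ (Set.range R.coroot)

instance : Module.Finite ℤ R.corootLattice :=
  Module.Finite.span_of_finite ℤ (Set.finite_range R.coroot)

instance : Module.Free ℤ R.corootLattice :=
  Module.Free.of_basis
    (Module.Basis.span (R.coroot_linearIndependent.restrict_scalars' ℤ))

/-- `α` is a positive real root with coroot `c`: for some `w` in the Weyl group and some `i` one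
has `α = w α_i` and `c = w α_i^∨`, and `α` is a combination of simple roots with coefficients in
the natural numbers. -/
def IsPosRealRoot (α : Module.Dual ℂ H) (c : H) : Prop :=
  (∃ (w : R.weylGroup) (i : Fin n),
    α = R.root i ∘ₗ ((w⁻¹ : R.weylGroup) : H ≃ₗ[ℂ] H).toLinearMap ∧
      c = (w : H ≃ₗ[ℂ] H) (R.coroot i)) ∧
    ∃ m : Fin n → ℕ, α = ∑ j, m j • R.root j

/-- There is a positive real root `α` with coroot `c` and an element `u` of `W_J` such that
`y u x⁻¹` is the reflection `s_α : v ↦ v - ⟨α, v⟩ c`. -/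
def IsEdgeLabel (J : Set (Fin n)) (x y : R.weylGroup) (c : H) : Prop :=
  ∃ α : Module.Dual ℂ H, R.IsPosRealRoot α c ∧ ∃ u ∈ R.parabolic J,
    ((y * u * x⁻¹ : R.weylGroup) : H ≃ₗ[ℂ] H).toLinearMap = Module.preReflection c α

lemma weyl_mem_corootLattice (w : R.weylGroup) :
    ∀ c ∈ R.corootLattice, (w : H ≃ₗ[ℂ] H) c ∈ R.corootLattice := by
  have hs : ∀ i, ∀ c ∈ R.corootLattice, R.simpleReflection i c ∈ R.corootLattice := by
    intro i c hc
    induction hc using Submodule.span_induction with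
    | mem x hx =>
      obtain ⟨j, rfl⟩ := hx
      rw [simpleReflection, Module.reflection_apply, R.pairing]
      refine Submodule.sub_mem _ (Submodule.subset_span ⟨j, rfl⟩) ?_
      rw [Int.cast_smul_eq_zsmul]
      exact Submodule.smul_mem _ _ (Submodule.subset_span ⟨i, rfl⟩)
    | zero => simp
    | add x y _ _ hx hy => rw [map_add]; exact Submodule.add_mem _ hx hy
    | smul a x _ hx => rw [map_zsmul]; exact Submodule.smul_mem _ a hx
  have hi : ∀ i, (R.simpleReflection i)⁻¹ = R.simpleReflection i := by
    intro i
    rw [inv_eq_iff_mul_eq_one]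
    ext v
    exact Module.involutive_reflection (R.root_coroot_self i) v
  obtain ⟨w, hw⟩ := w
  have key : (∀ c ∈ R.corootLattice, w c ∈ R.corootLattice) ∧
      ∀ c ∈ R.corootLattice, w⁻¹ c ∈ R.corootLattice := by
    induction hw using Subgroup.closure_induction with
    | mem x hx =>
      obtain ⟨i, rfl⟩ := hx
      rw [hi]
      exact ⟨hs i, hs i⟩
    | one => exact ⟨fun c hc => hc, fun c hc => by simpa using hc⟩
    | mul a b _ _ ha hb =>
      refine ⟨fun c hc => ha.1 _ (hb.1 _ hc), fun c hc => ?_⟩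
      rw [mul_inv_rev]
      exact hb.2 _ (ha.2 _ hc)
    | inv a _ ha => exact ⟨ha.2, by simpa using ha.1⟩
  exact key.1

lemma IsEdgeLabel.mem_ne_zero {J : Set (Fin n)} {x y : R.weylGroup} {c : H}
    (h : R.IsEdgeLabel J x y c) : c ∈ R.corootLattice ∧ c ≠ 0 := by
  obtain ⟨α, ⟨⟨w, i, -, rfl⟩, -⟩, -⟩ := h
  refine ⟨R.weyl_mem_corootLattice w _ (Submodule.subset_span ⟨i, rfl⟩), ?_⟩
  simpa using R.coroot_linearIndependent.ne_zero i

/-- The Bruhat moment graph of `W^J` on the coroot lattice: there is an edge `x → y` if `x < y`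
and `y u x⁻¹ = s_α` for some positive real root `α` and some `u` in `W_J`; its label is the
coroot of `α`. -/
noncomputable def bruhatGraph (J : Set (Fin n)) :
    MomentGraph R.corootLattice (R.minReps J) where
  Adj x y := x < y ∧ ∃ c : H, R.IsEdgeLabel J x y c
  lt_of_adj h := h.1
  label h := ⟨h.2.choose, (IsEdgeLabel.mem_ne_zero R h.2.choose_spec).1⟩
  label_ne_zero h := fun h0 =>
    (IsEdgeLabel.mem_ne_zero R h.2.choose_spec).2 (congrArg Subtype.val h0)

/-- The full subgraph of the Bruhat graph of `W^J` on the vertices `≤ w`. -/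
noncomputable def bruhatGraphLE (J : Set (Fin n)) (w : R.minReps J) :
    MomentGraph R.corootLattice (Set.Iic w) :=
  (R.bruhatGraph J).restrict (Set.Iic w)

end Realization

end MomentSheaf

/-!
Let `π` be the projection from the Bruhat graph of `w w_J` to the parabolic Bruhat graph of `w`, which
sends `v` to the minimal representative of `v W_J`.  It respects the order and the labels: edges
between different cosets are sent to edges with the same label (`edge_push`), and every edge `x → y`
lifts at every point of the coset of `x` (`edge_lift`).  Since `y w_J` is the maximal vertex of the
coset of `y`, the theorem follows once the stalks of the canonical sheaf `B` at `v` and of the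
canonical sheaf `F = B^J` at `π v` are known to be isomorphic for all `v`.

These isomorphisms are constructed vertex by vertex, from the top downwards
(`nonempty_grIso_of_hasExtensions`).  By uniqueness of projective covers (`exists_grIso`), the stalks
of `B` and of `F` at `z` and at `π z` are isomorphic as soon as they have the same boundary values.
The sheaf `B` and the pull-back of `F` being identified above `z`, this says that every section of
the pull-back of `F` over the vertices which lie above `z`, or in cosets above that of `z`, has
boundary values at `z` which come from the stalk of `F` (`HasExtensions`).

That property (`LerayHirsch.hasExtensions`) is a form of the Leray-Hirsch theorem.  Suppose that there
are classes on the Bruhat graph of `W`, indexed by `u ∈ W_J`, whose restriction to every coset of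
`W_J` is triangular, with a product of labels on the diagonal.  As labels at a common vertex are
coprime (this is where the GKM condition enters), every section over an upper part of a coset is a
combination of these classes (`exists_expansion`).  Thus a section of the pull-back over full cosets is
given by sections of `F`, one for each `u`; these extend to the next coset since `F` is canonical, and
what remains is a section over a part of that coset with values in the kernel of the boundary map.

The classes are the equivariant Schubert classes of the elements of `W_J`.  They are the coefficients
of the group elements of the nil Hecke ring with respect to its standard basis, or rather of their
images in the quotient by the generators outside of `J`.  In order to define them over an arbitrary
ring, one lets the simple reflections act on coefficient vectors as `(1 - α^∨ x_α) s_α`, where `x_α`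
is the multiplication by a generator of the nil Coxeter algebra of `W_J`.  These operators satisfy the
braid relations of rank two by an explicit computation (`braid_two`, `braid_three`, `braid_four`,
`braid_six`), hence define an action of the Weyl group (`groupMul`), and the required properties of
`schubert v = v · 1` are immediate: changing `v` by a reflection changes the class by a multiple of
the coroot, and induction on the length yields the triangularity.
-/

namespace MomentSheaf

/-! ### The Weyl group as a Coxeter group -/

/-- The order of the product of two simple reflections in terms of the product
`a i j * a j i` of Cartan matrix entries; `0` stands for infinite order. -/
def cartanOrder (p : ℤ) : ℕ :=
  if p = 0 then 2 else if p = 1 then 3 else if p = 2 then 4 else if p = 3 then 6 else 0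

lemma cartanOrder_ne_one (p : ℤ) : cartanOrder p ≠ 1 := by
  unfold cartanOrder; split_ifs <;> decide

/-- The Coxeter matrix of a generalised Cartan matrix. -/
def SymGCM.coxeterMatrix {n : ℕ} (C : SymGCM n) : CoxeterMatrix (Fin n) where
  M := Matrix.of fun i j => if i = j then 1 else cartanOrder (C.A i j * C.A j i)
  isSymm := by
    ext i j
    simp only [Matrix.transpose_apply, Matrix.of_apply, eq_comm (a := j) (b := i), mul_comm]
  diagonal i := by simp
  off_diagonal i j h := by simpa [h] using cartanOrder_ne_one _

/-- The abstract Coxeter group of a generalised Cartan matrix. -/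
noncomputable abbrev SymGCM.cs {n : ℕ} (C : SymGCM n) :
    CoxeterSystem C.coxeterMatrix C.coxeterMatrix.Group :=
  C.coxeterMatrix.toCoxeterSystem

lemma SymGCM.coxeterMatrix_apply {n : ℕ} (C : SymGCM n) {i j : Fin n} (h : i ≠ j) :
    C.coxeterMatrix i j = cartanOrder (C.A i j * C.A j i) := by
  change (if i = j then 1 else cartanOrder (C.A i j * C.A j i)) = _
  simp [h]

/-- The possible pairs of off-diagonal Cartan matrix entries. -/
lemma SymGCM.entries_cases {n : ℕ} (C : SymGCM n) {i j : Fin n} (h : i ≠ j) :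
    (C.A i j = 0 ∧ C.A j i = 0) ∨ (C.A i j = -1 ∧ C.A j i = -1) ∨
    (C.A i j = -1 ∧ C.A j i = -2) ∨ (C.A i j = -2 ∧ C.A j i = -1) ∨
    (C.A i j = -1 ∧ C.A j i = -3) ∨ (C.A i j = -3 ∧ C.A j i = -1) ∨
    4 ≤ C.A i j * C.A j i := by
  have h1 := C.nonpos i j h
  have h2 := C.nonpos j i h.symm
  have h3 := C.zero_symm i j
  have h4 := C.zero_symm j i
  generalize C.A i j = a at *
  generalize C.A j i = b at *
  by_cases ha : a = 0
  · exact Or.inl ⟨ha, h3 ha⟩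
  by_cases hb : b = 0
  · exact absurd (h4 hb) ha
  by_cases h5 : 4 ≤ a * b
  · tauto
  have ha' : -4 < a := by nlinarith [lt_of_le_of_ne h1 ha, lt_of_le_of_ne h2 hb]
  have hb' : -4 < b := by nlinarith [lt_of_le_of_ne h1 ha, lt_of_le_of_ne h2 hb]
  have ha'' := lt_of_le_of_ne h1 ha
  have hb'' := lt_of_le_of_ne h2 hb
  interval_cases a <;> interval_cases b <;> simp_all

namespace Realization

variable {n : ℕ} {C : SymGCM n} {H : Type u} [AddCommGroup H] [Module ℂ H]
  (R : Realization C H)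

lemma simpleReflection_apply (i : Fin n) (v : H) :
    R.simpleReflection i v = v - R.root i v • R.coroot i := by
  rw [simpleReflection, Module.reflection_apply]

lemma s_coe (i : Fin n) : ((R.s i : R.weylGroup) : H ≃ₗ[ℂ] H) = R.simpleReflection i := rfl

lemma s_apply (i : Fin n) (v : H) :
    ((R.s i : R.weylGroup) : H ≃ₗ[ℂ] H) v = v - R.root i v • R.coroot i :=
  R.simpleReflection_apply i v

lemma s_mul_self (i : Fin n) : R.s i * R.s i = 1 := by
  apply Subtype.ext
  ext v
  exact Module.involutive_reflection (R.root_coroot_self i) v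

lemma s_inv (i : Fin n) : (R.s i)⁻¹ = R.s i := inv_eq_of_mul_eq_one_right (R.s_mul_self i)

lemma simpleReflection_left_comb (i j : Fin n) (v : H) (x y : ℂ) :
    R.simpleReflection i (v + x • R.coroot i + y • R.coroot j) =
      v + (-x - R.root i v - C.A j i * y) • R.coroot i + y • R.coroot j := by
  rw [simpleReflection_apply]
  simp only [map_add, map_smul, R.pairing, C.diag, smul_eq_mul]
  push_cast
  module

lemma simpleReflection_right_comb (i j : Fin n) (v : H) (x y : ℂ) :
    R.simpleReflection j (v + x • R.coroot i + y • R.coroot j) =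
      v + x • R.coroot i + (-y - R.root j v - C.A i j * x) • R.coroot j := by
  rw [simpleReflection_apply]
  simp only [map_add, map_smul, R.pairing, C.diag, smul_eq_mul]
  push_cast
  module

lemma simpleReflection_comb (i j : Fin n) (v : H) (x y : ℂ) :
    R.simpleReflection i (R.simpleReflection j (v + x • R.coroot i + y • R.coroot j)) =
      v + (-x - R.root i v - C.A j i * (-y - R.root j v - C.A i j * x)) • R.coroot i +
        (-y - R.root j v - C.A i j * x) • R.coroot j := by
  rw [simpleReflection_right_comb, simpleReflection_left_comb]

lemma isLiftable_s : C.coxeterMatrix.IsLiftable R.s := by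
  intro i j
  by_cases hij : i = j
  · subst hij
    simp [R.s_mul_self]
  rw [C.coxeterMatrix_apply hij]
  have hv : ∀ v : H, v = v + (0 : ℂ) • R.coroot i + (0 : ℂ) • R.coroot j := by intro v; simp
  have key : ∀ (x y : ℂ) (v : H), x = 0 → y = 0 →
      v + x • R.coroot i + y • R.coroot j = v := by
    rintro x y v rfl rfl; simp
  rcases C.entries_cases hij with h | h | h | h | h | h | h
  all_goals try
    obtain ⟨ha, hb⟩ := h
    rw [ha, hb]
    norm_num [cartanOrder]
    apply Subtype.ext
    ext v
    simp only [pow_succ, pow_zero, one_mul, Subgroup.coe_mul, s_coe, LinearEquiv.mul_apply,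
      Subgroup.coe_one, LinearEquiv.coe_one, id]
    conv_lhs => rw [hv v]
    simp only [simpleReflection_comb, ha, hb]
    apply key
    · push_cast; ring
    · push_cast; ring
  · have : cartanOrder (C.A i j * C.A j i) = 0 := by
      unfold cartanOrder
      split_ifs <;> omega
    rw [this, pow_zero]

/-- The natural action of the Weyl group on the dual space. -/
def act (w : R.weylGroup) (φ : Module.Dual ℂ H) : Module.Dual ℂ H :=
  φ ∘ₗ ((w⁻¹ : R.weylGroup) : H ≃ₗ[ℂ] H).toLinearMap

lemma act_one (φ : Module.Dual ℂ H) : R.act 1 φ = φ := by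
  ext v; simp [act]

lemma act_mul (w w' : R.weylGroup) (φ : Module.Dual ℂ H) :
    R.act (w * w') φ = R.act w (R.act w' φ) := by
  ext v; simp [act, mul_inv_rev]

lemma act_add (w : R.weylGroup) (φ ψ : Module.Dual ℂ H) :
    R.act w (φ + ψ) = R.act w φ + R.act w ψ := by
  ext v; simp [act]

lemma act_neg (w : R.weylGroup) (φ : Module.Dual ℂ H) : R.act w (-φ) = -R.act w φ := by
  ext v; simp [act]

lemma act_zsmul (w : R.weylGroup) (a : ℤ) (φ : Module.Dual ℂ H) :
    R.act w (a • φ) = a • R.act w φ := by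
  ext v; simp [act]

lemma act_nsmul (w : R.weylGroup) (a : ℕ) (φ : Module.Dual ℂ H) :
    R.act w (a • φ) = a • R.act w φ := by
  ext v; simp [act]

lemma act_sum {ι : Type*} (w : R.weylGroup) (t : Finset ι) (f : ι → Module.Dual ℂ H) :
    R.act w (∑ x ∈ t, f x) = ∑ x ∈ t, R.act w (f x) := by
  ext v; simp [act]

lemma act_apply (w : R.weylGroup) (φ : Module.Dual ℂ H) (v : H) :
    R.act w φ v = φ ((w⁻¹ : R.weylGroup).1 v) := rfl

lemma act_s (i j : Fin n) : R.act (R.s i) (R.root j) = R.root j - C.A i j • R.root i := by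
  ext v
  rw [act_apply, s_inv, s_apply]
  simp [R.pairing, mul_comm]

lemma act_s_self (i : Fin n) : R.act (R.s i) (R.root i) = -R.root i := by
  rw [act_s, C.diag]; module

/-- Combinations of simple roots with coefficients in the natural numbers. -/
def IsPos (φ : Module.Dual ℂ H) : Prop := ∃ m : Fin n → ℕ, φ = ∑ j, m j • R.root j

variable {R}

lemma IsPos.add {φ ψ : Module.Dual ℂ H} (h : R.IsPos φ) (h' : R.IsPos ψ) : R.IsPos (φ + ψ) := by
  obtain ⟨m, rfl⟩ := h
  obtain ⟨m', rfl⟩ := h'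
  exact ⟨m + m', by simp [add_smul, Finset.sum_add_distrib]⟩

lemma IsPos.nsmul {φ : Module.Dual ℂ H} (h : R.IsPos φ) (a : ℕ) : R.IsPos (a • φ) := by
  obtain ⟨m, rfl⟩ := h
  exact ⟨a • m, by simp [Finset.smul_sum, mul_smul]⟩

variable (R) in
lemma isPos_zero : R.IsPos 0 := ⟨0, by simp⟩

variable (R) in
lemma isPos_root (i : Fin n) : R.IsPos (R.root i) :=
  ⟨Pi.single i 1, by simp [Pi.single_apply, ite_smul]⟩

lemma IsPos.sum {ι : Type*} {t : Finset ι} {f : ι → Module.Dual ℂ H}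
    (h : ∀ x ∈ t, R.IsPos (f x)) : R.IsPos (∑ x ∈ t, f x) := by
  classical
  induction t using Finset.induction_on with
  | empty => simpa using R.isPos_zero
  | insert a t ha ih =>
    rw [Finset.sum_insert ha]
    exact (h a (Finset.mem_insert_self a t)).add
      (ih fun x hx => h x (Finset.mem_insert_of_mem hx))

variable (R)

/-- Coordinates with respect to the simple roots are unique. -/
lemma root_coeff_ext {m m' : Fin n → ℤ} (h : ∑ j, m j • R.root j = ∑ j, m' j • R.root j) :
    m = m' := by
  have := R.root_linearIndependent.restrict_scalars' ℤ
  rw [Fintype.linearIndependent_iff] at this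
  have h2 := this (fun j => m j - m' j) (by
    simp only [sub_smul, Finset.sum_sub_distrib, h, sub_self])
  funext j
  have := h2 j
  omega

variable {R}

lemma IsPos.eq_zero_of_neg {φ : Module.Dual ℂ H} (h : R.IsPos φ) (h' : R.IsPos (-φ)) : φ = 0 := by
  obtain ⟨m, hm⟩ := h
  obtain ⟨m', hm'⟩ := h'
  have h1 : ∑ j, ((m j : ℤ) + m' j) • R.root j = ∑ j, (0 : ℤ) • R.root j := by
    simp only [add_smul, Finset.sum_add_distrib, natCast_zsmul, zero_smul, Finset.sum_const_zero]
    rw [← hm, ← hm']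
    simp
  have h2 := R.root_coeff_ext h1
  have h3 : m = 0 := by
    funext j
    have := congrFun h2 j
    simp only [Pi.zero_apply] at *
    omega
  simp [hm, h3]

variable (R)

/-- The coordinates of the alternating products of two simple reflections, applied to a simple
root, in terms of `a = -a i j` and `b = -a j i`. -/
def dihedralCoord (a b : ℤ) : ℕ → ℤ × ℤ
  | 0 => (1, 0)
  | k + 1 => if Even k then
      ((dihedralCoord a b k).1, b * (dihedralCoord a b k).1 - (dihedralCoord a b k).2)
    else (a * (dihedralCoord a b k).2 - (dihedralCoord a b k).1, (dihedralCoord a b k).2)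

lemma dihedralCoord_nonneg_of_four_le {a b : ℤ} (ha : 0 ≤ a) (hb : 0 ≤ b) (hab : 4 ≤ a * b)
    (k : ℕ) : 0 ≤ (dihedralCoord a b k).1 ∧ 0 ≤ (dihedralCoord a b k).2 ∧
      (Even k → 2 * (dihedralCoord a b k).2 ≤ b * (dihedralCoord a b k).1) ∧
      (¬ Even k → 2 * (dihedralCoord a b k).1 ≤ a * (dihedralCoord a b k).2) := by
  induction k with
  | zero => simpa [dihedralCoord] using hb
  | succ k ih =>
    obtain ⟨h1, h2, h3, h4⟩ := ih
    rw [dihedralCoord]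
    generalize (dihedralCoord a b k).1 = p at *
    generalize (dihedralCoord a b k).2 = q at *
    by_cases hk : Even k
    · have h3 := h3 hk
      simp only [hk, if_true, Nat.even_add_one, not_true, false_imp_iff, true_and, not_false_iff,
        true_imp_iff]
      exact ⟨h1, by linarith, by nlinarith⟩
    · have h4 := h4 hk
      simp only [hk, if_false, Nat.even_add_one, not_true, false_imp_iff, and_true, not_false_iff,
        true_imp_iff]
      exact ⟨by linarith, h2, by nlinarith⟩

lemma dihedralCoord_nonneg {i j : Fin n} (hij : i ≠ j) (k : ℕ)
    (hk : C.coxeterMatrix i j = 0 ∨ k < C.coxeterMatrix i j) :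
    0 ≤ (dihedralCoord (-C.A i j) (-C.A j i) k).1 ∧
      0 ≤ (dihedralCoord (-C.A i j) (-C.A j i) k).2 := by
  rw [C.coxeterMatrix_apply hij] at hk
  rcases C.entries_cases hij with h | h | h | h | h | h | h
  all_goals try
    obtain ⟨ha, hb⟩ := h
    rw [ha, hb] at hk
    norm_num [cartanOrder] at hk
    rw [ha, hb]
    interval_cases k <;> decide
  have h1 := C.nonpos i j hij
  have h2 := C.nonpos j i hij.symm
  have := dihedralCoord_nonneg_of_four_le (a := -C.A i j) (b := -C.A j i) (by omega) (by omega)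
    (by linarith) k
  exact ⟨this.1, this.2.1⟩

/-- The canonical homomorphism from the abstract Coxeter group onto the Weyl group. -/
noncomputable def coxeterHom : C.coxeterMatrix.Group →* R.weylGroup :=
  C.cs.lift ⟨R.s, R.isLiftable_s⟩

lemma coxeterHom_simple (i : Fin n) :
    R.coxeterHom (C.cs.simple i) = R.s i :=
  C.cs.lift_apply_simple R.isLiftable_s i

lemma act_alternatingWord (i j : Fin n) (k : ℕ) :
    R.act (R.coxeterHom (C.cs.wordProd
      (CoxeterSystem.alternatingWord i j k))) (R.root i) =
      (dihedralCoord (-C.A i j) (-C.A j i) k).1 • R.root i +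
        (dihedralCoord (-C.A i j) (-C.A j i) k).2 • R.root j := by
  induction k with
  | zero => simp [CoxeterSystem.alternatingWord, dihedralCoord, act_one]
  | succ k ih =>
    rw [CoxeterSystem.alternatingWord_succ', CoxeterSystem.wordProd_cons, map_mul, act_mul, ih,
      dihedralCoord, coxeterHom_simple, act_add, act_zsmul, act_zsmul]
    by_cases hk : Even k
    · simp only [hk, if_true, act_s, C.diag]
      module
    · simp only [hk, if_false, act_s, C.diag]
      module

/-- The basic positivity theorem: a simple root stays positive under `w` if the corresponding simple
reflection makes `w` longer.  The proof splits off from `w` on the right the longest possible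
alternating word in two simple reflections. -/
theorem isPos_act_of_length_lt (w : C.coxeterMatrix.Group) (i : Fin n)
    (h : C.cs.length w < C.cs.length (w * C.cs.simple i)) :
    R.IsPos (R.act (R.coxeterHom w) (R.root i)) := by
  induction hl : C.cs.length w using Nat.strong_induction_on generalizing w i with
  | _ N ih =>
  by_cases hw : w = 1
  · subst hw
    rw [map_one, act_one]
    exact R.isPos_root i
  obtain ⟨j, hj⟩ := C.cs.exists_rightDescent_of_ne_one hw
  have hij : i ≠ j := by
    rintro rfl
    exact absurd hj (not_lt.2 h.le)
  let Q : ℕ → Prop := fun k => ∃ v, w = v * C.cs.wordProd (CoxeterSystem.alternatingWord i j k) ∧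
    C.cs.length w = C.cs.length v + k
  classical
  have hQ1 : Q 1 := by
    refine ⟨w * C.cs.simple j, ?_, ?_⟩
    · rw [CoxeterSystem.alternatingWord_succ', CoxeterSystem.wordProd_cons]
      simp only [Even.zero, if_true, ← mul_assoc, CoxeterSystem.simple_mul_simple_cancel_right]
      simp [CoxeterSystem.alternatingWord]
    · exact (C.cs.isRightDescent_iff.1 hj).symm
  have hQle : ∀ k, Q k → k ≤ N := by
    rintro k ⟨v, -, hv⟩
    omega
  obtain ⟨k, hkdef⟩ : ∃ k, k = Nat.findGreatest Q N := ⟨_, rfl⟩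
  have hQk : Q k := hkdef ▸ Nat.findGreatest_spec (hQle 1 hQ1) hQ1
  have hk1 : 1 ≤ k := hkdef ▸ Nat.le_findGreatest (hQle 1 hQ1) hQ1
  have hQmax : ¬ Q (k + 1) := fun hq => by
    have := Nat.le_findGreatest (hQle _ hq) hq
    omega
  obtain ⟨v, hwv, hlv⟩ := hQk
  have hlt : ∀ e, C.cs.length (v * C.cs.simple e) ≠ C.cs.length v :=
    fun e => C.cs.length_mul_simple_ne v e
  have hcase := fun e => C.cs.length_mul_simple v e
  -- the letter that would prolong the alternating word to the left
  have he : C.cs.length v < C.cs.length (v * C.cs.simple (if Even k then j else i)) := by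
    by_contra hcon
    apply hQmax
    refine ⟨v * C.cs.simple (if Even k then j else i), ?_, ?_⟩
    · rw [CoxeterSystem.alternatingWord_succ', CoxeterSystem.wordProd_cons, ← mul_assoc,
        CoxeterSystem.simple_mul_simple_cancel_right]
      exact hwv
    · rcases hcase (if Even k then j else i) with h' | h' <;> omega
  -- the first letter of the alternating word
  have hf : C.cs.length v < C.cs.length (v * C.cs.simple (if Even k then i else j)) := by
    by_contra hcon
    obtain ⟨k', rfl⟩ : ∃ k', k = k' + 1 := ⟨k - 1, by omega⟩
    have hw' : w = v * C.cs.simple (if Even (k' + 1) then i else j) *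
        C.cs.wordProd (CoxeterSystem.alternatingWord i j k') := by
      rw [hwv, CoxeterSystem.alternatingWord_succ', CoxeterSystem.wordProd_cons, ← mul_assoc]
      congr 3
      by_cases hk' : Even k' <;> simp [hk', Nat.even_add_one]
    have h1 := C.cs.length_mul_le (v * C.cs.simple (if Even (k' + 1) then i else j))
      (C.cs.wordProd (CoxeterSystem.alternatingWord i j k'))
    rw [← hw'] at h1
    have h2 := C.cs.length_wordProd_le (CoxeterSystem.alternatingWord i j k')
    rw [CoxeterSystem.length_alternatingWord] at h2
    rcases hcase (if Even (k' + 1) then i else j) with h' | h' <;> omega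
  have hvi : R.IsPos (R.act (R.coxeterHom v) (R.root i)) ∧
      R.IsPos (R.act (R.coxeterHom v) (R.root j)) := by
    by_cases hk : Even k
    · simp only [hk, if_true] at he hf
      exact ⟨ih _ (by omega) v i hf rfl, ih _ (by omega) v j he rfl⟩
    · simp only [hk, if_false] at he hf
      exact ⟨ih _ (by omega) v i he rfl, ih _ (by omega) v j hf rfl⟩
  have hkM : C.coxeterMatrix i j = 0 ∨ k < C.coxeterMatrix i j := by
    by_contra! hcon
    obtain ⟨hM, hkM⟩ := hcon
    have hle := C.cs.length_mul_le v (C.cs.wordProd (CoxeterSystem.alternatingWord i j k))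
    rw [← hwv] at hle
    rcases hkM.lt_or_eq with hlt' | heq
    · apply C.cs.not_isReduced_alternatingWord i j hM hlt'
      have := C.cs.length_wordProd_le (CoxeterSystem.alternatingWord i j k)
      rw [CoxeterSystem.IsReduced]
      rw [CoxeterSystem.length_alternatingWord] at *
      omega
    · have hbr := C.cs.wordProd_braidWord_eq i j
      rw [CoxeterSystem.braidWord, CoxeterSystem.braidWord, C.coxeterMatrix.symmetric j i, heq]
        at hbr
      rw [hbr] at hwv
      obtain ⟨k', hk'⟩ : ∃ k', k = k' + 1 := ⟨k - 1, by omega⟩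
      rw [hk', CoxeterSystem.alternatingWord_succ, CoxeterSystem.wordProd_concat, ← mul_assoc]
        at hwv
      rw [hwv, CoxeterSystem.simple_mul_simple_cancel_right, ← hwv] at h
      have h1 := C.cs.length_mul_le v (C.cs.wordProd (CoxeterSystem.alternatingWord i j k'))
      have h2 := C.cs.length_wordProd_le (CoxeterSystem.alternatingWord i j k')
      rw [CoxeterSystem.length_alternatingWord] at h2
      omega
  obtain ⟨hp, hq⟩ := dihedralCoord_nonneg hij k hkM
  rw [hwv, map_mul, act_mul, act_alternatingWord, act_add, act_zsmul, act_zsmul]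
  obtain ⟨p, hp⟩ := Int.eq_ofNat_of_zero_le hp
  obtain ⟨q, hq⟩ := Int.eq_ofNat_of_zero_le hq
  rw [hp, hq, natCast_zsmul, natCast_zsmul]
  exact (hvi.1.nsmul p).add (hvi.2.nsmul q)

lemma root_not_neg (i : Fin n) : ¬ R.IsPos (-R.root i) := fun h =>
  R.root_linearIndependent.ne_zero i ((R.isPos_root i).eq_zero_of_neg h)

lemma coxeterHom_injective : Function.Injective R.coxeterHom := by
  rw [injective_iff_map_eq_one]
  intro w hw
  by_contra hne
  obtain ⟨i, hi⟩ := C.cs.exists_rightDescent_of_ne_one hne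
  have h1 := R.isPos_act_of_length_lt (w * C.cs.simple i) i (by
    rw [CoxeterSystem.simple_mul_simple_cancel_right]
    exact hi)
  rw [map_mul, hw, one_mul, coxeterHom_simple, act_s_self] at h1
  exact R.root_not_neg i h1

lemma coxeterHom_surjective : Function.Surjective R.coxeterHom := by
  rintro ⟨w, hw⟩
  induction hw using Subgroup.closure_induction with
  | mem x hx =>
    obtain ⟨i, rfl⟩ := hx
    exact ⟨_, R.coxeterHom_simple i⟩
  | one => exact ⟨1, map_one _⟩
  | mul a b ha hb h1 h2 =>
    obtain ⟨a', h1⟩ := h1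
    obtain ⟨b', h2⟩ := h2
    exact ⟨a' * b', by rw [map_mul, h1, h2]; rfl⟩
  | inv a ha h1 =>
    obtain ⟨a', h1⟩ := h1
    exact ⟨a'⁻¹, by rw [map_inv, h1]; rfl⟩

/-- The Weyl group with its simple reflections is a Coxeter system. -/
noncomputable def cs : CoxeterSystem C.coxeterMatrix R.weylGroup :=
  C.coxeterMatrix.toCoxeterSystem.map
    (MulEquiv.ofBijective R.coxeterHom ⟨R.coxeterHom_injective, R.coxeterHom_surjective⟩)

lemma cs_simple (i : Fin n) : R.cs.simple i = R.s i := by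
  rw [← coxeterHom_simple]
  rfl

lemma cs_wordProd (l : List (Fin n)) : R.cs.wordProd l = (l.map R.s).prod := by
  rw [CoxeterSystem.wordProd]
  congr 2

lemma cs_length (w : R.weylGroup) : R.cs.length w = R.length w := by
  apply le_antisymm
  · apply le_csInf
    · obtain ⟨l, -, rfl⟩ := R.cs.exists_isReduced w
      exact ⟨_, l, rfl, (R.cs_wordProd l).symm⟩
    · rintro m ⟨l, rfl, rfl⟩
      rw [← cs_wordProd]
      exact R.cs.length_wordProd_le l
  · obtain ⟨l, hl, rfl⟩ := R.cs.exists_isReduced w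
    exact Nat.sInf_le ⟨l, hl.eq.symm, (R.cs_wordProd l).symm⟩

lemma length_coxeterHom (w : C.coxeterMatrix.Group) :
    R.length (R.coxeterHom w) = C.cs.length w := by
  have hmap : ∀ l : List (Fin n), R.coxeterHom (C.cs.wordProd l) = (l.map R.s).prod := by
    intro l
    induction l with
    | nil => simp
    | cons a l ih => rw [CoxeterSystem.wordProd_cons, map_mul, ih, coxeterHom_simple]; simp
  rw [← R.cs_length]
  apply le_antisymm
  · obtain ⟨l, hl, rfl⟩ := C.cs.exists_isReduced w
    rw [hl.eq, hmap, ← cs_wordProd]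
    exact R.cs.length_wordProd_le l
  · obtain ⟨l, hl, hw⟩ := R.cs.exists_isReduced (R.coxeterHom w)
    rw [cs_wordProd, ← hmap] at hw
    rw [hw, hmap, ← cs_wordProd, hl.eq, R.coxeterHom_injective hw]
    exact C.cs.length_wordProd_le l

theorem isPos_act_root (w : R.weylGroup) (i : Fin n) (h : R.length w < R.length (w * R.s i)) :
    R.IsPos (R.act w (R.root i)) := by
  obtain ⟨w, rfl⟩ := R.coxeterHom_surjective w
  apply R.isPos_act_of_length_lt
  rwa [← R.length_coxeterHom, ← R.length_coxeterHom, map_mul, coxeterHom_simple]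

end Realization

namespace Realization

variable {n : ℕ} {C : SymGCM n} {H : Type u} [AddCommGroup H] [Module ℂ H]
  (R : Realization C H)

/-! ### Lengths, reflections and positive real roots -/

lemma length_mul_s (w : R.weylGroup) (i : Fin n) :
    R.length (w * R.s i) = R.length w + 1 ∨ R.length (w * R.s i) + 1 = R.length w := by
  simpa only [cs_length, cs_simple] using R.cs.length_mul_simple w i

lemma length_s_mul (w : R.weylGroup) (i : Fin n) :
    R.length (R.s i * w) = R.length w + 1 ∨ R.length (R.s i * w) + 1 = R.length w := by
  simpa only [cs_length, cs_simple] using R.cs.length_simple_mul w i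

lemma length_inv (w : R.weylGroup) : R.length w⁻¹ = R.length w := by
  simpa only [cs_length] using R.cs.length_inv w

lemma length_one : R.length 1 = 0 := by
  simpa only [cs_length] using R.cs.length_one

lemma length_eq_zero_iff {w : R.weylGroup} : R.length w = 0 ↔ w = 1 := by
  simpa only [cs_length] using R.cs.length_eq_zero_iff (w := w)

lemma mul_s_mul_s (w : R.weylGroup) (i : Fin n) : w * R.s i * R.s i = w := by
  rw [mul_assoc, s_mul_self, mul_one]

lemma exists_rightDescent {w : R.weylGroup} (hw : w ≠ 1) :
    ∃ i, R.length (w * R.s i) < R.length w := by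
  simpa only [CoxeterSystem.IsRightDescent, cs_length, cs_simple] using
    R.cs.exists_rightDescent_of_ne_one hw

lemma exists_leftDescent {w : R.weylGroup} (hw : w ≠ 1) :
    ∃ i, R.length (R.s i * w) < R.length w := by
  simpa only [CoxeterSystem.IsLeftDescent, cs_length, cs_simple] using
    R.cs.exists_leftDescent_of_ne_one hw

lemma isPos_neg_act_root (w : R.weylGroup) (i : Fin n) (h : R.length (w * R.s i) < R.length w) :
    R.IsPos (-R.act w (R.root i)) := by
  have h1 := R.isPos_act_root (w * R.s i) i (by rwa [mul_s_mul_s])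
  rwa [act_mul, act_s_self, act_neg] at h1

lemma act_inv_act (w : R.weylGroup) (φ : Module.Dual ℂ H) : R.act w⁻¹ (R.act w φ) = φ := by
  rw [← act_mul, inv_mul_cancel, act_one]

lemma act_root_ne_zero (w : R.weylGroup) (i : Fin n) : R.act w (R.root i) ≠ 0 := by
  intro h
  have := R.act_inv_act w (R.root i)
  rw [h] at this
  exact R.root_linearIndependent.ne_zero i (by rw [← this]; ext v; simp [act])

lemma pos_or_neg (w : R.weylGroup) (i : Fin n) :
    R.IsPos (R.act w (R.root i)) ∨ R.IsPos (-R.act w (R.root i)) := by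
  rcases R.length_mul_s w i with h | h
  · exact Or.inl (R.isPos_act_root w i (by omega))
  · exact Or.inr (R.isPos_neg_act_root w i (by omega))

lemma not_pos_and_neg (w : R.weylGroup) (i : Fin n) (h : R.IsPos (R.act w (R.root i))) :
    ¬ R.IsPos (-R.act w (R.root i)) := fun h' =>
  R.act_root_ne_zero w i (h.eq_zero_of_neg h')

lemma isPos_act_root_iff (w : R.weylGroup) (i : Fin n) :
    R.IsPos (R.act w (R.root i)) ↔ R.length w < R.length (w * R.s i) := by
  refine ⟨fun h => ?_, R.isPos_act_root w i⟩
  by_contra hcon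
  have := R.length_mul_s w i
  exact R.not_pos_and_neg w i h (R.isPos_neg_act_root w i (by omega))

/-- The reflection attached to the simple root `i` and `a` in the Weyl group. -/
noncomputable def refl (a : R.weylGroup) (i : Fin n) : R.weylGroup := a * R.s i * a⁻¹

lemma refl_apply (a : R.weylGroup) (i : Fin n) (v : H) :
    ((R.refl a i : R.weylGroup) : H ≃ₗ[ℂ] H) v =
      v - R.act a (R.root i) v • (a : H ≃ₗ[ℂ] H) (R.coroot i) := by
  have h : (a : H ≃ₗ[ℂ] H) (((a⁻¹ : R.weylGroup) : H ≃ₗ[ℂ] H) v) = v := by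
    rw [← LinearEquiv.mul_apply, ← Subgroup.coe_mul, mul_inv_cancel]; rfl
  simp only [refl, Subgroup.coe_mul, LinearEquiv.mul_apply]
  rw [s_apply, map_sub, map_smul, h]
  rfl

lemma refl_mul_self (a : R.weylGroup) (i : Fin n) : R.refl a i * R.refl a i = 1 := by
  unfold refl
  rw [show a * R.s i * a⁻¹ * (a * R.s i * a⁻¹) = a * (R.s i * R.s i) * a⁻¹ by group, s_mul_self]
  group

lemma refl_inv (a : R.weylGroup) (i : Fin n) : (R.refl a i)⁻¹ = R.refl a i :=
  inv_eq_of_mul_eq_one_right (R.refl_mul_self a i)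

lemma refl_mul_s (a : R.weylGroup) (i : Fin n) : R.refl (a * R.s i) i = R.refl a i := by
  unfold refl
  rw [mul_inv_rev, s_inv, mul_s_mul_s]
  group

lemma refl_conj (b a : R.weylGroup) (i : Fin n) : R.refl (b * a) i = b * R.refl a i * b⁻¹ := by
  unfold refl
  group

lemma act_refl_self (a : R.weylGroup) (i : Fin n) :
    R.act (R.refl a i) (R.act a (R.root i)) = -R.act a (R.root i) := by
  rw [← act_mul, refl, inv_mul_cancel_right, act_mul, act_s_self, act_neg]

lemma s_perm {a : R.weylGroup} {i j : Fin n} (hpos : R.IsPos (R.act a (R.root i)))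
    (hne : R.act a (R.root i) ≠ R.root j) :
    R.IsPos (R.act (R.s j) (R.act a (R.root i))) := by
  rw [← act_mul]
  refine (R.pos_or_neg (R.s j * a) i).resolve_right fun hneg => ?_
  rw [act_mul] at hneg
  obtain ⟨m, hm⟩ := hpos
  obtain ⟨m', hm'⟩ := hneg
  rw [hm] at hm'
  -- all coefficients of the root apart from the one of `root j` vanish
  have hz : ∀ l, l ≠ j → m l = 0 := by
    have h1 : ∑ l, ((m l : ℤ) + m' l) • R.root l =
        ∑ l, (if l = j then ∑ l', (m l' : ℤ) * C.A j l' else 0) • R.root l := by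
      simp only [ite_smul, zero_smul, Finset.sum_ite_eq', Finset.mem_univ, if_true, add_smul,
        Finset.sum_add_distrib, natCast_zsmul]
      rw [← hm', act_sum]
      simp only [act_nsmul, act_s, smul_sub, Finset.sum_sub_distrib, neg_sub]
      rw [add_sub_cancel, Finset.sum_smul]
      refine Finset.sum_congr rfl fun l _ => ?_
      rw [mul_smul, natCast_zsmul]
    intro l hl
    have := congrFun (R.root_coeff_ext h1) l
    simp only [hl, if_false] at this
    omega
  have hm2 : R.act a (R.root i) = m j • R.root j := by
    rw [hm]
    exact Finset.sum_eq_single j (fun l _ hl => by rw [hz l hl, zero_smul]) (by simp)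
  have hroot : R.root i = m j • R.act a⁻¹ (R.root j) := by
    rw [← act_nsmul, ← hm2, act_inv_act]
  -- the coefficient of a multiple of a simple root that is a root divides one
  have h1 : m j = 1 := by
    rcases R.pos_or_neg a⁻¹ j with ⟨p, hp⟩ | ⟨p, hp⟩
    · rw [hp] at hroot
      have := R.root_coeff_ext (m := Pi.single i 1) (m' := fun l => m j * p l) (by
        simp only [Pi.single_apply, ite_smul, zero_smul, one_smul, Finset.sum_ite_eq',
          Finset.mem_univ, if_true]
        rw [hroot, Finset.smul_sum]
        refine Finset.sum_congr rfl fun l _ => ?_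
        rw [mul_smul, natCast_zsmul, natCast_zsmul])
      have := congrFun this i
      rw [Pi.single_eq_same] at this
      exact Nat.eq_one_of_mul_eq_one_right (by exact_mod_cast this.symm)
    · exfalso
      apply R.root_not_neg i
      rw [hroot, ← smul_neg, hp]
      exact IsPos.nsmul ⟨p, rfl⟩ _
  exact hne (by rw [hm2, h1, one_smul])

/-- A positive root determines its reflection. -/
lemma refl_eq_s {a : R.weylGroup} {i j : Fin n} (h : R.act a (R.root i) = R.root j) :
    R.refl a i = R.s j := by
  by_contra hne
  have h1 : R.refl a i * R.s j ≠ 1 := fun h1 => hne (by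
    rw [← R.s_inv j]; exact mul_eq_one_iff_eq_inv.1 h1)
  have h2 : R.root j ((a : H ≃ₗ[ℂ] H) (R.coroot i)) = 2 := by
    rw [← h, act_apply, ← LinearEquiv.mul_apply, ← Subgroup.coe_mul, inv_mul_cancel]
    exact R.root_coroot_self i
  have hc : ∀ l, ∃ m : ℂ, R.act (R.refl a i * R.s j) (R.root l) = R.root l - m • R.root j ∧
      (l = j → m = 0) := by
    intro l
    refine ⟨R.root l ((a : H ≃ₗ[ℂ] H) (R.coroot i)) - R.root l (R.coroot j), ?_, ?_⟩
    · ext v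
      rw [act_apply, mul_inv_rev, s_inv, refl_inv]
      simp only [Subgroup.coe_mul, LinearEquiv.mul_apply]
      rw [refl_apply, s_apply, h]
      simp only [map_sub, map_smul, h2, smul_eq_mul, LinearMap.sub_apply, LinearMap.smul_apply]
      ring
    · rintro rfl
      rw [h2, R.root_coroot_self, sub_self]
  obtain ⟨l, hl⟩ := R.exists_rightDescent h1
  have hneg := R.isPos_neg_act_root _ _ hl
  obtain ⟨m, hm, hmj⟩ := hc l
  rw [hm] at hneg
  by_cases hlj : l = j
  · rw [hmj hlj, zero_smul, sub_zero] at hneg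
    exact R.root_not_neg l hneg
  · obtain ⟨p, hp⟩ := hneg
    have hli := R.root_linearIndependent
    rw [Fintype.linearIndependent_iff] at hli
    have := hli (fun x => (p x : ℂ) + (if x = l then 1 else 0) - (if x = j then m else 0)) (by
      simp only [sub_smul, add_smul, Finset.sum_sub_distrib, Finset.sum_add_distrib, ite_smul,
        zero_smul, one_smul, Finset.sum_ite_eq', Finset.mem_univ, if_true, Nat.cast_smul_eq_nsmul]
      rw [← hp]
      module) l
    simp only [if_true, hlj, if_false, sub_zero] at this
    have h3 : ((p l + 1 : ℕ) : ℂ) = 0 := by exact_mod_cast this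
    exact absurd (Nat.cast_eq_zero.1 h3) (Nat.succ_ne_zero _)

/-- The strong exchange property, in terms of roots. -/
lemma length_refl_mul_lt {a v : R.weylGroup} {i : Fin n} (hpos : R.IsPos (R.act a (R.root i)))
    (hneg : R.IsPos (-R.act v⁻¹ (R.act a (R.root i)))) :
    R.length (R.refl a i * v) < R.length v := by
  induction hl : R.length v using Nat.strong_induction_on generalizing v a with
  | _ N ih =>
  by_cases hv : v = 1
  · subst hv
    rw [inv_one, act_one] at hneg
    exact absurd hneg (R.not_pos_and_neg a i hpos)
  obtain ⟨j, hj⟩ := R.exists_leftDescent hv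
  by_cases hroot : R.act a (R.root i) = R.root j
  · rw [R.refl_eq_s hroot, ← hl]
    exact hj
  · have h1 := R.s_perm hpos hroot
    rw [← act_mul] at h1
    have h2 := ih (R.length (R.s j * v)) (by omega) (v := R.s j * v) (a := R.s j * a) h1 (by
      rw [← act_mul, mul_inv_rev, s_inv]
      rw [← act_mul] at hneg
      rwa [show v⁻¹ * R.s j * (R.s j * a) = v⁻¹ * (R.s j * R.s j) * a by group, s_mul_self,
        mul_one]) rfl
    rw [refl_conj, s_inv, show R.s j * R.refl a i * R.s j * (R.s j * v) =
      R.s j * R.refl a i * (R.s j * R.s j) * v by group, s_mul_self, mul_one] at h2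
    have h3 := R.length_s_mul (R.s j * R.refl a i * v) j
    rw [show R.s j * (R.s j * R.refl a i * v) = (R.s j * R.s j) * (R.refl a i * v) by group,
      s_mul_self, one_mul] at h3
    omega

lemma length_lt_refl_mul {a v : R.weylGroup} {i : Fin n} (hpos : R.IsPos (R.act a (R.root i)))
    (hpos' : R.IsPos (R.act v⁻¹ (R.act a (R.root i)))) :
    R.length v < R.length (R.refl a i * v) := by
  have h := R.length_refl_mul_lt (v := R.refl a i * v) hpos (by
    rwa [mul_inv_rev, refl_inv, act_mul, act_refl_self, act_neg, neg_neg])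
  rwa [← mul_assoc, refl_mul_self, one_mul] at h

lemma isPos_act_inv_iff {a v : R.weylGroup} {i : Fin n} (hpos : R.IsPos (R.act a (R.root i))) :
    R.IsPos (R.act v⁻¹ (R.act a (R.root i))) ↔ R.length v < R.length (R.refl a i * v) := by
  refine ⟨R.length_lt_refl_mul hpos, fun h => ?_⟩
  by_contra hcon
  have h1 := R.pos_or_neg (v⁻¹ * a) i
  rw [act_mul] at h1
  have := R.length_refl_mul_lt hpos (h1.resolve_left hcon)
  omega

lemma isPos_neg_act_inv_iff {a v : R.weylGroup} {i : Fin n}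
    (hpos : R.IsPos (R.act a (R.root i))) :
    R.IsPos (-R.act v⁻¹ (R.act a (R.root i))) ↔ R.length (R.refl a i * v) < R.length v := by
  refine ⟨R.length_refl_mul_lt hpos, fun h => ?_⟩
  have h1 := R.pos_or_neg (v⁻¹ * a) i
  rw [act_mul] at h1
  refine h1.resolve_left fun hcon => ?_
  have := R.length_lt_refl_mul hpos hcon
  omega

lemma exists_refl_pos {t : R.weylGroup} (ht : R.IsReflection t) :
    ∃ (a : R.weylGroup) (i : Fin n), t = R.refl a i ∧ R.IsPos (R.act a (R.root i)) := by
  obtain ⟨a, i, rfl⟩ := ht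
  rcases R.pos_or_neg a i with h | h
  · exact ⟨a, i, rfl, h⟩
  · exact ⟨a * R.s i, i, (R.refl_mul_s a i).symm, by rwa [act_mul, act_s_self, act_neg]⟩

lemma isReflection_refl (a : R.weylGroup) (i : Fin n) : R.IsReflection (R.refl a i) := ⟨a, i, rfl⟩

lemma length_refl_mul_ne (a v : R.weylGroup) (i : Fin n) :
    R.length (R.refl a i * v) ≠ R.length v := by
  obtain ⟨b, j, h, hpos⟩ := R.exists_refl_pos (R.isReflection_refl a i)
  rw [h]
  rcases R.pos_or_neg (v⁻¹ * b) j with h | h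
  · rw [act_mul] at h
    exact ((R.isPos_act_inv_iff hpos).1 h).ne'
  · rw [act_mul] at h
    exact ((R.isPos_neg_act_inv_iff hpos).1 h).ne

/-! ### The Bruhat order -/

lemma le_of_step {x y : R.weylGroup} (h : R.BruhatStep x y) : x ≤ y :=
  Relation.ReflTransGen.single h

lemma lt_of_step {x y : R.weylGroup} (h : R.BruhatStep x y) : x < y := by
  refine lt_of_le_of_ne (R.le_of_step h) fun he => ?_
  obtain ⟨t, -, -, hl⟩ := h
  rw [he] at hl
  exact lt_irrefl _ hl

lemma length_lt_of_lt {x y : R.weylGroup} (h : x < y) : R.length x < R.length y :=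
  (BruhatStep.length_le R h.le).resolve_left h.ne

lemma length_le_of_le {x y : R.weylGroup} (h : x ≤ y) : R.length x ≤ R.length y := by
  rcases BruhatStep.length_le R h with rfl | h
  · exact le_rfl
  · exact h.le

lemma lt_refl_mul {a x : R.weylGroup} {i : Fin n} (h : R.length x < R.length (R.refl a i * x)) :
    x < R.refl a i * x :=
  R.lt_of_step ⟨_, R.isReflection_refl a i, rfl, h⟩

lemma mul_s_eq (x : R.weylGroup) (i : Fin n) : x * R.s i = R.refl x i * x := by
  simp [refl]

lemma lt_mul_s {x : R.weylGroup} {i : Fin n} (h : R.length x < R.length (x * R.s i)) :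
    x < x * R.s i := by
  rw [mul_s_eq] at h ⊢
  exact R.lt_refl_mul h

lemma mul_s_lt {x : R.weylGroup} {i : Fin n} (h : R.length (x * R.s i) < R.length x) :
    x * R.s i < x := by
  have := R.lt_mul_s (x := x * R.s i) (i := i) (by rwa [mul_s_mul_s])
  rwa [mul_s_mul_s] at this

lemma mul_s_cases (x : R.weylGroup) (i : Fin n) :
    R.length x < R.length (x * R.s i) ∨ R.length (x * R.s i) < R.length x := by
  have := R.length_mul_s x i
  omega

/-- Right multiplication by a simple reflection respects steps of the Bruhat order, apart from the
steps `x → x s`. -/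
lemma BruhatStep.mul_s {x y : R.weylGroup} (h : R.BruhatStep x y) (i : Fin n) :
    y = x * R.s i ∨ R.BruhatStep (x * R.s i) (y * R.s i) := by
  obtain ⟨t, ht, rfl, hl⟩ := h
  obtain ⟨a, j, rfl, hpos⟩ := R.exists_refl_pos ht
  have h1 := (R.isPos_act_inv_iff hpos).2 hl
  rw [← act_mul] at h1
  by_cases hroot : R.act (x⁻¹ * a) (R.root j) = R.root i
  · left
    have h2 := R.refl_eq_s hroot
    rw [refl_conj, inv_inv] at h2
    rw [← h2]
    group
  · right
    refine ⟨_, ht, (mul_assoc _ _ _), ?_⟩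
    rw [mul_assoc]
    apply R.length_lt_refl_mul hpos
    rw [mul_inv_rev, s_inv, act_mul, ← R.act_mul x⁻¹]
    exact R.s_perm h1 hroot

open Classical in
/-- The shorter one of `x` and `x s`. -/
noncomputable def minS (i : Fin n) (x : R.weylGroup) : R.weylGroup :=
  if R.length x < R.length (x * R.s i) then x else x * R.s i

open Classical in
/-- The longer one of `x` and `x s`. -/
noncomputable def maxS (i : Fin n) (x : R.weylGroup) : R.weylGroup :=
  if R.length x < R.length (x * R.s i) then x * R.s i else x

lemma minS_le (i : Fin n) (x : R.weylGroup) : R.minS i x ≤ x ∧ R.minS i x ≤ x * R.s i := by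
  unfold minS
  split_ifs with h
  · exact ⟨le_rfl, (R.lt_mul_s h).le⟩
  · exact ⟨(R.mul_s_lt ((R.mul_s_cases x i).resolve_left h)).le, le_rfl⟩

lemma le_maxS (i : Fin n) (x : R.weylGroup) : x ≤ R.maxS i x ∧ x * R.s i ≤ R.maxS i x := by
  unfold maxS
  split_ifs with h
  · exact ⟨(R.lt_mul_s h).le, le_rfl⟩
  · exact ⟨le_rfl, (R.mul_s_lt ((R.mul_s_cases x i).resolve_left h)).le⟩

lemma minS_eq_or (i : Fin n) (x : R.weylGroup) : R.minS i x = x ∨ R.minS i x = x * R.s i := by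
  unfold minS
  split_ifs
  · exact Or.inl rfl
  · exact Or.inr rfl

lemma maxS_eq_or (i : Fin n) (x : R.weylGroup) : R.maxS i x = x ∨ R.maxS i x = x * R.s i := by
  unfold maxS
  split_ifs
  · exact Or.inr rfl
  · exact Or.inl rfl

lemma minS_mul_s (i : Fin n) (x : R.weylGroup) : R.minS i (x * R.s i) = R.minS i x := by
  have := R.mul_s_cases x i
  unfold minS
  rw [mul_s_mul_s]
  split_ifs <;> first | rfl | omega

lemma maxS_mul_s (i : Fin n) (x : R.weylGroup) : R.maxS i (x * R.s i) = R.maxS i x := by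
  have := R.mul_s_cases x i
  unfold maxS
  rw [mul_s_mul_s]
  split_ifs <;> first | rfl | omega

lemma minS_mono (i : Fin n) {x y : R.weylGroup} (h : x ≤ y) : R.minS i x ≤ R.minS i y := by
  induction h with
  | refl => exact le_rfl
  | @tail y z _ hs ih =>
    refine ih.trans ?_
    rcases BruhatStep.mul_s R hs i with rfl | hs'
    · rw [minS_mul_s]
    · rcases R.minS_eq_or i z with h | h
      · rw [h]; exact (R.minS_le i y).1.trans (R.le_of_step hs)
      · rw [h]; exact (R.minS_le i y).2.trans (R.le_of_step hs')

lemma maxS_mono (i : Fin n) {x y : R.weylGroup} (h : x ≤ y) : R.maxS i x ≤ R.maxS i y := by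
  induction h with
  | refl => exact le_rfl
  | @tail y z _ hs ih =>
    refine ih.trans ?_
    rcases BruhatStep.mul_s R hs i with rfl | hs'
    · rw [maxS_mul_s]
    · rcases R.maxS_eq_or i y with h | h
      · rw [h]; exact (R.le_of_step hs).trans (R.le_maxS i z).1
      · rw [h]; exact (R.le_of_step hs').trans (R.le_maxS i z).2

lemma finite_Iic (w : R.weylGroup) : (Set.Iic w).Finite := by
  have h1 : (Set.range fun p : (Σ m : Fin (R.length w + 1), Fin m → Fin n) =>
      R.cs.wordProd (List.ofFn p.2)).Finite := Set.finite_range _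
  refine h1.subset fun x hx => ?_
  obtain ⟨l, hl, rfl⟩ := R.cs.exists_isReduced x
  refine ⟨⟨⟨l.length, ?_⟩, l.get⟩, by simp⟩
  have := R.length_le_of_le hx
  rw [← cs_length, hl.eq] at this
  omega

end Realization

namespace Realization

variable {n : ℕ} {C : SymGCM n} {H : Type u} [AddCommGroup H] [Module ℂ H]
  (R : Realization C H)

/-! ### Parabolic subgroups and minimal coset representatives -/

lemma exists_weight (c : Fin n → ℂ) : ∃ v : H, ∀ i, R.root i v = c i := by
  have := R.finite
  have h1 : Function.Surjective (LinearMap.pi R.root : H →ₗ[ℂ] (Fin n → ℂ)) := by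
    rw [← LinearMap.dualMap_injective_iff, ← LinearMap.ker_eq_bot, LinearMap.ker_eq_bot']
    intro f hf
    have h := R.root_linearIndependent
    rw [Fintype.linearIndependent_iff] at h
    have := h (fun i => f (Pi.single i 1)) (by
      ext v
      have := LinearMap.congr_fun hf v
      simp only [LinearMap.dualMap_apply, LinearMap.zero_apply] at this
      have hsingle : ∀ i : Fin n, (fun j => if i = j then (1 : ℂ) else 0) = Pi.single i 1 := by
        intro i
        funext j
        simp [Pi.single_apply, eq_comm]
      rw [LinearMap.zero_apply, ← this, LinearMap.pi_apply_eq_sum_univ f]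
      simp [mul_comm, hsingle])
    ext i
    simpa using this i
  obtain ⟨v, hv⟩ := h1 c
  exact ⟨v, fun i => congrFun hv i⟩

open Classical in
/-- A dominant element whose stabiliser is the parabolic subgroup `W_J`. -/
noncomputable def weight (J : Set (Fin n)) : H :=
  (R.exists_weight fun i => if i ∈ J then 0 else 1).choose

open Classical in
lemma root_weight_of_mem {J : Set (Fin n)} {i : Fin n} (hi : i ∈ J) :
    R.root i (R.weight J) = 0 := by
  have := (R.exists_weight fun i => if i ∈ J then 0 else 1).choose_spec i
  rw [if_pos hi] at this
  exact this

open Classical in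
lemma root_weight_of_notMem {J : Set (Fin n)} {i : Fin n} (hi : i ∉ J) :
    R.root i (R.weight J) = 1 := by
  have := (R.exists_weight fun i => if i ∈ J then 0 else 1).choose_spec i
  rw [if_neg hi] at this
  exact this

variable {R} in
lemma IsPos.apply_weight {φ : Module.Dual ℂ H} (h : R.IsPos φ) (J : Set (Fin n)) :
    ∃ m : ℕ, φ (R.weight J) = m := by
  classical
  obtain ⟨m, rfl⟩ := h
  refine ⟨∑ i, m i * (if i ∈ J then 0 else 1), ?_⟩
  rw [LinearMap.sum_apply]
  push_cast
  refine Finset.sum_congr rfl fun i _ => ?_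
  by_cases hi : i ∈ J
  · simp [hi, R.root_weight_of_mem hi]
  · simp [hi, R.root_weight_of_notMem hi]

variable {R} in
/-- A positive combination of simple roots vanishing at `weight J` involves roots in `J` only. -/
lemma IsPos.exists_of_apply_weight_eq_zero {φ : Module.Dual ℂ H} (h : R.IsPos φ)
    {J : Set (Fin n)} (h0 : φ (R.weight J) = 0) :
    ∃ m : Fin n → ℕ, φ = ∑ j, m j • R.root j ∧ ∀ j, j ∉ J → m j = 0 := by
  classical
  obtain ⟨m, rfl⟩ := h
  refine ⟨m, rfl, fun j hj => ?_⟩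
  have h1 : ((∑ i, m i * (if i ∈ J then 0 else 1) : ℕ) : ℂ) = 0 := by
    rw [← h0, LinearMap.sum_apply]
    push_cast
    refine Finset.sum_congr rfl fun i _ => ?_
    by_cases hi : i ∈ J
    · simp [hi, R.root_weight_of_mem hi]
    · simp [hi, R.root_weight_of_notMem hi]
  have h2 := (Finset.sum_eq_zero_iff.1 (Nat.cast_eq_zero.1 h1)) j (Finset.mem_univ j)
  simpa [hj] using h2

lemma weight_fixed {J : Set (Fin n)} {u : R.weylGroup} (hu : u ∈ R.parabolic J) :
    (u : H ≃ₗ[ℂ] H) (R.weight J) = R.weight J := by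
  induction hu using Subgroup.closure_induction with
  | mem x hx =>
    obtain ⟨i, hi, rfl⟩ := hx
    rw [s_apply, R.root_weight_of_mem hi, zero_smul, sub_zero]
  | one => rfl
  | mul a b _ _ ha hb => rw [Subgroup.coe_mul, LinearEquiv.mul_apply, hb, ha]
  | inv a _ ha =>
    conv_lhs => rw [← ha]
    rw [← LinearEquiv.mul_apply, ← Subgroup.coe_mul, inv_mul_cancel]
    rfl

lemma mul_apply' (a b : R.weylGroup) (v : H) :
    ((a * b : R.weylGroup) : H ≃ₗ[ℂ] H) v = (a : H ≃ₗ[ℂ] H) ((b : H ≃ₗ[ℂ] H) v) := rfl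

lemma act_inv_apply (a : R.weylGroup) (φ : Module.Dual ℂ H) (v : H) :
    R.act a⁻¹ φ v = φ ((a : H ≃ₗ[ℂ] H) v) := by
  rw [act_apply, inv_inv]

lemma s_mem_parabolic {J : Set (Fin n)} {i : Fin n} (hi : i ∈ J) : R.s i ∈ R.parabolic J :=
  Subgroup.subset_closure ⟨i, hi, rfl⟩

lemma mem_parabolic_of_fixed {J : Set (Fin n)} {u : R.weylGroup}
    (hu : (u : H ≃ₗ[ℂ] H) (R.weight J) = R.weight J) : u ∈ R.parabolic J := by
  induction hl : R.length u using Nat.strong_induction_on generalizing u with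
  | _ N ih =>
  by_cases hu1 : u = 1
  · rw [hu1]; exact one_mem _
  obtain ⟨j, hj⟩ := R.exists_rightDescent hu1
  have hjJ : j ∈ J := by
    by_contra hjJ
    obtain ⟨m, hm⟩ := (R.isPos_neg_act_root u j hj).apply_weight J
    rw [LinearMap.neg_apply, ← hu, act_apply, ← mul_apply', inv_mul_cancel] at hm
    change -(R.root j (R.weight J)) = m at hm
    rw [R.root_weight_of_notMem hjJ] at hm
    have : ((m + 1 : ℕ) : ℂ) = 0 := by push_cast; rw [← hm]; ring
    exact absurd (Nat.cast_eq_zero.1 this) (Nat.succ_ne_zero m)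
  have h1 := ih _ (by omega) (u := u * R.s j)
    (by rw [mul_apply', R.weight_fixed (R.s_mem_parabolic hjJ), hu]) rfl
  have h2 := mul_mem h1 (R.s_mem_parabolic hjJ)
  rwa [mul_s_mul_s] at h2

lemma apply_weight_eq_iff {J : Set (Fin n)} {x y : R.weylGroup} :
    (x : H ≃ₗ[ℂ] H) (R.weight J) = (y : H ≃ₗ[ℂ] H) (R.weight J) ↔ x⁻¹ * y ∈ R.parabolic J := by
  constructor
  · intro h
    apply R.mem_parabolic_of_fixed
    rw [mul_apply', ← h, ← mul_apply', inv_mul_cancel]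
    rfl
  · intro h
    have := R.weight_fixed h
    rw [mul_apply'] at this
    conv_lhs => rw [← this]
    rw [← mul_apply', mul_inv_cancel]
    rfl

lemma apply_weight_mul {J : Set (Fin n)} (x : R.weylGroup) {u : R.weylGroup}
    (hu : u ∈ R.parabolic J) :
    ((x * u : R.weylGroup) : H ≃ₗ[ℂ] H) (R.weight J) = (x : H ≃ₗ[ℂ] H) (R.weight J) := by
  rw [mul_apply', R.weight_fixed hu]

/-- Induction along reduced words in the generators of a parabolic subgroup. -/
lemma parabolic_induction {J : Set (Fin n)} {p : ∀ u : R.weylGroup, u ∈ R.parabolic J → Prop}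
    (one : p 1 (one_mem _))
    (mul : ∀ (u : R.weylGroup) (hu : u ∈ R.parabolic J) (j : Fin n) (hj : j ∈ J),
      R.length u < R.length (u * R.s j) → p u hu →
        p (u * R.s j) (mul_mem hu (R.s_mem_parabolic hj)))
    {u : R.weylGroup} (hu : u ∈ R.parabolic J) : p u hu := by
  induction hl : R.length u using Nat.strong_induction_on generalizing u with
  | _ N ih =>
  by_cases hu1 : u = 1
  · subst hu1
    exact one
  obtain ⟨j, hj⟩ := R.exists_rightDescent hu1
  have hjJ : j ∈ J := by
    by_contra hjJ
    obtain ⟨m, hm⟩ := (R.isPos_neg_act_root u j hj).apply_weight J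
    rw [LinearMap.neg_apply, act_apply, R.weight_fixed (inv_mem hu),
      R.root_weight_of_notMem hjJ] at hm
    have : ((m + 1 : ℕ) : ℂ) = 0 := by push_cast; rw [← hm]; ring
    exact absurd (Nat.cast_eq_zero.1 this) (Nat.succ_ne_zero m)
  have h1 := mul_mem hu (R.s_mem_parabolic hjJ)
  have h2 := mul _ h1 j hjJ (by rwa [mul_s_mul_s]) (ih _ (by omega) h1 rfl)
  have h3 : ∀ (v : R.weylGroup) (hv : v ∈ R.parabolic J), v = u → p v hv → p u hu := by
    rintro _ _ rfl h
    exact h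
  exact h3 _ _ (R.mul_s_mul_s u j) h2

lemma isPos_act_of_parabolic {J : Set (Fin n)} {x : R.weylGroup}
    (hx : ∀ j ∈ J, R.length x < R.length (x * R.s j)) {φ : Module.Dual ℂ H} (h : R.IsPos φ)
    (h0 : φ (R.weight J) = 0) : R.IsPos (R.act x φ) := by
  obtain ⟨m, rfl, hm⟩ := h.exists_of_apply_weight_eq_zero h0
  rw [act_sum]
  refine IsPos.sum fun j _ => ?_
  rw [act_nsmul]
  by_cases hj : j ∈ J
  · exact (R.isPos_act_root x j (hx j hj)).nsmul _
  · rw [hm j hj, zero_smul]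
    exact R.isPos_zero

lemma isPos_neg_act_of_parabolic {J : Set (Fin n)} {x : R.weylGroup}
    (hx : ∀ j ∈ J, R.length (x * R.s j) < R.length x) {φ : Module.Dual ℂ H} (h : R.IsPos φ)
    (h0 : φ (R.weight J) = 0) : R.IsPos (-R.act x φ) := by
  obtain ⟨m, rfl, hm⟩ := h.exists_of_apply_weight_eq_zero h0
  rw [act_sum, ← Finset.sum_neg_distrib]
  refine IsPos.sum fun j _ => ?_
  rw [act_nsmul, ← smul_neg]
  by_cases hj : j ∈ J
  · exact (R.isPos_neg_act_root x j (hx j hj)).nsmul _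
  · rw [hm j hj, zero_smul]
    exact R.isPos_zero

lemma act_root_weight {J : Set (Fin n)} {u : R.weylGroup} (hu : u ∈ R.parabolic J) {j : Fin n}
    (hj : j ∈ J) : R.act u (R.root j) (R.weight J) = 0 := by
  rw [act_apply, R.weight_fixed (inv_mem hu), R.root_weight_of_mem hj]

lemma length_mul_of_ascents {J : Set (Fin n)} {x : R.weylGroup}
    (hx : ∀ j ∈ J, R.length x < R.length (x * R.s j)) {u : R.weylGroup}
    (hu : u ∈ R.parabolic J) : R.length (x * u) = R.length x + R.length u := by
  induction hu using R.parabolic_induction with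
  | one => simp [length_one]
  | mul u hu j hj hlt ih =>
    have h1 := R.isPos_act_of_parabolic hx (R.isPos_act_root u j hlt) (R.act_root_weight hu hj)
    rw [← act_mul, isPos_act_root_iff] at h1
    have h2 := R.length_mul_s u j
    have h3 := R.length_mul_s (x * u) j
    rw [← mul_assoc]
    omega

lemma length_mul_of_descents {J : Set (Fin n)} {x : R.weylGroup}
    (hx : ∀ j ∈ J, R.length (x * R.s j) < R.length x) {u : R.weylGroup}
    (hu : u ∈ R.parabolic J) : R.length (x * u) + R.length u = R.length x := by
  induction hu using R.parabolic_induction with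
  | one => simp [length_one]
  | mul u hu j hj hlt ih =>
    have h1 := R.isPos_neg_act_of_parabolic hx (R.isPos_act_root u j hlt)
      (R.act_root_weight hu hj)
    rw [← act_mul] at h1
    have h4 : ¬ R.length (x * u) < R.length (x * u * R.s j) := fun h =>
      R.not_pos_and_neg _ _ (R.isPos_act_root _ _ h) h1
    have h2 := R.length_mul_s u j
    have h3 := R.length_mul_s (x * u) j
    rw [← mul_assoc]
    omega

lemma mem_minReps_iff {J : Set (Fin n)} {x : R.weylGroup} :
    x ∈ R.minReps J ↔ ∀ j ∈ J, R.length x < R.length (x * R.s j) := by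
  constructor
  · intro hx j hj
    have h1 := hx _ (R.s_mem_parabolic hj)
    have h2 := R.length_mul_s x j
    omega
  · intro hx u hu
    rw [R.length_mul_of_ascents hx hu]
    omega

lemma length_mul_of_mem_minReps {J : Set (Fin n)} {x : R.weylGroup} (hx : x ∈ R.minReps J)
    {u : R.weylGroup} (hu : u ∈ R.parabolic J) : R.length (x * u) = R.length x + R.length u :=
  R.length_mul_of_ascents (R.mem_minReps_iff.1 hx) hu

lemma eq_of_mem_minReps {J : Set (Fin n)} {x y : R.weylGroup} (hx : x ∈ R.minReps J)
    (hy : y ∈ R.minReps J) (h : x⁻¹ * y ∈ R.parabolic J) : x = y := by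
  have h1 := R.length_mul_of_mem_minReps hx h
  have h2 := R.length_mul_of_mem_minReps hy (inv_mem h)
  rw [mul_inv_rev, inv_inv, mul_inv_cancel_left] at h2
  rw [mul_inv_cancel_left] at h1
  have h3 : R.length (x⁻¹ * y) = 0 := by omega
  rw [length_eq_zero_iff] at h3
  exact (inv_mul_eq_one.1 h3)

lemma exists_minRep (J : Set (Fin n)) (v : R.weylGroup) :
    ∃ x : R.minReps J, (x : R.weylGroup)⁻¹ * v ∈ R.parabolic J := by
  induction hl : R.length v using Nat.strong_induction_on generalizing v with
  | _ N ih =>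
  by_cases hv : ∀ j ∈ J, R.length v < R.length (v * R.s j)
  · exact ⟨⟨v, R.mem_minReps_iff.2 hv⟩, by rw [inv_mul_cancel]; exact one_mem _⟩
  · push Not at hv
    obtain ⟨j, hj, hle⟩ := hv
    have := R.length_mul_s v j
    obtain ⟨x, hx⟩ := ih (R.length (v * R.s j)) (by omega) _ rfl
    refine ⟨x, ?_⟩
    have h2 := mul_mem hx (R.s_mem_parabolic hj)
    rwa [mul_assoc, mul_s_mul_s] at h2

/-- The minimal length representative of the coset of `v`. -/
noncomputable def minRep (J : Set (Fin n)) (v : R.weylGroup) : R.minReps J :=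
  (R.exists_minRep J v).choose

lemma minRep_spec (J : Set (Fin n)) (v : R.weylGroup) :
    (R.minRep J v : R.weylGroup)⁻¹ * v ∈ R.parabolic J :=
  (R.exists_minRep J v).choose_spec

lemma minRep_eq {J : Set (Fin n)} {v : R.weylGroup} {x : R.minReps J}
    (h : (x : R.weylGroup)⁻¹ * v ∈ R.parabolic J) : R.minRep J v = x := by
  apply Subtype.ext
  apply R.eq_of_mem_minReps (R.minRep J v).2 x.2
  have := mul_mem (R.minRep_spec J v) (inv_mem h)
  rwa [mul_inv_rev, inv_inv, mul_assoc, mul_inv_cancel_left] at this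

lemma minRep_mul {J : Set (Fin n)} (x : R.minReps J) {u : R.weylGroup} (hu : u ∈ R.parabolic J) :
    R.minRep J (x * u) = x :=
  R.minRep_eq (by rwa [inv_mul_cancel_left])

lemma exists_eq_minRep_mul (J : Set (Fin n)) (v : R.weylGroup) :
    ∃ u ∈ R.parabolic J, v = R.minRep J v * u :=
  ⟨_, R.minRep_spec J v, by rw [mul_inv_cancel_left]⟩

lemma apply_weight_minRep (J : Set (Fin n)) (v : R.weylGroup) :
    ((R.minRep J v : R.weylGroup) : H ≃ₗ[ℂ] H) (R.weight J) = (v : H ≃ₗ[ℂ] H) (R.weight J) :=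
  R.apply_weight_eq_iff.2 (R.minRep_spec J v)

lemma minRep_eq_iff {J : Set (Fin n)} {v v' : R.weylGroup} :
    R.minRep J v = R.minRep J v' ↔
      (v : H ≃ₗ[ℂ] H) (R.weight J) = (v' : H ≃ₗ[ℂ] H) (R.weight J) := by
  constructor
  · intro h
    rw [← R.apply_weight_minRep J v, h, R.apply_weight_minRep]
  · intro h
    apply R.minRep_eq
    rw [← R.apply_weight_eq_iff, h, R.apply_weight_minRep]

lemma minReps_le_mul {J : Set (Fin n)} {x : R.weylGroup} (hx : x ∈ R.minReps J)
    {u : R.weylGroup} (hu : u ∈ R.parabolic J) : x ≤ x * u := by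
  induction hu using R.parabolic_induction with
  | one => simp
  | mul u hu j hj hlt ih =>
    refine ih.trans ?_
    rw [← mul_assoc]
    apply (R.lt_mul_s _).le
    rw [mul_assoc, R.length_mul_of_mem_minReps hx hu,
      R.length_mul_of_mem_minReps hx (mul_mem hu (R.s_mem_parabolic hj))]
    omega

/-- Passing to minimal coset representatives is monotone. -/
lemma minRep_mono (J : Set (Fin n)) {v v' : R.weylGroup} (h : v ≤ v') :
    R.minRep J v ≤ R.minRep J v' := by
  induction hl : R.length v' using Nat.strong_induction_on generalizing v v' with
  | _ N ih =>
  by_cases hv : ∀ j ∈ J, R.length v' < R.length (v' * R.s j)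
  · have h1 : R.minRep J v' = ⟨v', R.mem_minReps_iff.2 hv⟩ := R.minRep_eq (by
      rw [inv_mul_cancel]; exact one_mem _)
    rw [h1]
    change (R.minRep J v : R.weylGroup) ≤ v'
    obtain ⟨u, hu, hvu⟩ := R.exists_eq_minRep_mul J v
    refine le_trans (b := v) ?_ h
    conv_rhs => rw [hvu]
    exact R.minReps_le_mul (R.minRep J v).2 hu
  · push Not at hv
    obtain ⟨j, hj, hle⟩ := hv
    have h1 := R.length_mul_s v' j
    have hmin : R.minS j v' = v' * R.s j := by
      unfold minS; rw [if_neg (by omega)]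
    have h2 := R.minS_mono j h
    rw [hmin] at h2
    have h3 := ih _ (by omega) h2 rfl
    have h4 : ∀ x, R.minRep J (x * R.s j) = R.minRep J x := fun x => R.minRep_eq_iff.2
      (R.apply_weight_mul x (R.s_mem_parabolic hj))
    rw [h4] at h3
    rcases R.minS_eq_or j v with h5 | h5
    · rwa [h5] at h3
    · rwa [h5, h4] at h3

section Longest

variable {R} {J : Set (Fin n)} {wJ : R.weylGroup}

lemma IsLongest.descents (hwJ : R.IsLongest J wJ) :
    ∀ j ∈ J, R.length (wJ * R.s j) < R.length wJ := by
  intro j hj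
  have h1 := hwJ.2 _ (mul_mem hwJ.1 (R.s_mem_parabolic hj))
  have h2 := R.length_mul_s wJ j
  omega

lemma IsLongest.length_mul (hwJ : R.IsLongest J wJ) {x : R.weylGroup} (hx : x ∈ R.minReps J)
    {u : R.weylGroup} (hu : u ∈ R.parabolic J) :
    R.length (x * wJ * u) + R.length u = R.length x + R.length wJ := by
  rw [mul_assoc, R.length_mul_of_mem_minReps hx (mul_mem hwJ.1 hu)]
  have := R.length_mul_of_descents hwJ.descents hu
  omega

lemma IsLongest.mul_le (hwJ : R.IsLongest J wJ) {x : R.weylGroup} (hx : x ∈ R.minReps J)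
    {u : R.weylGroup} (hu : u ∈ R.parabolic J) : x * wJ * u ≤ x * wJ := by
  induction hu using R.parabolic_induction with
  | one => simp
  | mul u hu j hj hlt ih =>
    refine le_trans ?_ ih
    rw [← mul_assoc]
    apply (R.mul_s_lt _).le
    have h1 := hwJ.length_mul hx hu
    have h2 := hwJ.length_mul hx (mul_mem hu (R.s_mem_parabolic hj))
    rw [← mul_assoc] at h2
    omega

lemma IsLongest.le_mul (hwJ : R.IsLongest J wJ) (v : R.weylGroup) :
    v ≤ R.minRep J v * wJ := by
  obtain ⟨u, hu, hv⟩ := R.exists_eq_minRep_mul J v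
  have h := hwJ.mul_le (R.minRep J v).2 (mul_mem (inv_mem hwJ.1) hu)
  rwa [mul_assoc, mul_inv_cancel_left, ← hv] at h

lemma IsLongest.mul_mono (hwJ : R.IsLongest J wJ) {x y : R.weylGroup} (hx : x ∈ R.minReps J)
    (hy : y ∈ R.minReps J) (h : x ≤ y) : x * wJ ≤ y * wJ := by
  have key : ∀ u ∈ R.parabolic J, ∃ u' ∈ R.parabolic J, x * u ≤ y * u' := by
    intro u hu
    induction hu using R.parabolic_induction with
    | one => exact ⟨1, one_mem _, by simpa using h⟩
    | mul u hu j hj hlt ih =>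
      obtain ⟨u', hu', hle⟩ := ih
      have h1 := R.maxS_mono j hle
      have h2 : R.maxS j (x * u) = x * u * R.s j := by
        unfold maxS
        rw [if_pos]
        rw [mul_assoc, R.length_mul_of_mem_minReps hx hu,
          R.length_mul_of_mem_minReps hx (mul_mem hu (R.s_mem_parabolic hj))]
        omega
      rw [h2] at h1
      rcases R.maxS_eq_or j (y * u') with h3 | h3
      · exact ⟨u', hu', by rw [← mul_assoc, ← h3]; exact h1⟩
      · exact ⟨u' * R.s j, mul_mem hu' (R.s_mem_parabolic hj),
          by rw [← mul_assoc, ← mul_assoc, ← h3]; exact h1⟩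
  obtain ⟨u', hu', hle⟩ := key wJ hwJ.1
  refine hle.trans ?_
  have := hwJ.le_mul (y * u')
  rwa [R.minRep_mul ⟨y, hy⟩ hu'] at this

lemma IsLongest.le_mul_iff (hwJ : R.IsLongest J wJ) (v : R.weylGroup) (w : R.minReps J) :
    v ≤ w * wJ ↔ R.minRep J v ≤ w := by
  constructor
  · intro h
    have := R.minRep_mono J h
    rwa [R.minRep_mul w hwJ.1] at this
  · intro h
    exact (hwJ.le_mul v).trans (hwJ.mul_mono (R.minRep J v).2 w.2 h)

end Longest

/-! ### Edges of the Bruhat graphs -/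

lemma isEdgeLabel_iff {J : Set (Fin n)} {x y : R.weylGroup} {c : H} :
    R.IsEdgeLabel J x y c ↔ ∃ (a : R.weylGroup) (i : Fin n), R.IsPos (R.act a (R.root i)) ∧
      c = (a : H ≃ₗ[ℂ] H) (R.coroot i) ∧ ∃ u ∈ R.parabolic J, R.refl a i * x = y * u := by
  have key : ∀ (a : R.weylGroup) (i : Fin n) (t : R.weylGroup),
      (t : H ≃ₗ[ℂ] H).toLinearMap = Module.preReflection ((a : H ≃ₗ[ℂ] H) (R.coroot i))
        (R.act a (R.root i)) ↔ t = R.refl a i := by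
    intro a i t
    constructor
    · intro h
      apply Subtype.ext
      ext v
      rw [refl_apply, ← Module.preReflection_apply, ← h]
      rfl
    · rintro rfl
      ext v
      rw [Module.preReflection_apply, ← refl_apply]
      rfl
  constructor
  · rintro ⟨α, ⟨⟨a, i, rfl, rfl⟩, hpos⟩, u, hu, h⟩
    refine ⟨a, i, hpos, rfl, u, hu, ?_⟩
    rw [← (key a i _).1 h]
    group
  · rintro ⟨a, i, hpos, rfl, u, hu, h⟩
    refine ⟨_, ⟨⟨a, i, rfl, rfl⟩, hpos⟩, u, hu, (key a i _).2 ?_⟩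
    rw [← h]
    group

lemma isEdgeLabel_empty_iff {x y : R.weylGroup} {c : H} :
    R.IsEdgeLabel ∅ x y c ↔ ∃ (a : R.weylGroup) (i : Fin n), R.IsPos (R.act a (R.root i)) ∧
      c = (a : H ≃ₗ[ℂ] H) (R.coroot i) ∧ y = R.refl a i * x := by
  rw [isEdgeLabel_iff]
  have h1 : ∀ u, u ∈ R.parabolic ∅ ↔ u = 1 := by simp [parabolic, Subgroup.mem_bot]
  simp only [h1, exists_eq_left, mul_one, eq_comm]

lemma exists_isEdgeLabel_refl (a : R.weylGroup) (i : Fin n) (x : R.weylGroup) :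
    ∃ c, R.IsEdgeLabel ∅ x (R.refl a i * x) c ∧
      (c = (a : H ≃ₗ[ℂ] H) (R.coroot i) ∨ c = -(a : H ≃ₗ[ℂ] H) (R.coroot i)) := by
  rcases R.pos_or_neg a i with h | h
  · exact ⟨_, R.isEdgeLabel_empty_iff.2 ⟨a, i, h, rfl, rfl⟩, Or.inl rfl⟩
  · refine ⟨_, R.isEdgeLabel_empty_iff.2 ⟨a * R.s i, i, ?_, rfl, by rw [refl_mul_s]⟩, Or.inr ?_⟩
    · rwa [act_mul, act_s_self, act_neg]
    · rw [mul_apply', s_apply, root_coroot_self, map_sub, map_smul]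
      module

/-- Across an edge between different cosets the value of the root at the weight is positive, and
conversely. -/
lemma apply_weight_pos {J : Set (Fin n)} {a x : R.weylGroup} {i : Fin n}
    (hpos : R.IsPos (R.act a (R.root i))) (hl : R.length x < R.length (R.refl a i * x))
    (hne : ((R.refl a i * x : R.weylGroup) : H ≃ₗ[ℂ] H) (R.weight J) ≠
      (x : H ≃ₗ[ℂ] H) (R.weight J)) :
    ∃ m : ℕ, m ≠ 0 ∧ R.act a (R.root i) ((x : H ≃ₗ[ℂ] H) (R.weight J)) = m := by
  obtain ⟨m, hm⟩ := ((R.isPos_act_inv_iff hpos).2 hl).apply_weight J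
  rw [act_inv_apply] at hm
  refine ⟨m, fun h0 => hne ?_, hm⟩
  rw [mul_apply', refl_apply, hm, h0, Nat.cast_zero, zero_smul, sub_zero]

lemma length_lt_of_apply_weight {J : Set (Fin n)} {a x : R.weylGroup} {i : Fin n}
    (hpos : R.IsPos (R.act a (R.root i))) {m : ℕ} (hm0 : m ≠ 0)
    (hm : R.act a (R.root i) ((x : H ≃ₗ[ℂ] H) (R.weight J)) = m) :
    R.length x < R.length (R.refl a i * x) := by
  rw [← R.isPos_act_inv_iff hpos]
  have h := R.pos_or_neg (x⁻¹ * a) i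
  rw [act_mul] at h
  refine h.resolve_right fun hneg => hm0 ?_
  obtain ⟨m', hm'⟩ := hneg.apply_weight J
  rw [LinearMap.neg_apply, act_inv_apply, hm] at hm'
  have : ((m + m' : ℕ) : ℂ) = 0 := by push_cast; rw [← hm']; ring
  have := Nat.cast_eq_zero.1 this
  omega

lemma edge_data {J : Set (Fin n)} {x y : R.minReps J} (hxy : x < y) {a : R.weylGroup} {i : Fin n}
    (hpos : R.IsPos (R.act a (R.root i))) {u : R.weylGroup} (hu : u ∈ R.parabolic J)
    (h : R.refl a i * x = y * u) :
    ∃ m : ℕ, m ≠ 0 ∧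
      R.act a (R.root i) (((x : R.weylGroup) : H ≃ₗ[ℂ] H) (R.weight J)) = m := by
  apply R.apply_weight_pos hpos
  · refine lt_of_le_of_ne (not_lt.1 fun hlt => ?_) (R.length_refl_mul_ne a x i).symm
    have h1 : R.refl a i * x < x := by
      have := R.lt_refl_mul (a := a) (i := i) (x := R.refl a i * x) (by
        rwa [← mul_assoc, refl_mul_self, one_mul])
      rwa [← mul_assoc, refl_mul_self, one_mul] at this
    have h2 := R.minRep_mono J h1.le
    rw [h, R.minRep_mul y hu, show (x : R.weylGroup) = x * 1 by rw [mul_one],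
      R.minRep_mul x (one_mem _)] at h2
    exact h2.not_gt hxy
  · rw [h, R.apply_weight_mul _ hu]
    intro heq
    exact hxy.ne (Subtype.ext (R.eq_of_mem_minReps x.2 y.2 (R.apply_weight_eq_iff.1 heq.symm)))

/-- Edges of the Bruhat graph of `W^J` lift to edges of the Bruhat graph of `W` with the same label,
starting at an arbitrary element of the coset. -/
lemma edge_lift {J : Set (Fin n)} {x y : R.minReps J} (hxy : x < y) {c : H}
    (h : R.IsEdgeLabel J x y c) {v : R.weylGroup} (hv : R.minRep J v = x) :
    ∃ v', R.minRep J v' = y ∧ v < v' ∧ R.IsEdgeLabel ∅ v v' c := by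
  obtain ⟨a, i, hpos, rfl, u, hu, h⟩ := R.isEdgeLabel_iff.1 h
  obtain ⟨m, hm0, hm⟩ := R.edge_data hxy hpos hu h
  have hvx := R.apply_weight_minRep J v
  rw [hv] at hvx
  refine ⟨R.refl a i * v, ?_, ?_, R.isEdgeLabel_empty_iff.2 ⟨a, i, hpos, rfl, rfl⟩⟩
  · apply R.minRep_eq
    rw [← R.apply_weight_eq_iff, mul_apply', ← hvx, ← mul_apply', h, R.apply_weight_mul _ hu]
  · apply R.lt_refl_mul
    rw [hvx] at hm
    exact R.length_lt_of_apply_weight hpos hm0 hm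

/-- Edges between different cosets descend to the Bruhat graph of `W^J`. -/
lemma edge_push {J : Set (Fin n)} {v v' : R.weylGroup} (hlt : v < v') {c : H}
    (h : R.IsEdgeLabel ∅ v v' c) (hne : R.minRep J v ≠ R.minRep J v') :
    R.minRep J v < R.minRep J v' ∧ R.IsEdgeLabel J (R.minRep J v) (R.minRep J v') c := by
  refine ⟨lt_of_le_of_ne (R.minRep_mono J hlt.le) hne, ?_⟩
  obtain ⟨a, i, hpos, rfl, rfl⟩ := R.isEdgeLabel_empty_iff.1 h
  refine R.isEdgeLabel_iff.2 ⟨a, i, hpos, rfl,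
    (R.minRep J (R.refl a i * v) : R.weylGroup)⁻¹ * (R.refl a i * R.minRep J v), ?_, ?_⟩
  · rw [← R.apply_weight_eq_iff, mul_apply', R.apply_weight_minRep, R.apply_weight_minRep,
      mul_apply']
  · rw [mul_inv_cancel_left]

lemma coroot_coeff_ext {m m' : Fin n → ℤ} (h : ∑ j, m j • R.coroot j = ∑ j, m' j • R.coroot j) :
    m = m' := by
  have := R.coroot_linearIndependent.restrict_scalars' ℤ
  rw [Fintype.linearIndependent_iff] at this
  have h2 := this (fun j => m j - m' j) (by
    simp only [sub_smul, Finset.sum_sub_distrib, h, sub_self])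
  funext j
  have := h2 j
  omega

lemma dvd_of_smul_coroot_eq {a b : R.weylGroup} {i j : Fin n} {p q : ℕ}
    (h : p • (a : H ≃ₗ[ℂ] H) (R.coroot i) = q • (b : H ≃ₗ[ℂ] H) (R.coroot j)) : q ∣ p := by
  have h1 : p • R.coroot i = q • ((a⁻¹ * b : R.weylGroup) : H ≃ₗ[ℂ] H) (R.coroot j) := by
    rw [mul_apply', ← map_nsmul, ← h, map_nsmul, ← mul_apply', inv_mul_cancel]
    rfl
  have h2 : ((a⁻¹ * b : R.weylGroup) : H ≃ₗ[ℂ] H) (R.coroot j) ∈ R.corootLattice :=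
    R.weyl_mem_corootLattice _ _ (Submodule.subset_span ⟨j, rfl⟩)
  obtain ⟨m, hm⟩ := (Submodule.mem_span_range_iff_exists_fun ℤ).1 h2
  have h3 := R.coroot_coeff_ext (m := Pi.single i (p : ℤ)) (m' := fun l => q * m l) (by
    simp only [Pi.single_apply, ite_smul, zero_smul, Finset.sum_ite_eq', Finset.mem_univ, if_true,
      mul_smul, natCast_zsmul]
    rw [h1, ← hm, Finset.smul_sum])
  have h4 := congrFun h3 i
  rw [Pi.single_eq_same] at h4
  exact Int.natCast_dvd_natCast.1 ⟨m i, h4⟩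

/-- The label of an edge is determined by the vertices. -/
lemma isEdgeLabel_unique {J : Set (Fin n)} {x y : R.minReps J} (hxy : x < y) {c c' : H}
    (h : R.IsEdgeLabel J x y c) (h' : R.IsEdgeLabel J x y c') : c = c' := by
  obtain ⟨a, i, hpos, rfl, u, hu, h⟩ := R.isEdgeLabel_iff.1 h
  obtain ⟨a', i', hpos', rfl, u', hu', h'⟩ := R.isEdgeLabel_iff.1 h'
  obtain ⟨m, hm0, hm⟩ := R.edge_data hxy hpos hu h
  obtain ⟨m', hm0', hm'⟩ := R.edge_data hxy hpos' hu' h'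
  have key : m • (a : H ≃ₗ[ℂ] H) (R.coroot i) = m' • (a' : H ≃ₗ[ℂ] H) (R.coroot i') := by
    have h1 : ((R.refl a i * x : R.weylGroup) : H ≃ₗ[ℂ] H) (R.weight J) =
        ((R.refl a' i' * x : R.weylGroup) : H ≃ₗ[ℂ] H) (R.weight J) := by
      rw [h, h', R.apply_weight_mul _ hu, R.apply_weight_mul _ hu']
    rw [mul_apply', mul_apply', refl_apply, refl_apply, hm, hm', Nat.cast_smul_eq_nsmul,
      Nat.cast_smul_eq_nsmul] at h1
    exact sub_right_injective h1
  have hmm : m = m' := Nat.dvd_antisymm (R.dvd_of_smul_coroot_eq key.symm)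
    (R.dvd_of_smul_coroot_eq key)
  rw [← hmm, ← Nat.cast_smul_eq_nsmul ℂ, ← Nat.cast_smul_eq_nsmul ℂ] at key
  exact smul_right_injective H (Nat.cast_ne_zero.2 hm0) key

/-- Every vertex below `w` has an outgoing edge to a vertex `≤ w`. -/
lemma exists_edge {J : Set (Fin n)} {x w : R.minReps J} (hxw : x < w) :
    ∃ y : R.minReps J, y ≤ w ∧ x < y ∧ ∃ c, R.IsEdgeLabel J x y c := by
  have key : ∀ z : R.weylGroup, z ≤ (w : R.weylGroup) → R.minRep J z = x →
      ∃ y : R.minReps J, y ≤ w ∧ x < y ∧ ∃ c, R.IsEdgeLabel J x y c := by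
    intro z hz
    have hw : R.minRep J (w : R.weylGroup) = w := by
      have := R.minRep_mul w (one_mem _)
      rwa [mul_one] at this
    induction hz using Relation.ReflTransGen.head_induction_on with
    | refl =>
      intro h
      rw [hw] at h
      exact absurd h hxw.ne'
    | head hs hle ih =>
      rename_i a b
      intro ha
      by_cases hb : R.minRep J b = x
      · exact ih hb
      have hab := R.lt_of_step hs
      obtain ⟨t, ht, rfl, hl⟩ := hs
      obtain ⟨d, i, rfl, hpos⟩ := R.exists_refl_pos ht
      have h1 := R.edge_push hab (R.isEdgeLabel_empty_iff.2 ⟨d, i, hpos, rfl, rfl⟩)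
        (by rw [ha]; exact fun h => hb h.symm)
      rw [ha] at h1
      refine ⟨_, ?_, h1.1, _, h1.2⟩
      have := R.minRep_mono J (show R.refl d i * a ≤ (w : R.weylGroup) from hle)
      rwa [hw] at this
  refine key x hxw.le ?_
  have := R.minRep_mul x (one_mem _)
  rwa [mul_one] at this

end Realization

/-! ### Linear forms in polynomial rings and symmetric algebras -/

section LinearForms

open MvPolynomial

/-- McCoy's theorem for linear forms: if a linear form kills a nonzero polynomial, then a nonzero
constant kills all its coefficients. -/
lemma exists_const_of_linearForm_mul_eq_zero {σ k : Type*} [Fintype σ] [CommRing k] (a : σ → k)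
    {f : MvPolynomial σ k} (hf : f ≠ 0) (h : (∑ j, C (a j) * X j) * f = 0) :
    ∃ c : k, c ≠ 0 ∧ ∀ j, a j * c = 0 := by
  classical
  -- among the nonzero scalar multiples of `f` one with the fewest terms is killed by all `a j`
  induction hN : f.support.card using Nat.strong_induction_on generalizing f with
  | _ N ih =>
  by_cases hall : ∀ j, C (a j) * f = 0
  · obtain ⟨m, hm⟩ := MvPolynomial.ne_zero_iff.1 hf
    refine ⟨coeff m f, hm, fun j => ?_⟩
    rw [← coeff_C_mul, hall j, coeff_zero]
  · push Not at hall
    obtain ⟨j, hj⟩ := hall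
    obtain ⟨m, hm, hmax⟩ := f.support.exists_max_image (fun m => m j)
      (Finset.nonempty_iff_ne_empty.2 fun h0 => hf (MvPolynomial.support_eq_empty.1 h0))
    have h1 : a j * coeff m f = 0 := by
      have h2 := congrArg (coeff (m + Finsupp.single j 1)) h
      rw [Finset.sum_mul, coeff_sum, coeff_zero] at h2
      rw [Finset.sum_eq_single j] at h2
      · rwa [mul_assoc, coeff_C_mul, mul_comm (X j), coeff_mul_X] at h2
      · intro j' _ hj'
        rw [mul_assoc, coeff_C_mul, mul_comm (X j'), coeff_mul_X']
        split_ifs with hs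
        · have h4 : coeff (m + Finsupp.single j 1 - Finsupp.single j' 1) f = 0 := by
            by_contra hne
            have h3 := hmax _ (mem_support_iff.2 hne)
            simp [hj'] at h3
          rw [h4, mul_zero]
        · rw [mul_zero]
      · simp
    have h2 : (C (a j) * f).support.card < N := by
      rw [← hN]
      apply Finset.card_lt_card
      refine (Finset.ssubset_iff_of_subset fun x hx => ?_).2 ⟨m, hm, ?_⟩
      · rw [mem_support_iff, coeff_C_mul] at hx
        exact mem_support_iff.2 (right_ne_zero_of_mul hx)
      · rw [mem_support_iff, coeff_C_mul, h1]
        simp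
    exact ih _ h2 hj (by rw [mul_left_comm, h, mul_zero]) rfl

lemma X_dvd_of_X_dvd_linearForm_mul {σ k : Type*} [Fintype σ] [CommRing k] (a : σ → k)
    (i : σ) (ha : ∀ c : k, (∀ j, j ≠ i → a j * c = 0) → c = 0) {f : MvPolynomial σ k}
    (h : X i ∣ (∑ j, C (a j) * X j) * f) : X i ∣ f := by
  classical
  let θ : MvPolynomial σ k →ₐ[k] MvPolynomial σ k := aeval fun j => if j = i then 0 else X j
  have hθ : ∀ f, X i ∣ f - θ f := by
    intro f
    rw [← Ideal.mem_span_singleton, ← Ideal.Quotient.mk_eq_mk_iff_sub_mem]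
    have : (Ideal.Quotient.mkₐ k (Ideal.span {(X i : MvPolynomial σ k)})) =
        (Ideal.Quotient.mkₐ k (Ideal.span {(X i : MvPolynomial σ k)})).comp θ := by
      apply MvPolynomial.algHom_ext
      intro j
      simp only [θ, AlgHom.comp_apply, aeval_X, Ideal.Quotient.mkₐ_eq_mk]
      split_ifs with hj
      · rw [hj, Ideal.Quotient.mk_eq_mk_iff_sub_mem, sub_zero]
        exact Ideal.mem_span_singleton_self _
      · rfl
    exact DFunLike.congr_fun this f
  suffices hz : θ f = 0 by simpa [hz] using hθ f
  by_contra hne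
  obtain ⟨g, hg⟩ := h
  have h1 : (∑ j, C (if j = i then 0 else a j) * X j) * θ f = 0 := by
    have h2 := congrArg θ hg
    rw [map_mul, map_mul] at h2
    have h3 : θ (X i) = 0 := by simp [θ]
    rw [h3, zero_mul, map_sum] at h2
    rw [← h2]
    congr 1
    refine Finset.sum_congr rfl fun j _ => ?_
    simp only [θ, map_mul, aeval_X, algHom_C]
    split_ifs with hj
    · simp
    · rfl
  obtain ⟨c, hc, hc'⟩ := exists_const_of_linearForm_mul_eq_zero _ hne h1
  refine hc (ha c fun j hj => ?_)
  have := hc' j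
  rwa [if_neg hj] at this

variable {k : Type*} [CommRing k] {M : Type*} [AddCommGroup M] [Module k M]

/-- A linear form that is linearly independent of a member `b i` of a basis is not a zero divisor
modulo `b i`. -/
lemma ι_basis_dvd_of_dvd_mul {κ : Type*} [Finite κ] (b : Module.Basis κ k M) (i : κ) (m : M)
    (hm : LinearIndependent k ![b i, m]) {f : SymmetricAlgebra k M}
    (h : SymmetricAlgebra.ι k M (b i) ∣ SymmetricAlgebra.ι k M m * f) :
    SymmetricAlgebra.ι k M (b i) ∣ f := by
  classical
  have := Fintype.ofFinite κ
  rw [← map_dvd_iff (SymmetricAlgebra.equivMvPolynomial b)] at h ⊢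
  rw [map_mul, SymmetricAlgebra.equivMvPolynomial_ι_apply] at h
  rw [SymmetricAlgebra.equivMvPolynomial_ι_apply]
  have hm2 : (SymmetricAlgebra.equivMvPolynomial b) (SymmetricAlgebra.ι k M m) =
      ∑ j, C (b.repr m j) * X j := by
    conv_lhs => rw [← b.sum_repr m]
    simp only [map_sum, map_smul, SymmetricAlgebra.equivMvPolynomial_ι_apply, smul_eq_C_mul]
  rw [hm2] at h
  refine X_dvd_of_X_dvd_linearForm_mul _ i (fun c hc => ?_) h
  rw [LinearIndependent.pair_iff] at hm
  refine (hm (-(c * b.repr m i)) c ?_).2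
  have hcm : c • m = ∑ j, c • b.repr m j • b j := by rw [← Finset.smul_sum, b.sum_repr]
  rw [hcm, ← Finset.add_sum_erase _ _ (Finset.mem_univ i), Finset.sum_eq_zero,
    smul_smul, add_zero, neg_smul, neg_add_cancel]
  intro j hj
  rw [smul_smul, mul_comm, hc j (Finset.ne_of_mem_erase hj), zero_smul]

/-- Algebra endomorphisms of the symmetric algebra that are congruent on the generators are
congruent. -/
lemma dvd_sub_of_dvd_sub_ι {A : Type*} [CommRing A] [Algebra k A] {c : A}
    {φ ψ : SymmetricAlgebra k M →ₐ[k] A}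
    (h : ∀ m, c ∣ φ (SymmetricAlgebra.ι k M m) - ψ (SymmetricAlgebra.ι k M m))
    (f : SymmetricAlgebra k M) : c ∣ φ f - ψ f := by
  rw [← Ideal.mem_span_singleton, ← Ideal.Quotient.mk_eq_mk_iff_sub_mem]
  have : (Ideal.Quotient.mkₐ k (Ideal.span {c})).comp φ =
      (Ideal.Quotient.mkₐ k (Ideal.span {c})).comp ψ := by
    refine SymmetricAlgebra.algHom_ext (LinearMap.ext fun m => ?_)
    change Ideal.Quotient.mk _ (φ _) = Ideal.Quotient.mk _ (ψ _)
    rw [Ideal.Quotient.mk_eq_mk_iff_sub_mem, Ideal.mem_span_singleton]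
    exact h m
  exact DFunLike.congr_fun this f

end LinearForms

/-! ### The grading of the symmetric algebra -/

section Grading

open Polynomial

variable (k : Type u) [CommRing k] (Y : Type u) [AddCommGroup Y]

lemma symGrading_even (n : ℕ) : symGrading k Y (2 * n) =
    LinearMap.range (SymmetricAlgebra.ι k (k ⊗[ℤ] Y)) ^ n := by
  unfold symGrading
  apply le_antisymm
  · refine iSup_le fun m => iSup_le fun hm => ?_
    have : n = m := by omega
    rw [this]
  · exact le_iSup₂_of_le n rfl le_rfl

lemma mem_symGrading {i : ℤ} {s : SymAlg k Y} (hs : s ∈ symGrading k Y i) :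
    s = 0 ∨ ∃ n : ℕ, i = 2 * n ∧ s ∈ LinearMap.range (SymmetricAlgebra.ι k (k ⊗[ℤ] Y)) ^ n := by
  by_cases h : ∃ n : ℕ, i = 2 * n
  · obtain ⟨n, rfl⟩ := h
    rw [symGrading_even] at hs
    exact Or.inr ⟨n, rfl, hs⟩
  · left
    push Not at h
    have : symGrading k Y i = ⊥ := by
      unfold symGrading
      simp [h]
    rwa [this] at hs

lemma one_mem_symGrading : (1 : SymAlg k Y) ∈ symGrading k Y 0 := by
  have := symGrading_even k Y 0
  simp only [Nat.cast_zero, mul_zero, pow_zero] at this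
  rw [this]
  exact Submodule.one_le.1 le_rfl

lemma linForm_mem_symGrading {Y : Type u} [AddCommGroup Y] (l : Y) :
    linForm k l ∈ symGrading k Y 2 := by
  have := symGrading_even k Y 1
  simp only [Nat.cast_one, mul_one, pow_one] at this
  rw [this]
  exact LinearMap.mem_range_self _ _

lemma mul_mem_symGrading {i j : ℤ} {s t : SymAlg k Y} (hs : s ∈ symGrading k Y i)
    (ht : t ∈ symGrading k Y j) : s * t ∈ symGrading k Y (i + j) := by
  rcases mem_symGrading k Y hs with rfl | ⟨n, rfl, hs'⟩
  · simp
  rcases mem_symGrading k Y ht with rfl | ⟨m, rfl, ht'⟩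
  · simp
  rw [← mul_add, ← Nat.cast_add, symGrading_even, pow_add]
  exact Submodule.mul_mem_mul hs' ht'

/-- The algebra homomorphism multiplying an element of polynomial degree `n` by `X ^ n`. -/
noncomputable def degreeHom : SymAlg k Y →ₐ[k] (SymAlg k Y)[X] :=
  SymmetricAlgebra.lift
    ((LinearMap.mulRight k (X : (SymAlg k Y)[X])) ∘ₗ
      (Algebra.ofId (SymAlg k Y) (SymAlg k Y)[X]).toLinearMap.restrictScalars k ∘ₗ
      SymmetricAlgebra.ι k (k ⊗[ℤ] Y))

lemma degreeHom_ι (m : k ⊗[ℤ] Y) :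
    degreeHom k Y (SymmetricAlgebra.ι k _ m) = C (SymmetricAlgebra.ι k _ m) * X := by
  rw [degreeHom, SymmetricAlgebra.lift_ι_apply]
  rfl

lemma degreeHom_algebraMap (r : k) :
    degreeHom k Y (algebraMap k _ r) = C (algebraMap k _ r) := by
  rw [AlgHom.commutes]
  rfl

lemma degreeHom_of_mem {n : ℕ} {s : SymAlg k Y}
    (hs : s ∈ LinearMap.range (SymmetricAlgebra.ι k (k ⊗[ℤ] Y)) ^ n) :
    degreeHom k Y s = C s * X ^ n := by
  induction hs using Submodule.pow_induction_on_left' with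
  | algebraMap r => rw [degreeHom_algebraMap, pow_zero, mul_one]
  | add x y i _ _ hx hy => rw [map_add, hx, hy, map_add, add_mul]
  | mem_mul m hm i x _ hx =>
    obtain ⟨m, rfl⟩ := hm
    rw [map_mul, hx, degreeHom_ι, map_mul, pow_succ]
    ring

lemma coeff_degreeHom_mem (s : SymAlg k Y) (n : ℕ) : (degreeHom k Y s).coeff n ∈
    LinearMap.range (SymmetricAlgebra.ι k (k ⊗[ℤ] Y)) ^ n := by
  induction s using SymmetricAlgebra.induction generalizing n with
  | algebraMap r =>
    rw [degreeHom_algebraMap, coeff_C]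
    split_ifs with h
    · subst h
      rw [pow_zero]
      exact Submodule.algebraMap_mem r
    · exact zero_mem _
  | ι x =>
    rw [degreeHom_ι, coeff_C_mul, coeff_X]
    split_ifs with h
    · subst h
      rw [pow_one, mul_one]
      exact LinearMap.mem_range_self _ _
    · rw [mul_zero]
      exact zero_mem _
  | mul a b ha hb =>
    rw [map_mul, coeff_mul]
    refine Submodule.sum_mem _ fun p hp => ?_
    rw [← Finset.HasAntidiagonal.mem_antidiagonal.1 hp, pow_add]
    exact Submodule.mul_mem_mul (ha _) (hb _)
  | add a b ha hb =>
    rw [map_add, coeff_add]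
    exact add_mem (ha n) (hb n)

lemma eval_one_degreeHom (s : SymAlg k Y) : (degreeHom k Y s).eval 1 = s := by
  have : ((Polynomial.aeval (R := SymAlg k Y) (1 : SymAlg k Y)).restrictScalars k).comp
      (degreeHom k Y) = AlgHom.id k _ := by
    apply SymmetricAlgebra.algHom_ext
    ext m
    simp [degreeHom_ι]
  have h := DFunLike.congr_fun this s
  simpa [Polynomial.coe_aeval_eq_eval] using h

open Classical in
/-- The projection of the symmetric algebra onto its part of degree `i`. -/
noncomputable def symProj (i : ℤ) : SymAlg k Y →+ SymAlg k Y :=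
  if 2 ∣ i ∧ 0 ≤ i then
    (Polynomial.lcoeff (SymAlg k Y) (i / 2).toNat).toAddMonoidHom.comp
      (degreeHom k Y).toRingHom.toAddMonoidHom
  else 0

lemma symProj_two_mul (n : ℕ) (s : SymAlg k Y) :
    symProj k Y (2 * n) s = (degreeHom k Y s).coeff n := by
  have h : (2 : ℤ) ∣ 2 * n ∧ 0 ≤ 2 * (n : ℤ) := ⟨⟨n, rfl⟩, by positivity⟩
  rw [symProj, if_pos h]
  simp

lemma symProj_mem (i : ℤ) (s : SymAlg k Y) : symProj k Y i s ∈ symGrading k Y i := by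
  by_cases h : 2 ∣ i ∧ 0 ≤ i
  · obtain ⟨n, rfl⟩ : ∃ n : ℕ, i = 2 * n := ⟨(i / 2).toNat, by omega⟩
    rw [symProj_two_mul, symGrading_even]
    exact coeff_degreeHom_mem k Y s n
  · rw [symProj, if_neg h]
    exact zero_mem _

lemma symProj_of_mem {i : ℤ} {s : SymAlg k Y} (hs : s ∈ symGrading k Y i) (j : ℤ) :
    symProj k Y j s = if i = j then s else 0 := by
  rcases mem_symGrading k Y hs with rfl | ⟨n, rfl, hs'⟩
  · simp
  by_cases h : 2 ∣ j ∧ 0 ≤ j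
  · obtain ⟨m, rfl⟩ : ∃ n : ℕ, j = 2 * n := ⟨(j / 2).toNat, by omega⟩
    rw [symProj_two_mul, degreeHom_of_mem k Y hs', coeff_C_mul, coeff_X_pow]
    by_cases hmn : m = n
    · simp [hmn]
    · have : ¬ (2 * (n : ℤ) = 2 * m) := by omega
      simp [hmn, this]
  · rw [symProj, if_neg h, if_neg (by omega)]
    rfl

lemma sum_symProj (s : SymAlg k Y) : ∃ t : Finset ℤ, ∀ t' : Finset ℤ, t ⊆ t' →
    ∑ j ∈ t', symProj k Y j s = s := by
  classical
  refine ⟨(Finset.range ((degreeHom k Y s).natDegree + 1)).image (fun n : ℕ => (2 * n : ℤ)),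
    fun t' ht' => ?_⟩
  rw [← Finset.sum_subset ht']
  · rw [Finset.sum_image (by intro a _ b _ h; simpa using h)]
    simp only [symProj_two_mul]
    conv_rhs => rw [← eval_one_degreeHom k Y s, Polynomial.eval_eq_sum_range]
    simp
  · intro j _ hj
    by_cases h : 2 ∣ j ∧ 0 ≤ j
    · obtain ⟨m, rfl⟩ : ∃ n : ℕ, j = 2 * n := ⟨(j / 2).toNat, by omega⟩
      rw [symProj_two_mul]
      apply Polynomial.coeff_eq_zero_of_natDegree_lt
      by_contra hcon
      exact hj (Finset.mem_image.2 ⟨m, Finset.mem_range.2 (by omega), rfl⟩)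
    · rw [symProj, if_neg h]
      rfl

end Grading

/-! ### Graded modules, projectivity and projective covers -/

/-- A family of additive projections onto the members of a grading gives a decomposition. -/
noncomputable abbrev decompositionOfProj {M : Type*} [AddCommGroup M] (𝒢 : ℤ → AddSubgroup M)
    (pr : ℤ → M →+ M) (mem : ∀ i m, pr i m ∈ 𝒢 i)
    (of_mem : ∀ i m, m ∈ 𝒢 i → ∀ j, pr j m = if i = j then m else 0)
    (sum : ∀ m, ∃ t : Finset ℤ, ∑ j ∈ t, pr j m = m) : DirectSum.Decomposition 𝒢 := by
  classical
  refine DirectSum.IsInternal.chooseDecomposition 𝒢 ⟨?_, fun m => ?_⟩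
  · rw [injective_iff_map_eq_zero]
    intro x hx
    have key : ∀ (x : DirectSum ℤ fun i => 𝒢 i) (j : ℤ),
        pr j (DirectSum.coeAddMonoidHom 𝒢 x) = x j := by
      intro x j
      induction x using DirectSum.induction_on with
      | zero => simp
      | of i m =>
        rw [DirectSum.coeAddMonoidHom_of, of_mem i _ m.2, DirectSum.of_apply]
        split_ifs with h
        · subst h; rfl
        · rfl
      | add x y hx hy => rw [map_add, map_add, hx, hy]; rfl
    ext j
    rw [← key, hx, map_zero]
    rfl
  · obtain ⟨t, ht⟩ := sum m
    refine ⟨∑ j ∈ t, DirectSum.of (fun i => 𝒢 i) j ⟨pr j m, mem j m⟩, ?_⟩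
    rw [map_sum]
    simpa using ht

variable {k : Type u} [CommRing k] {Y : Type u} [AddCommGroup Y]

namespace GrMod

/-- The component of degree `j` of an element. -/
noncomputable def comp (P : GrMod k Y) (j : ℤ) (x : P) : P :=
  (DirectSum.decompose P.grading x j : P)

variable (P : GrMod k Y)

lemma comp_mem (j : ℤ) (x : P) : P.comp j x ∈ P.grading j := SetLike.coe_mem _

lemma comp_add (j : ℤ) (x y : P) : P.comp j (x + y) = P.comp j x + P.comp j y := by
  simp [comp, DirectSum.decompose_add]

lemma comp_zero (j : ℤ) : P.comp j 0 = 0 := by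
  simp [comp]

lemma comp_of_mem {i : ℤ} {x : P} (hx : x ∈ P.grading i) (j : ℤ) :
    P.comp j x = if i = j then x else 0 := by
  rw [comp]
  split_ifs with h
  · subst h
    rw [DirectSum.decompose_of_mem_same _ hx]
  · rw [DirectSum.decompose_of_mem_ne _ hx h]

lemma sum_comp (x : P) : ∃ t : Finset ℤ, ∑ j ∈ t, P.comp j x = x := by
  classical
  exact ⟨_, DirectSum.sum_support_decompose P.grading x⟩

lemma homogeneous_induction {p : P → Prop} (zero : p 0)
    (hom : ∀ (j : ℤ) (x : P), x ∈ P.grading j → p x) (add : ∀ x y, p x → p y → p (x + y))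
    (x : P) : p x := by
  obtain ⟨t, ht⟩ := P.sum_comp x
  rw [← ht]
  exact Finset.sum_induction _ p add zero fun j _ => hom j _ (P.comp_mem j x)

end GrMod

lemma GrHom.map_comp {P Q : GrMod k Y} (f : GrHom P Q) (j : ℤ) (x : P) :
    f (P.comp j x) = Q.comp j (f x) := by
  induction x using P.homogeneous_induction with
  | zero => simp [GrMod.comp_zero]
  | hom i x hx =>
    rw [P.comp_of_mem hx, Q.comp_of_mem (f.map_mem hx)]
    split_ifs
    · rfl
    · exact map_zero f.toLinearMap
  | add x y hx hy =>
    rw [GrMod.comp_add, map_add, map_add, GrMod.comp_add, hx, hy]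

/-- The identity morphism. -/
def GrHom.id (P : GrMod k Y) : GrHom P P := ⟨LinearMap.id, fun h => h⟩

/-- The composition of morphisms. -/
def GrHom.comp {P Q T : GrMod k Y} (g : GrHom Q T) (f : GrHom P Q) : GrHom P T :=
  ⟨g.toLinearMap ∘ₗ f.toLinearMap, fun h => g.map_mem (f.map_mem h)⟩

@[simp] lemma GrHom.comp_apply {P Q T : GrMod k Y} (g : GrHom Q T) (f : GrHom P Q) (x : P) :
    (g.comp f) x = g (f x) := rfl

namespace GrIso

variable {P Q : GrMod k Y}

/-- The morphism underlying an isomorphism. -/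
def toGrHom (e : GrIso P Q) : GrHom P Q := ⟨e.toLinearEquiv.toLinearMap, e.map_mem_iff.2⟩

/-- The inverse isomorphism. -/
def symm (e : GrIso P Q) : GrIso Q P :=
  ⟨e.toLinearEquiv.symm, fun {i m} => by
    conv_rhs => rw [← e.toLinearEquiv.apply_symm_apply m]
    exact e.map_mem_iff.symm⟩

/-- A bijective morphism is an isomorphism. -/
noncomputable def ofBijective (f : GrHom P Q) (h : Function.Bijective f) : GrIso P Q where
  toLinearEquiv := LinearEquiv.ofBijective f.toLinearMap h
  map_mem_iff := fun {i m} => by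
    refine ⟨fun hm => ?_, f.map_mem⟩
    have h1 : f (P.comp i m) = f m := by
      rw [f.map_comp, Q.comp_of_mem (x := f m) hm, if_pos rfl]
    rw [← h.1 h1]
    exact P.comp_mem i m

end GrIso

/-- The free graded module with generators in the given degrees. -/
noncomputable def freeGrMod (k : Type u) [CommRing k] (Y : Type u) [AddCommGroup Y] {m : ℕ}
    (d : Fin m → ℤ) : GrMod k Y where
  carrier := Fin m → SymAlg k Y
  grading j :=
    { carrier := {p | ∀ i, p i ∈ symGrading k Y (j - d i)}
      add_mem' := fun ha hb i => add_mem (ha i) (hb i)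
      zero_mem' := fun i => zero_mem _
      neg_mem' := fun ha i => neg_mem (ha i) }
  decomposition := decompositionOfProj _
    (fun j => { toFun := fun p i => symProj k Y (j - d i) (p i)
                map_zero' := by funext i; simp
                map_add' := by intro x y; funext i; simp })
    (fun j p i => symProj_mem k Y _ _)
    (fun j p hp j' => by
      funext i
      change symProj k Y (j' - d i) (p i) = _
      rw [symProj_of_mem k Y (hp i)]
      by_cases h : j = j'
      · simp [h]
      · have : ¬ (j - d i = j' - d i) := by omega
        simp [h, this])
    (fun p => by
      classical
      choose t ht using fun i => sum_symProj k Y (p i)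
      refine ⟨Finset.univ.biUnion fun i => (t i).image (fun j => j + d i), ?_⟩
      funext i
      rw [Finset.sum_apply]
      change ∑ j ∈ _, symProj k Y (j - d i) (p i) = p i
      have h := ht i ((Finset.univ.biUnion fun i => (t i).image (fun j => j + d i)).image
        (fun j => j - d i)) fun j hj => Finset.mem_image.2 ⟨j + d i, Finset.mem_biUnion.2
          ⟨i, Finset.mem_univ _, Finset.mem_image_of_mem _ hj⟩, by ring⟩
      rwa [Finset.sum_image (by intro a _ b _ h; simpa using h)] at h)
  smul_mem := fun {i j s m} hs hm l => by
    have := mul_mem_symGrading k Y hs (hm l)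
    rwa [← add_sub_assoc] at this

/-- A finite homogeneous dual basis of a graded module: homogeneous elements `p i` of degree `d i`
and functionals `c i` of degree `- d i` with `x = ∑ c i x • p i` for all `x`. -/
def GrMod.HasDualBasis (P : GrMod k Y) : Prop :=
  ∃ (m : ℕ) (d : Fin m → ℤ) (p : Fin m → P) (c : Fin m → (P →ₗ[SymAlg k Y] SymAlg k Y)),
    (∀ i, p i ∈ P.grading (d i)) ∧
    (∀ i j x, x ∈ P.grading j → c i x ∈ symGrading k Y (j - d i)) ∧
    ∀ x, x = ∑ i, c i x • p i

lemma GrMod.exists_homogeneous_generators (P : GrMod k Y) :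
    ∃ (m : ℕ) (d : Fin m → ℤ) (p : Fin m → P), (∀ i, p i ∈ P.grading (d i)) ∧
      Submodule.span (SymAlg k Y) (Set.range p) = ⊤ := by
  classical
  obtain ⟨s, hs⟩ := (Module.finite_def.1 P.finite)
  choose t ht using P.sum_comp
  let G : Finset (ℤ × P) := s.biUnion fun x => (t x).image fun j => (j, P.comp j x)
  have hG : ∀ g ∈ G, g.2 ∈ P.grading g.1 := by
    intro g hg
    obtain ⟨x, -, hx⟩ := Finset.mem_biUnion.1 hg
    obtain ⟨j, -, rfl⟩ := Finset.mem_image.1 hx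
    exact P.comp_mem j x
  refine ⟨G.card, fun i => (G.equivFin.symm i).1.1, fun i => (G.equivFin.symm i).1.2,
    fun i => hG _ (G.equivFin.symm i).2, ?_⟩
  rw [eq_top_iff, ← hs, Submodule.span_le]
  intro x hx
  rw [SetLike.mem_coe, ← ht x]
  refine Submodule.sum_mem _ fun j hj => Submodule.subset_span ?_
  have hmem : (j, P.comp j x) ∈ G :=
    Finset.mem_biUnion.2 ⟨x, hx, Finset.mem_image.2 ⟨j, hj, rfl⟩⟩
  exact ⟨G.equivFin ⟨_, hmem⟩, by simp⟩

/-- Projective graded modules have homogeneous dual bases. -/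
lemma GrMod.IsProjective.hasDualBasis {P : GrMod k Y} (hP : P.IsProjective) : P.HasDualBasis := by
  classical
  obtain ⟨m, d, p, hp, hspan⟩ := P.exists_homogeneous_generators
  let q : GrHom (freeGrMod k Y d) P :=
    { toLinearMap := (Fintype.linearCombination (SymAlg k Y) p : (Fin m → SymAlg k Y) →ₗ[_] P)
      map_mem := fun {j f} hf => by
        have hmem : ∑ i, (f : Fin m → SymAlg k Y) i • p i ∈ P.grading j := by
          refine sum_mem fun i _ => ?_
          have := P.smul_mem (hf i) (hp i)
          rwa [sub_add_cancel] at this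
        exact hmem }
  have hq : Function.Surjective q := by
    have h1 : LinearMap.range (Fintype.linearCombination (SymAlg k Y) p) = ⊤ := by
      rw [Fintype.range_linearCombination, hspan]
    exact LinearMap.range_eq_top.1 h1
  obtain ⟨f, hf⟩ := hP _ _ q (GrHom.id P) hq
  refine ⟨m, d, p, fun i => (LinearMap.proj i : (Fin m → SymAlg k Y) →ₗ[_] _) ∘ₗ f.toLinearMap,
    hp, fun i j x hx => f.map_mem hx i, fun x => (hf x).symm⟩

lemma GrMod.IsoSym.hasDualBasis {P : GrMod k Y} (hP : P.IsoSym) : P.HasDualBasis := by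
  obtain ⟨e, he⟩ := hP
  refine ⟨1, fun _ => 0, fun _ => e 1, fun _ => e.symm.toLinearMap, fun _ => ?_, fun _ j x hx => ?_,
    fun x => ?_⟩
  · rw [he]
    exact one_mem_symGrading k Y
  · rw [sub_zero, ← he]
    simpa using hx
  · simp only [Finset.univ_unique, Finset.sum_singleton]
    rw [← map_smul]
    simp

namespace GrMod.HasDualBasis

variable {P : GrMod k Y}

/-- If `a` is not a zero divisor modulo `b`, then also on the module modulo `b`. -/
lemma exists_eq_smul (hP : P.HasDualBasis) {a b : SymAlg k Y} (hab : ∀ f, b ∣ a * f → b ∣ f)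
    {x y : P} (hx : a • x = b • y) : ∃ z, x = b • z := by
  obtain ⟨m, d, p, c, -, -, h⟩ := hP
  have h1 : ∀ i, ∃ f, c i x = b * f := fun i => hab _ ⟨c i y, by
    rw [← smul_eq_mul, ← map_smul, hx, map_smul, smul_eq_mul]⟩
  choose f hf using h1
  refine ⟨∑ i, f i • p i, ?_⟩
  rw [h x, Finset.smul_sum]
  refine Finset.sum_congr rfl fun i _ => ?_
  rw [hf, mul_smul]

/-- Lifting along a family of morphisms out of a graded module with a homogeneous dual basis. -/
lemma exists_lift (hP : P.HasDualBasis) {P' : GrMod k Y} {ι : Type*} {E : ι → GrMod k Y}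
    (a : ∀ i, GrHom P (E i)) (b : ∀ i, GrHom P' (E i)) (h : ∀ p, ∃ p', ∀ i, a i p = b i p') :
    ∃ f : GrHom P P', ∀ i p, b i (f p) = a i p := by
  obtain ⟨m, d, p, c, hp, hc, hx⟩ := hP
  choose q hq using h
  refine ⟨⟨∑ l, (c l).smulRight (P'.comp (d l) (q (p l))), fun {j x} hxj => ?_⟩, fun i x => ?_⟩
  · rw [LinearMap.sum_apply]
    refine sum_mem fun l _ => ?_
    have := P'.smul_mem (hc l j x hxj) (P'.comp_mem (d l) (q (p l)))
    rwa [sub_add_cancel] at this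
  · simp only [LinearMap.sum_apply, LinearMap.smulRight_apply, map_sum, map_smul]
    conv_rhs => rw [hx x, map_sum]
    refine Finset.sum_congr rfl fun l _ => ?_
    rw [map_smul, (b i).map_comp, ← hq, (E i).comp_of_mem ((a i).map_mem (hp l)), if_pos rfl]

/-- An endomorphism which is the identity up to elements of a superfluous kernel is bijective. -/
lemma bijective_of_superfluous {ι : Type*} {E : ι → GrMod k Y} (a : ∀ i, GrHom P (E i))
    (ha : ∀ N : Submodule (SymAlg k Y) P, N.IsHomogeneous P.grading →
      (∀ x, ∃ y ∈ N, ∀ i, a i x = a i y) → N = ⊤)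
    (f : GrHom P P) (hf : ∀ i x, a i (f x) = a i x) : Function.Bijective f := by
  have h1 : Function.Surjective f.toLinearMap := by
    rw [← LinearMap.range_eq_top]
    apply ha
    · rintro j _ ⟨x, rfl⟩
      exact ⟨P.comp j x, f.map_comp j x⟩
    · intro x
      exact ⟨f x, ⟨x, rfl⟩, fun i => (hf i x).symm⟩
  exact ⟨OrzechProperty.injective_of_surjective_endomorphism f.toLinearMap h1, h1⟩

/-- Uniqueness of projective covers. -/
theorem exists_grIso (hP : P.HasDualBasis) {P' : GrMod k Y} (hP' : P'.HasDualBasis) {ι : Type*}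
    {E : ι → GrMod k Y} (a : ∀ i, GrHom P (E i)) (b : ∀ i, GrHom P' (E i))
    (hab : ∀ p, ∃ p', ∀ i, a i p = b i p') (hba : ∀ p', ∃ p, ∀ i, b i p' = a i p)
    (ha : ∀ N : Submodule (SymAlg k Y) P, N.IsHomogeneous P.grading →
      (∀ x, ∃ y ∈ N, ∀ i, a i x = a i y) → N = ⊤)
    (hb : ∀ N : Submodule (SymAlg k Y) P', N.IsHomogeneous P'.grading →
      (∀ x, ∃ y ∈ N, ∀ i, b i x = b i y) → N = ⊤) :
    ∃ e : GrIso P P', ∀ i p, b i (e.toLinearEquiv p) = a i p := by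
  obtain ⟨f, hf⟩ := hP.exists_lift a b hab
  obtain ⟨g, hg⟩ := hP'.exists_lift b a hba
  have h1 := bijective_of_superfluous a ha (g.comp f) fun i x => by
    rw [GrHom.comp_apply, hg, hf]
  have h2 := bijective_of_superfluous b hb (f.comp g) fun i x => by
    rw [GrHom.comp_apply, hf, hg]
  have hbij : Function.Bijective f :=
    ⟨Function.Injective.of_comp (f := g) h1.1, Function.Surjective.of_comp (g := g) h2.2⟩
  exact ⟨GrIso.ofBijective f hbij, fun i p => hf i p⟩

end GrMod.HasDualBasis

/-- A form of the graded Nakayama lemma for modules isomorphic to the symmetric algebra. -/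
lemma GrMod.IsoSym.eq_top_of_homogeneous {P : GrMod k Y} (hP : P.IsoSym) (l : Y)
    {N : Submodule (SymAlg k Y) P} (hN : N.IsHomogeneous P.grading)
    (h : ∀ x, ∃ y ∈ N, ∃ z, x - y = linForm k l • z) : N = ⊤ := by
  obtain ⟨e, he⟩ := hP
  obtain ⟨y, hy, z, hz⟩ := h (e 1)
  have h1 : P.comp 0 (linForm k l • z) = 0 := by
    clear hz
    induction z using P.homogeneous_induction with
    | zero => rw [smul_zero, P.comp_zero]
    | hom j x hx =>
      rw [P.comp_of_mem (P.smul_mem (linForm_mem_symGrading k l) hx)]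
      split_ifs with hj
      · have hx2 : e.symm x ∈ symGrading k Y j := by
          rw [← he]
          simpa using hx
        rcases mem_symGrading k Y hx2 with h0 | ⟨n, hn, -⟩
        · have : x = 0 := by simpa using h0
          rw [this, smul_zero]
        · omega
      · rfl
    | add x x' hx hx' => rw [smul_add, P.comp_add, hx, hx', add_zero]
  have h2 : e 1 ∈ N := by
    have h3 : P.comp 0 (e 1) = e 1 := by
      rw [P.comp_of_mem ((he 0 1).2 (one_mem_symGrading k Y)), if_pos rfl]
    rw [← h3, show e 1 = y + linForm k l • z by rw [← hz]; abel, P.comp_add, h1, add_zero]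
    exact hN 0 hy
  rw [eq_top_iff]
  intro x _
  have h4 : x = e.symm x • e 1 := by rw [← map_smul]; simp
  rw [h4]
  exact N.smul_mem _ h2

/-! ### Comparison of canonical sheaves along a map of moment graphs -/

section Comparison

variable {k : Type u} [CommRing k] {Y : Type u} [AddCommGroup Y]

/-- Inverting a surjection: if `β` and `γ` are surjective with the same kernel, then every morphism
into the target of `β` has a counterpart with values in the target of `γ`. -/
lemma GrHom.exists_transfer {P M E E' : GrMod k Y} (α : GrHom P E) (β : GrHom M E) (γ : GrHom M E')
    (hβ : Function.Surjective β) (hker : ∀ m, β m = 0 ↔ γ m = 0) :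
    ∃ θ : GrHom P E', ∀ p m, θ p = γ m ↔ α p = β m := by
  have hwd : ∀ m m', γ m = γ m' ↔ β m = β m' := by
    intro m m'
    rw [← sub_eq_zero, ← map_sub, ← hker, map_sub, sub_eq_zero]
  choose r hr using fun p => hβ (α p)
  refine ⟨⟨{ toFun := fun p => γ (r p), map_add' := fun p p' => ?_, map_smul' := fun a p => ?_ },
    fun {i p} hp => ?_⟩, fun p m => ?_⟩
  · rw [← map_add, hwd, hr, map_add, map_add, hr, hr]
  · rw [RingHom.id_apply, ← map_smul, hwd, hr, map_smul, map_smul, hr]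
  · change γ (r p) ∈ E'.grading i
    rw [(hwd (r p) (M.comp i (r p))).2]
    · exact γ.map_mem (M.comp_mem i _)
    · rw [β.map_comp, hr, E.comp_of_mem (α.map_mem hp), if_pos rfl]
  · change γ (r p) = γ m ↔ _
    rw [hwd, hr]

lemma GrMod.IsoSym.exists_grIso {P Q : GrMod k Y} (hP : P.IsoSym) (hQ : Q.IsoSym) :
    Nonempty (GrIso P Q) := by
  obtain ⟨e, he⟩ := hP
  obtain ⟨f, hf⟩ := hQ
  refine ⟨⟨e.symm.trans f, fun {i m} => ?_⟩⟩
  rw [LinearEquiv.trans_apply, hf, ← he, LinearEquiv.apply_symm_apply]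

variable [Module.Free ℤ Y] [Module.Finite ℤ Y] {V V' : Type*} [PartialOrder V] [PartialOrder V']
  {G : MomentGraph Y V} {G' : MomentGraph Y V'}

/-- Transport between the stalks at equal vertices. -/
def KSheaf.stalkCast (F : KSheaf k G) {x y : V} (e : x = y) : GrHom (F.stalk x) (F.stalk y) :=
  e ▸ GrHom.id _

/-- The families satisfying the section condition for all edges within `U`. -/
def KSheaf.IsSection (F : KSheaf k G) (U : Set V) (m : ∀ v, F.stalk v) : Prop :=
  ∀ {x y : V} (h : G.Adj x y), x ∈ U → y ∈ U → F.srcMap h (m x) = F.tgtMap h (m y)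

lemma KSheaf.exists_mem_sections (F : KSheaf k G) {U : Set V} {m : ∀ v, F.stalk v}
    (h : F.IsSection U m) : ∃ s : F.sections U, ∀ x : U, s.1 x = m x :=
  ⟨⟨fun x => m x, fun x y hxy => h hxy x.2 y.2⟩, fun _ => rfl⟩

open Classical in
lemma KSheaf.exists_isSection (F : KSheaf k G) {U : Set V} (s : F.sections U) :
    ∃ m : ∀ v, F.stalk v, F.IsSection U m ∧ ∀ x : U, m x = s.1 x := by
  refine ⟨fun v => if h : v ∈ U then s.1 ⟨v, h⟩ else 0, fun {x y} h hx hy => ?_, fun x => ?_⟩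
  · simp only [dif_pos hx, dif_pos hy]
    exact s.2 ⟨x, hx⟩ ⟨y, hy⟩ h
  · simp

/-- Elements of the stalk at `x` have boundary values coming from sections, and conversely. -/
lemma KSheaf.IsCanonical.exists_section {F : KSheaf k G} {w : V} (hF : F.IsCanonical w) {x y : V}
    (hxy : G.Adj x y) (f : F.stalk x) : ∃ m : ∀ v, F.stalk v, F.IsSection (Set.Ioi x) m ∧
      ∀ {y} (h : G.Adj x y), F.srcMap h f = F.tgtMap h (m y) := by
  have h1 : F.d x f ∈ F.delta x := by
    rw [← (hF.projectiveCover hxy).2.1]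
    exact LinearMap.mem_range_self _ _
  obtain ⟨s, hs⟩ := h1
  obtain ⟨m, hm, hms⟩ := F.exists_isSection s
  refine ⟨m, hm, fun {y} h => ?_⟩
  have := congrFun hs ⟨y, h⟩
  rw [hms ⟨y, G.lt_of_adj h⟩]
  exact this.symm

lemma KSheaf.IsCanonical.exists_stalk {F : KSheaf k G} {w : V} (hF : F.IsCanonical w) (x : V)
    {m : ∀ v, F.stalk v} (hm : F.IsSection (Set.Ioi x) m) :
    ∃ f : F.stalk x, ∀ {y} (h : G.Adj x y), F.srcMap h f = F.tgtMap h (m y) := by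
  by_cases hx : ∃ y, G.Adj x y
  · obtain ⟨y, hxy⟩ := hx
    obtain ⟨s, hs⟩ := F.exists_mem_sections hm
    have h1 : F.u x s ∈ LinearMap.range (F.d x) := by
      rw [(hF.projectiveCover hxy).2.1]
      exact LinearMap.mem_range_self _ _
    obtain ⟨f, hf⟩ := h1
    refine ⟨f, fun {y} h => ?_⟩
    have := congrFun hf ⟨y, h⟩
    rw [← hs ⟨y, G.lt_of_adj h⟩]
    exact this
  · exact ⟨0, fun {y} h => absurd ⟨y, h⟩ hx⟩

open Classical in
lemma KSheaf.IsSection.update {F : KSheaf k G} {U : Set V} (hU : IsUpperSet U) {z : V} (hz : z ∉ U)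
    {m : ∀ v, F.stalk v} (hm : F.IsSection U m) {f : F.stalk z}
    (hf : ∀ {y} (h : G.Adj z y), F.srcMap h f = F.tgtMap h (m y)) :
    F.IsSection (insert z U) (Function.update m z f) := by
  intro x y h hx hy
  have hyz : y ≠ z := by
    rintro rfl
    rcases hx with rfl | hx
    · exact lt_irrefl _ (G.lt_of_adj h)
    · exact hz (hU (G.lt_of_adj h).le hx)
  rw [Function.update_of_ne hyz]
  by_cases hxz : x = z
  · subst hxz
    rw [Function.update_self]
    exact hf h
  · rw [Function.update_of_ne hxz]
    exact hm h (hx.resolve_left hxz) (hy.resolve_left hyz)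

/-- Canonical sheaves are flabby: sections over upper sets extend to global sections. -/
lemma KSheaf.IsCanonical.flabby [Finite V] {F : KSheaf k G} {w : V} (hF : F.IsCanonical w)
    {U : Set V} (hU : IsUpperSet U) {m : ∀ v, F.stalk v} (hm : F.IsSection U m) :
    ∃ m' : ∀ v, F.stalk v, F.IsSection Set.univ m' ∧ ∀ v ∈ U, m' v = m v := by
  classical
  induction hN : (Uᶜ).ncard using Nat.strong_induction_on generalizing U m with
  | _ N ih =>
  by_cases hne : (Uᶜ).Nonempty
  · obtain ⟨z, hz, hmax⟩ := (Set.toFinite Uᶜ).exists_maximal hne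
    have hIoi : Set.Ioi z ⊆ U := by
      intro v hv
      by_contra hvU
      exact lt_irrefl z (lt_of_lt_of_le hv (hmax hvU (le_of_lt hv)))
    obtain ⟨f, hf⟩ := hF.exists_stalk z (m := m)
      fun {x y} h hx hy => hm h (hIoi hx) (hIoi hy)
    have hU' : IsUpperSet (insert z U) := by
      rintro a b hab (rfl | ha)
      · rcases hab.eq_or_lt with rfl | hlt
        · exact Or.inl rfl
        · exact Or.inr (hIoi hlt)
      · exact Or.inr (hU hab ha)
    have hlt : ((insert z U)ᶜ).ncard < N := by
      rw [← hN]
      apply Set.ncard_lt_ncard _ (Set.toFinite _)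
      refine (Set.ssubset_iff_of_subset fun x hx => ?_).2 ⟨z, hz, fun h => h (Or.inl rfl)⟩
      exact fun h => hx (Or.inr h)
    obtain ⟨m', hm', hmm⟩ := ih _ hlt hU' (hm.update hU hz hf) rfl
    refine ⟨m', hm', fun v hv => ?_⟩
    rw [hmm v (Or.inr hv), Function.update_of_ne]
    rintro rfl
    exact hz hv
  · have : U = Set.univ := by
      rwa [Set.not_nonempty_iff_eq_empty, Set.compl_empty_iff] at hne
    subst this
    exact ⟨m, hm, fun _ _ => rfl⟩

/-- A map of moment graphs along which edges between different fibres correspond to the edges of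
the target. -/
structure IsFibration (G : MomentGraph Y V) (G' : MomentGraph Y V') (π : V → V') : Prop where
  mono : Monotone π
  push : ∀ {v v' : V} (h : G.Adj v v'), π v ≠ π v' →
    ∃ h' : G'.Adj (π v) (π v'), G'.label h' = G.label h
  lift : ∀ {x y : V'} (_ : G'.Adj x y) {v : V}, π v = x → ∃ v', G.Adj v v' ∧ π v' = y

/-- The section condition at an edge `h : v → v'` for the pull-back of the sheaf `F` along `π`: on an
edge inside a fibre the pull-back is the quotient of the stalk by the label, on the other
edges it is the module on the image of the edge. -/
def PullRel (F : KSheaf k G') (π : V → V') {v v' : V} (h : G.Adj v v') (m : F.stalk (π v))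
    (m' : F.stalk (π v')) : Prop :=
  (∃ (e : π v = π v') (g : F.stalk (π v')), F.stalkCast e m = m' + linForm k (G.label h) • g) ∨
    ∃ h' : G'.Adj (π v) (π v'), F.srcMap h' m = F.tgtMap h' m'

variable {π : V → V'}

lemma pullRel_of_adj {F : KSheaf k G'} {v v' : V} (h : G.Adj v v') (h' : G'.Adj (π v) (π v'))
    {m : F.stalk (π v)} {m' : F.stalk (π v')} :
    PullRel F π h m m' ↔ F.srcMap h' m = F.tgtMap h' m' := by
  constructor
  · rintro (⟨e, -⟩ | ⟨_, h⟩)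
    · exact absurd e (G'.lt_of_adj h').ne
    · exact h
  · exact fun h => Or.inr ⟨h', h⟩

lemma pullRel_of_eq {F : KSheaf k G'} {v v' : V} (h : G.Adj v v') (e : π v = π v')
    {m : F.stalk (π v)} {m' : F.stalk (π v')} :
    PullRel F π h m m' ↔ ∃ g, F.stalkCast e m = m' + linForm k (G.label h) • g := by
  constructor
  · rintro (⟨e, h⟩ | ⟨h', -⟩)
    · exact h
    · exact absurd e (G'.lt_of_adj h').ne
  · exact fun h => Or.inl ⟨e, h⟩

/-- The section condition for the pull-back of a section. -/
lemma pullRel_pull (hπ : IsFibration G G' π) {F : KSheaf k G'} {n : ∀ x, F.stalk x} {v v' : V}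
    (h : G.Adj v v')
    (hn : ∀ h' : G'.Adj (π v) (π v'), F.srcMap h' (n (π v)) = F.tgtMap h' (n (π v'))) :
    PullRel F π h (n (π v)) (n (π v')) := by
  by_cases e : π v = π v'
  · rw [pullRel_of_eq h e]
    refine ⟨0, ?_⟩
    rw [smul_zero, add_zero]
    have : ∀ {x y : V'} (e : x = y), F.stalkCast e (n x) = n y := by
      rintro x _ rfl
      rfl
    exact this e
  · obtain ⟨h', -⟩ := hπ.push h e
    rw [pullRel_of_adj h h']
    exact hn h'

/-- The boundary maps of the pull-back of `F`, with values in the modules on the edges of `B`. -/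
lemma exists_boundary (hπ : IsFibration G G' π) {B : KSheaf k G} {F : KSheaf k G'} {w : V} {w' : V'}
    (hB : B.IsCanonical w) (hF : F.IsCanonical w') {z v : V} (h : G.Adj z v)
    (φ : GrHom (B.stalk v) (F.stalk (π v))) (hφ : Function.Bijective φ) :
    ∃ θ : GrHom (F.stalk (π z)) (B.edge h), ∀ f m, θ f = B.tgtMap h m ↔ PullRel F π h f (φ m) := by
  by_cases e : π z = π v
  · let ψ := (GrIso.ofBijective φ hφ).symm.toGrHom
    have hψ : ∀ f, φ (ψ f) = f := fun f => (GrIso.ofBijective φ hφ).toLinearEquiv.apply_symm_apply f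
    refine ⟨(B.tgtMap h).comp (ψ.comp (F.stalkCast e)), fun f m => ?_⟩
    rw [pullRel_of_eq h e, GrHom.comp_apply, GrHom.comp_apply, ← sub_eq_zero, ← map_sub,
      hB.tgtMap_eq_zero_iff]
    constructor
    · rintro ⟨m', hm'⟩
      refine ⟨φ m', ?_⟩
      rw [← map_smul, ← hm', map_sub, hψ]
      abel
    · rintro ⟨g, hg⟩
      refine ⟨ψ g, hφ.1 ?_⟩
      rw [map_sub, map_smul, hψ, hψ, hg]
      abel
  · obtain ⟨h', hl⟩ := hπ.push h e
    obtain ⟨θ, hθ⟩ := GrHom.exists_transfer (F.srcMap h') ((F.tgtMap h').comp φ) (B.tgtMap h)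
      ((hF.tgtMap_surjective h').comp hφ.2) (fun m => by
        rw [GrHom.comp_apply, hF.tgtMap_eq_zero_iff, hB.tgtMap_eq_zero_iff, hl]
        constructor
        · rintro ⟨m', hm'⟩
          obtain ⟨m', rfl⟩ := hφ.2 m'
          exact ⟨m', hφ.1 (by rw [hm', map_smul])⟩
        · rintro ⟨m', rfl⟩
          exact ⟨φ m', by rw [map_smul]⟩)
    refine ⟨θ, fun f m => ?_⟩
    rw [hθ, pullRel_of_adj h h']
    rfl

/-- The pull-back of `F` along `π` is flabby at the vertices of `G` in the following sense: for every
section `n` over the vertices which are above `z` or whose fibre is above the fibre of `z`, the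
boundary values at `z` come from the stalk of `F`. -/
def HasExtensions (G : MomentGraph Y V) (F : KSheaf k G') (π : V → V') : Prop :=
  ∀ (z : V) (n : ∀ v, F.stalk (π v)),
    (∀ {v v' : V} (h : G.Adj v v'), z < v ∨ π z < π v → z < v' ∨ π z < π v' →
      PullRel F π h (n v) (n v')) →
    ∃ f : F.stalk (π z), ∀ {v : V} (h : G.Adj z v), PullRel F π h f (n v)

/-- Isomorphisms between the stalks of `B` and the pull-back of `F`, compatible with the section
condition on the edges within `U`.  The values outside of `U` are irrelevant. -/
def StalkIsos (B : KSheaf k G) (F : KSheaf k G') (U : Set V)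
    (φ : ∀ v, GrHom (B.stalk v) (F.stalk (π v))) : Prop :=
  (∀ v ∈ U, Function.Bijective (φ v)) ∧ ∀ {v v' : V} (h : G.Adj v v'), v ∈ U → v' ∈ U →
    ∀ m m', B.srcMap h m = B.tgtMap h m' ↔ PullRel F π h (φ v m) (φ v' m')

open Classical in
/-- Extension of the isomorphisms to a further vertex, by uniqueness of projective covers. -/
lemma StalkIsos.extend [Finite V] (hπ : IsFibration G G' π) {B : KSheaf k G} {F : KSheaf k G'}
    {w : V} {w' : V'} (hB : B.IsCanonical w) (hF : F.IsCanonical w')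
    (htop : ∀ x : V', x ≠ w' → ∃ y, G'.Adj x y) (hext : HasExtensions G F π) {U : Set V}
    {φ : ∀ v, GrHom (B.stalk v) (F.stalk (π v))} (hφ : StalkIsos B F U φ) {z : V} (hz : z ∉ U)
    (hzU : ∀ v, z < v ∨ π z < π v → v ∈ U) (hU : ∀ v, v ∈ U → ¬ G.Adj v z)
    (hout : ∃ v, G.Adj z v) : ∃ f, StalkIsos B F (insert z U) (Function.update φ z f) := by
  obtain ⟨v₀, h₀⟩ := hout
  have hadj : ∀ {v}, G.Adj z v → v ∈ U := fun h => hzU _ (Or.inl (G.lt_of_adj h))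
  choose θ hθ using fun v (h : G.Adj z v) =>
    exists_boundary hπ hB hF h (φ v) (hφ.1 v (hadj h))
  have hcover := hB.projectiveCover h₀
  have hiso : ∃ e : GrIso (B.stalk z) (F.stalk (π z)), ∀ (E : {v // G.Adj z v}) (p : B.stalk z),
      θ E.1 E.2 (e.toLinearEquiv p) = B.srcMap E.2 p := by
    refine hcover.1.hasDualBasis.exists_grIso (ι := {v // G.Adj z v})
      (E := fun E => B.edge E.2) ?_ (fun E => B.srcMap E.2) (fun E => θ E.1 E.2) ?_ ?_ ?_ ?_
    · by_cases hx : ∃ y, G'.Adj (π z) y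
      · exact (hF.projectiveCover hx.choose_spec).1.hasDualBasis
      · have : π z = w' := by
          by_contra hne
          exact hx (htop _ hne)
        rw [this]
        exact hF.stalk_top.hasDualBasis
    · intro p
      obtain ⟨m, hm, hpm⟩ := hB.exists_section h₀ p
      obtain ⟨m', hm', hmm⟩ := hB.flabby (isUpperSet_Ioi z) hm
      obtain ⟨f, hf⟩ := hext z (fun v => φ v (m' v)) fun {v v'} h hv hv' =>
        (hφ.2 h (hzU v hv) (hzU v' hv') _ _).1 (hm' h trivial trivial)
      refine ⟨f, fun E => ?_⟩
      rw [hpm E.2, ← hmm E.1 (G.lt_of_adj E.2)]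
      exact ((hθ E.1 E.2 _ _).2 (hf E.2)).symm
    · intro f
      obtain ⟨n, hn, hnf⟩ : ∃ n : ∀ x, F.stalk x, (∀ {x y} (h : G'.Adj x y), π z ≤ x →
          F.srcMap h (n x) = F.tgtMap h (n y)) ∧ n (π z) = f := by
        by_cases hx : ∃ y, G'.Adj (π z) y
        · obtain ⟨n, hn, hnf⟩ := hF.exists_section hx.choose_spec f
          have h1 : F.IsSection (insert (π z) (Set.Ioi (π z))) (Function.update n (π z) f) :=
            hn.update (isUpperSet_Ioi (π z)) (lt_irrefl (π z)) hnf
          refine ⟨Function.update n (π z) f, fun {x y} h hx => h1 h ?_ ?_, Function.update_self _ _ _⟩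
          · rcases hx.eq_or_lt with e | e
            · exact Or.inl e.symm
            · exact Or.inr e
          · exact Or.inr (lt_of_le_of_lt hx (G'.lt_of_adj h))
        · refine ⟨Function.update 0 (π z) f, fun {x y} h hx' => ?_, Function.update_self _ _ _⟩
          have hzy : y ≠ π z := (lt_of_le_of_lt hx' (G'.lt_of_adj h)).ne'
          by_cases hxz : x = π z
          · exact absurd ⟨y, hxz ▸ h⟩ hx
          · rw [Function.update_of_ne hzy, Function.update_of_ne hxz]
            simp
      have hsurj : ∀ v, ∃ m : B.stalk v, v ∈ U → φ v m = n (π v) := by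
        intro v
        by_cases hv : v ∈ U
        · obtain ⟨m, hm⟩ := (hφ.1 v hv).2 (n (π v))
          exact ⟨m, fun _ => hm⟩
        · exact ⟨0, fun h => absurd h hv⟩
      choose m hm using hsurj
      have hrel : ∀ {v v'} (h : G.Adj v v'), z ≤ v → PullRel F π h (n (π v)) (n (π v')) :=
        fun h hzv => pullRel_pull hπ h fun h' => hn h' (hπ.mono hzv)
      obtain ⟨p, hp⟩ := hB.exists_stalk z (m := m) fun {v v'} h hv hv' => by
        have hvU := hzU v (Or.inl hv)
        have hvU' := hzU v' (Or.inl hv')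
        rw [hφ.2 h hvU hvU', hm v hvU, hm v' hvU']
        exact hrel h (le_of_lt hv)
      refine ⟨p, fun E => ?_⟩
      rw [hp E.2, hθ E.1 E.2, hm E.1 (hadj E.2), ← hnf]
      exact hrel E.2 le_rfl
    · intro N hN h
      refine hcover.2.2 N hN (eq_top_iff.2 fun x _ => ?_)
      obtain ⟨y, hy, hxy⟩ := h x
      rw [show x = y + (x - y) by abel]
      refine Submodule.add_mem_sup hy ?_
      rw [LinearMap.mem_ker]
      funext E
      change B.srcMap E.2 (x - y) = 0
      rw [map_sub, hxy E, sub_self]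
    · intro N hN h
      have hrel : ∀ x, ∃ y ∈ N, ∀ {v} (h : G.Adj z v), PullRel F π h (x - y) 0 := by
        intro x
        obtain ⟨y, hy, hxy⟩ := h x
        refine ⟨y, hy, fun {v} h => ?_⟩
        rw [← map_zero (φ v).toLinearMap, ← hθ v h, map_sub, hxy ⟨v, h⟩, sub_self, map_zero]
      by_cases hx : ∃ y, G'.Adj (π z) y
      · refine (hF.projectiveCover hx.choose_spec).2.2 N hN (eq_top_iff.2 fun x _ => ?_)
        obtain ⟨y, hy, hxy⟩ := hrel x
        rw [show x = y + (x - y) by abel]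
        refine Submodule.add_mem_sup hy ?_
        rw [LinearMap.mem_ker]
        funext ⟨x', hE⟩
        obtain ⟨v', h', rfl⟩ := hπ.lift hE rfl
        have h1 := (pullRel_of_adj h' hE).1 (hxy h')
        rw [map_zero] at h1
        exact h1
      · have hw' : π z = w' := by
          by_contra hne
          exact hx (htop _ hne)
        have hIso : (F.stalk (π z)).IsoSym := by
          rw [hw']
          exact hF.stalk_top
        have heq : π z = π v₀ := by
          by_contra hne
          obtain ⟨h', -⟩ := hπ.push h₀ hne
          exact hx ⟨_, h'⟩
        refine hIso.eq_top_of_homogeneous (G.label h₀) hN fun x => ?_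
        obtain ⟨y, hy, hxy⟩ := hrel x
        obtain ⟨g, hg⟩ := (pullRel_of_eq h₀ heq).1 (hxy h₀)
        refine ⟨y, hy, F.stalkCast heq.symm g, ?_⟩
        have hcast : ∀ {a b : V'} (e : a = b) (m : F.stalk a) (g : F.stalk b) (l : SymAlg k Y),
            F.stalkCast e m = 0 + l • g → m = l • F.stalkCast e.symm g := by
          rintro a _ rfl m g l h
          rw [zero_add] at h
          exact h
        exact hcast heq _ _ _ hg
  obtain ⟨e, he⟩ := hiso
  refine ⟨e.toGrHom, fun v hv => ?_, fun {v v'} h hv hv' m m' => ?_⟩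
  · by_cases hvz : v = z
    · subst hvz
      rw [Function.update_self]
      exact e.toLinearEquiv.bijective
    · rw [Function.update_of_ne hvz]
      exact hφ.1 v (hv.resolve_left hvz)
  · have hvz' : v' ≠ z := by
      rintro rfl
      rcases hv with rfl | hv
      · exact lt_irrefl _ (G.lt_of_adj h)
      · exact hU v hv h
    rw [Function.update_of_ne hvz']
    by_cases hvz : v = z
    · subst hvz
      rw [Function.update_self, ← hθ _ h]
      exact Eq.congr_left (he ⟨v', h⟩ m).symm
    · rw [Function.update_of_ne hvz]
      exact hφ.2 h (hv.resolve_left hvz) (hv'.resolve_left hvz') m m'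

/-- If `F` and `B` are canonical and the pull-back of `F` has the extension property, then the stalks
of `B` are those of the pull-back of `F`. -/
theorem nonempty_grIso_of_hasExtensions [Finite V] (hπ : IsFibration G G' π) {B : KSheaf k G}
    {F : KSheaf k G'} {w : V} (hB : B.IsCanonical w) (hF : F.IsCanonical (π w))
    (hw : ∀ v, v ≤ w) (hout : ∀ v, v ≠ w → ∃ v', G.Adj v v')
    (htop : ∀ x : V', x ≠ π w → ∃ y, G'.Adj x y) (hext : HasExtensions G F π) (v : V) :
    Nonempty (GrIso (B.stalk v) (F.stalk (π v))) := by
  classical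
  -- vertices are treated in decreasing lexicographic order: first the fibre, then the vertex
  let L : V → V → Prop := fun v v' => π v < π v' ∨ (π v = π v' ∧ v < v')
  have hLlt : ∀ {a b}, a < b → L a b := fun {a b} h => by
    rcases (hπ.mono h.le).lt_or_eq with h' | h'
    · exact Or.inl h'
    · exact Or.inr ⟨h', h⟩
  have htrans : ∀ a b c, L a b → L b c → L a c := by
    rintro a b c (h | ⟨h, h'⟩) (g | ⟨g, g'⟩)
    · exact Or.inl (h.trans g)
    · exact Or.inl (g ▸ h)
    · exact Or.inl (h ▸ g)
    · exact Or.inr ⟨h.trans g, h'.trans g'⟩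
  have hirr : ∀ a, ¬ L a a := by
    rintro a (h | ⟨-, h⟩) <;> exact lt_irrefl _ h
  have : IsTrans V L := ⟨htrans⟩
  have : Std.Irrefl L := ⟨hirr⟩
  have hwf : WellFounded L := Finite.wellFounded_of_trans_of_irrefl L
  have key : ∀ U : Set V, (∀ a b, a ∈ U → L a b → b ∈ U) →
      ∃ φ : ∀ v, GrHom (B.stalk v) (F.stalk (π v)), StalkIsos B F U φ := by
    intro U
    induction hN : U.ncard using Nat.strong_induction_on generalizing U with
    | _ N ih =>
    intro hU
    by_cases hne : U.Nonempty
    · obtain ⟨z, hzU, hmin⟩ := hwf.has_min U hne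
      by_cases hzw : z = w
      · subst hzw
        obtain ⟨e⟩ := hB.stalk_top.exists_grIso hF.stalk_top
        have hUz : ∀ v ∈ U, v = z := by
          intro v hv
          by_contra hvz
          exact hmin v hv (hLlt (lt_of_le_of_ne (hw v) hvz))
        refine ⟨Function.update (fun v => ⟨0, fun {i m} _ => zero_mem _⟩) z e.toGrHom,
          fun v hv => ?_, fun {v v'} h hv hv' => ?_⟩
        · obtain rfl := hUz v hv
          rw [Function.update_self]
          exact e.toLinearEquiv.bijective
        · have := G.lt_of_adj h
          rw [hUz v hv, hUz v' hv'] at this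
          exact absurd this (lt_irrefl _)
      · have hcl : ∀ a b, a ∈ U \ {z} → L a b → b ∈ U \ {z} := by
          rintro a b ⟨ha, haz⟩ hab
          refine ⟨hU a b ha hab, ?_⟩
          rintro rfl
          exact hmin a ha hab
        have hlt : (U \ {z}).ncard < N := by
          rw [← hN]
          exact Set.ncard_sdiff_singleton_lt_of_mem hzU (Set.toFinite _)
        obtain ⟨φ, hφ⟩ := ih _ hlt _ rfl hcl
        obtain ⟨f, hf⟩ := hφ.extend hπ hB hF htop hext (z := z) (fun h => h.2 rfl)
          (fun v hv => by
            have hLv : L z v := by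
              rcases hv with hv | hv
              · exact hLlt hv
              · exact Or.inl hv
            refine ⟨hU z v hzU hLv, ?_⟩
            rintro rfl
            exact hirr _ hLv)
          (fun v hv h => hmin v hv.1 (hLlt (G.lt_of_adj h))) (hout z hzw)
        rw [Set.insert_sdiff_singleton, Set.insert_eq_of_mem hzU] at hf
        exact ⟨_, hf⟩
    · rw [Set.not_nonempty_iff_eq_empty] at hne
      subst hne
      exact ⟨fun v => ⟨0, fun {i m} _ => zero_mem _⟩, fun v hv => absurd hv (by simp),
        fun {v v'} h hv => absurd hv (by simp)⟩
  obtain ⟨φ, hφ⟩ := key Set.univ fun _ _ _ _ => trivial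
  exact ⟨GrIso.ofBijective (φ v) (hφ.1 v trivial)⟩

end Comparison

/-! ### The extension property from classes with triangular restrictions -/

section LerayHirsch

variable {k : Type u} [CommRing k] {Y : Type u} [AddCommGroup Y] [Module.Free ℤ Y]
  [Module.Finite ℤ Y] {V V' : Type*} [PartialOrder V] {G : MomentGraph Y V} {π : V → V'}

/-- The labels of two edges starting at the same vertex are coprime in the symmetric algebra. -/
def MomentGraph.HasCoprimeLabels (k : Type u) [CommRing k] (G : MomentGraph Y V) : Prop :=
  ∀ {v v₁ v₂ : V} (h₁ : G.Adj v v₁) (h₂ : G.Adj v v₂), v₁ ≠ v₂ → ∀ f : SymAlg k Y,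
    linForm k (G.label h₁) ∣ linForm k (G.label h₂) * f → linForm k (G.label h₁) ∣ f

/-- Data as in the Leray-Hirsch theorem for the map `π`.  A section `cls` of the structure sheaf with
coefficients in a module `M` is thought of as a family of sections of the structure sheaf, indexed
by a basis of the dual of `M`.  In a suitable basis of `M`, its restriction to a fibre of `π` is
triangular with respect to `rank`, and the diagonal entry at a vertex is, up to a unit, a product of
labels of different edges of the fibre which start at this vertex. -/
structure LerayHirsch (k : Type u) [CommRing k] (G : MomentGraph Y V) (π : V → V') (M : Type*)
    [AddCommGroup M] [Module (SymAlg k Y) M] where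
  cls : V → M
  rank : V → ℕ
  basis : ∀ x : V', Module.Basis {v // π v = x} (SymAlg k Y) M
  cls_adj : ∀ {v v' : V} (h : G.Adj v v'), ∃ g, cls v = cls v' + linForm k (G.label h) • g
  rank_lt : ∀ {v v' : V}, G.Adj v v' → rank v < rank v'
  triangular : ∀ (x : V') (u v : {v // π v = x}), (basis x).repr (cls v) u ≠ 0 →
    u = v ∨ rank v < rank u
  diag : ∀ v : V, ∃ (c : SymAlg k Y) (L : List {v' // G.Adj v v'}), IsUnit c ∧ L.Nodup ∧
    (∀ E ∈ L, π E.1 = π v) ∧ (basis (π v)).repr (cls v) ⟨v, rfl⟩ =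
      c * (L.map fun E => linForm k (G.label E.2)).prod

/-- If a list of elements of a commutative ring is pairwise coprime with respect to a module, then
its product divides an element of the module as soon as its members do. -/
lemma exists_eq_prod_smul {A Q ι : Type*} [CommRing A] [AddCommGroup Q] [Module A Q] (l : ι → A)
    {L : List ι} (hL : L.Nodup)
    (hcop : ∀ i ∈ L, ∀ j ∈ L, i ≠ j → ∀ q q' : Q, l j • q = l i • q' → ∃ q'', q = l i • q'')
    (q : Q) (hq : ∀ i ∈ L, ∃ q', q = l i • q') : ∃ q', q = (L.map l).prod • q' := by
  induction L with
  | nil => exact ⟨q, by simp⟩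
  | cons i L ih =>
    rw [List.nodup_cons] at hL
    obtain ⟨q', hq'⟩ := ih hL.2 (fun i hi j hj => hcop i (.tail _ hi) j (.tail _ hj))
      (fun i hi => hq i (.tail _ hi))
    have h1 : ∀ L' : List ι, (∀ j ∈ L', j ∈ L) → ∀ q' : Q,
        (∃ q'', (L'.map l).prod • q' = l i • q'') → ∃ q'', q' = l i • q'' := by
      intro L'
      induction L' with
      | nil => exact fun _ q' h => by simpa using h
      | cons j L' ih' =>
        rintro hj q' ⟨q'', h⟩
        rw [List.map_cons, List.prod_cons, mul_smul] at h
        refine ih' (fun a ha => hj a (.tail _ ha)) q' (hcop i (.head _) j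
          (.tail _ (hj j (.head _))) ?_ _ _ h)
        rintro rfl
        exact hL.1 (hj i (.head _))
    obtain ⟨q₁, hq₁⟩ := hq i (.head _)
    obtain ⟨q₂, hq₂⟩ := h1 L (fun _ h => h) q' ⟨q₁, by rw [← hq', hq₁]⟩
    refine ⟨q₂, ?_⟩
    rw [List.map_cons, List.prod_cons, mul_comm, mul_smul, ← hq₂, hq']

variable {M : Type*} [AddCommGroup M] [Module (SymAlg k Y) M]

namespace LerayHirsch

/-- A linear map vanishes if it vanishes on the classes of a fibre. -/
lemma eq_zero_of_cls [Finite V] (D : LerayHirsch k G π M) (x : V') {Q : Type*} [AddCommGroup Q]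
    [Module (SymAlg k Y) Q] (hQ : ∀ {v v' : V} (h : G.Adj v v'), π v = x → π v' = x → ∀ q : Q,
      linForm k (G.label h) • q = 0 → q = 0)
    (ν : M →ₗ[SymAlg k Y] Q) (hν : ∀ v, π v = x → ν (D.cls v) = 0) : ν = 0 := by
  classical
  have : Fintype {v // π v = x} := Fintype.ofFinite _
  refine (D.basis x).ext fun u => ?_
  rw [LinearMap.zero_apply]
  by_contra hu
  obtain ⟨v, hv, hmax⟩ := Set.exists_max_image {u : {v // π v = x} | ν (D.basis x u) ≠ 0}
    (fun u => D.rank u) (Set.toFinite _) ⟨u, hu⟩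
  apply hv
  have h1 : D.cls v = ∑ u, (D.basis x).repr (D.cls v) u • D.basis x u :=
    ((D.basis x).sum_repr _).symm
  have h2 := hν v v.2
  rw [h1, map_sum, Finset.sum_eq_single v, map_smul] at h2
  · obtain ⟨v, rfl⟩ := v
    obtain ⟨c, L, hc, -, hL, hdiag⟩ := D.diag v
    rw [hdiag, mul_smul, hc.smul_eq_zero] at h2
    clear hdiag
    induction L with
    | nil => simpa using h2
    | cons E L ih =>
      rw [List.map_cons, List.prod_cons, mul_smul] at h2
      exact ih (hQ E.2 rfl (hL E (.head _)) _ h2) fun E hE => hL E (.tail _ hE)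
  · intro u _ huv
    rw [map_smul]
    by_cases hr : (D.basis x).repr (D.cls v) u = 0
    · rw [hr, zero_smul]
    · rcases D.triangular x u v hr with h | h
      · exact absurd h huv
      · by_cases hu : ν (D.basis x u) = 0
        · rw [hu, smul_zero]
        · exact absurd (hmax u hu) (not_le.2 h)
  · exact fun h => absurd (Finset.mem_univ _) h

/-- Expansion in terms of the classes: sections of the constant sheaf with stalk `Q` over an upper
subset of a fibre, with values in a suitable submodule `K`, are given by linear maps `M → K`. -/
lemma exists_expansion [Finite V] (hG : G.HasCoprimeLabels k) (D : LerayHirsch k G π M) (x : V')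
    {Q : GrMod k Y} (hQ : Q.HasDualBasis) (K : Submodule (SymAlg k Y) Q)
    (hK : ∀ {v v' : V} (h : G.Adj v v'), π v = x → π v' = x → ∀ q : Q,
      linForm k (G.label h) • q ∈ K → q ∈ K)
    (A : Set {v // π v = x}) (hA : ∀ v v' : {v // π v = x}, G.Adj v.1 v'.1 → v ∈ A → v' ∈ A)
    (m : {v // π v = x} → Q) (hmK : ∀ v ∈ A, m v ∈ K)
    (hm : ∀ (v v' : {v // π v = x}) (h : G.Adj v.1 v'.1), v ∈ A → v' ∈ A →
      ∃ g, m v = m v' + linForm k (G.label h) • g) :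
    ∃ N : M →ₗ[SymAlg k Y] Q, (∀ p, N p ∈ K) ∧ ∀ v ∈ A, N (D.cls v.1) = m v := by
  induction hN : A.ncard using Nat.strong_induction_on generalizing A with
  | _ N ih =>
  by_cases hne : A.Nonempty
  · obtain ⟨v, hv, hmin⟩ := Set.exists_min_image A (fun u => D.rank u.1) (Set.toFinite _) hne
    have hlt : (A \ {v}).ncard < N := by
      rw [← hN]
      exact Set.ncard_sdiff_singleton_lt_of_mem hv (Set.toFinite _)
    obtain ⟨N₁, hN₁K, hN₁⟩ := ih _ hlt (A \ {v}) (fun u u' h hu => ⟨hA u u' h hu.1, by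
        rintro rfl
        exact absurd (hmin u hu.1) (not_le.2 (D.rank_lt h))⟩)
      (fun u hu => hmK u hu.1) (fun u u' h hu hu' => hm u u' h hu.1 hu'.1) rfl
    obtain ⟨q, hqK, hq⟩ : ∃ q ∈ K, m v - N₁ (D.cls v.1) = (D.basis x).repr (D.cls v.1) v • q := by
      obtain ⟨v, rfl⟩ := v
      obtain ⟨c, L, hc, hnd, hL, hdiag⟩ := D.diag v
      obtain ⟨q, hq⟩ := exists_eq_prod_smul
        (fun E : {v' // G.Adj v v'} => linForm k (G.label E.2)) hnd
        (fun E _ E' _ hne q q' h => hQ.exists_eq_smul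
          (hG E.2 E'.2 fun e => hne (Subtype.ext e)) h)
        (m ⟨v, rfl⟩ - N₁ (D.cls v)) fun E hE => by
          have hE' := hL E hE
          have hEA := hA ⟨v, rfl⟩ ⟨E.1, hE'⟩ E.2 hv
          obtain ⟨g, hg⟩ := hm ⟨v, rfl⟩ ⟨E.1, hE'⟩ E.2 hv hEA
          obtain ⟨g', hg'⟩ := D.cls_adj E.2
          refine ⟨g - N₁ g', ?_⟩
          rw [hg, hg', map_add, map_smul, hN₁ ⟨E.1, hE'⟩ ⟨hEA, fun e =>
            (G.lt_of_adj E.2).ne' (congrArg Subtype.val e)⟩, smul_sub]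
          abel
      have hqK : q ∈ K := by
        have h1 : (L.map fun E => linForm k (G.label E.2)).prod • q ∈ K := by
          rw [← hq]
          exact K.sub_mem (hmK _ hv) (hN₁K _)
        clear hq hdiag
        induction L with
        | nil => simpa using h1
        | cons E L ih =>
          rw [List.map_cons, List.prod_cons, mul_smul] at h1
          exact ih (List.nodup_cons.1 hnd).2 (fun E hE => hL E (.tail _ hE))
            (hK E.2 rfl (hL E (.head _)) _ h1)
      obtain ⟨c', hc'⟩ := hc.exists_right_inv
      refine ⟨c' • q, K.smul_mem _ hqK, ?_⟩
      rw [hdiag, hq, smul_smul, mul_right_comm, hc', one_mul]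
    refine ⟨N₁ + ((D.basis x).coord v).smulRight q, fun p => ?_, fun u hu => ?_⟩
    · exact K.add_mem (hN₁K p) (K.smul_mem _ hqK)
    · rw [LinearMap.add_apply, LinearMap.smulRight_apply, Module.Basis.coord_apply]
      by_cases huv : u = v
      · subst huv
        rw [← hq]
        abel
      · rw [hN₁ u ⟨hu, huv⟩]
        by_cases hr : (D.basis x).repr (D.cls u.1) v = 0
        · rw [hr, zero_smul, add_zero]
        · rcases D.triangular x v u hr with h | h
          · exact absurd h.symm huv
          · exact absurd (hmin u hu) (not_le.2 h)
  · rw [Set.not_nonempty_iff_eq_empty] at hne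
    subst hne
    exact ⟨0, fun _ => K.zero_mem, fun v hv => absurd hv (Set.notMem_empty v)⟩

variable [PartialOrder V'] {G' : MomentGraph Y V'}

/-- The labels of the edges within the fibre of `x` are regular on the modules on the edges of the
canonical sheaf `F` which start at `x`. -/
lemma smul_eq_zero_of_edge (hG : G.HasCoprimeLabels k) (hπ : IsFibration G G' π) {F : KSheaf k G'}
    {w' : V'} (hF : F.IsCanonical w') (hdual : ∀ x, (F.stalk x).HasDualBasis) {x y : V'}
    (h' : G'.Adj x y) {v v' : V} (h : G.Adj v v') (hv : π v = x) (hv' : π v' = x) (q : F.edge h')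
    (hq : linForm k (G.label h) • q = 0) : q = 0 := by
  obtain ⟨v₁, h₁, rfl⟩ := hπ.lift h' hv
  subst hv
  obtain ⟨h'', hl⟩ := hπ.push h₁ (G'.lt_of_adj h').ne
  obtain ⟨m, rfl⟩ := hF.tgtMap_surjective h' q
  rw [← map_smul, hF.tgtMap_eq_zero_iff, hl] at hq
  obtain ⟨m', hm'⟩ := hq
  rw [hF.tgtMap_eq_zero_iff, hl]
  refine (hdual _).exists_eq_smul (hG h₁ h ?_) hm'
  rintro rfl
  exact (G'.lt_of_adj h').ne hv'.symm

/-- The extension property of the pull-back of a canonical sheaf. -/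
theorem hasExtensions [Finite V] (hG : G.HasCoprimeLabels k) (D : LerayHirsch k G π M)
    (hπ : IsFibration G G' π) {F : KSheaf k G'} {w' : V'} (hF : F.IsCanonical w')
    (hdual : ∀ x, (F.stalk x).HasDualBasis) : HasExtensions G F π := by
  classical
  intro z n hn
  -- over the fibres above the fibre of `z`, the section is given by linear maps `N y`
  have hN : ∀ y : V', ∃ N : M →ₗ[SymAlg k Y] F.stalk y, π z < y →
      ∀ (v : V) (e : π v = y), N (D.cls v) = F.stalkCast e (n v) := by
    intro y
    by_cases hy : π z < y
    · obtain ⟨N, -, hN⟩ := D.exists_expansion hG y (hdual y) ⊤ (fun _ _ _ _ _ => trivial) Set.univ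
        (fun _ _ _ _ => trivial) (fun v => F.stalkCast v.2 (n v.1)) (fun _ _ => trivial)
        fun v v' h _ _ => by
          obtain ⟨v, rfl⟩ := v
          obtain ⟨v', hv'⟩ := v'
          have hrel := hn h (Or.inr hy) (Or.inr (by rwa [hv']))
          obtain ⟨g, hg⟩ := (pullRel_of_eq h hv'.symm).1 hrel
          refine ⟨F.stalkCast hv' g, ?_⟩
          have hcast : ∀ {a b : V'} (e : a = b) (e' : b = a) (m : F.stalk a) (m' g : F.stalk b)
              (l : SymAlg k Y), F.stalkCast e m = m' + l • g →
              F.stalkCast rfl m = F.stalkCast e' m' + l • F.stalkCast e' g := by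
            rintro a _ rfl _ m m' g l h
            exact h
          exact hcast hv'.symm hv' _ _ _ _ hg
      exact ⟨N, fun _ v e => hN ⟨v, e⟩ trivial⟩
    · exact ⟨0, fun h => absurd h hy⟩
  choose N hN using hN
  have hNv : ∀ v, π z < π v → N (π v) (D.cls v) = n v := fun v hv => hN _ hv v rfl
  have hker : ∀ {v v' : V} (h : G.Adj v v') (h' : G'.Adj (π v) (π v')) (q : F.edge h'),
      linForm k (G.label h) • q = 0 := by
    intro v v' h h' q
    obtain ⟨_, hl⟩ := hπ.push h (G'.lt_of_adj h').ne
    rw [← hl]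
    exact F.label_smul h' q
  -- the values of the maps `N y` are sections
  have hNsec : ∀ p, F.IsSection (Set.Ioi (π z)) fun y => N y p := by
    intro p x y h' hx hy
    have h0 : (F.srcMap h').toLinearMap ∘ₗ N x - (F.tgtMap h').toLinearMap ∘ₗ N y = 0 := by
      refine D.eq_zero_of_cls x (fun h hv hv' => smul_eq_zero_of_edge hG hπ hF hdual h' h hv hv') _
        fun v hv => ?_
      obtain ⟨v', h, rfl⟩ := hπ.lift h' hv
      subst hv
      have h1 := (pullRel_of_adj h h').1 (hn h (Or.inr hx) (Or.inr hy))
      obtain ⟨g, hg⟩ := D.cls_adj h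
      rw [LinearMap.sub_apply, LinearMap.comp_apply, LinearMap.comp_apply, hNv v hx, h1, hg,
        map_add, map_smul, hNv v' hy, map_add, map_smul, hker h h', add_zero, sub_self]
    exact sub_eq_zero.1 (LinearMap.congr_fun h0 p)
  -- a linear map with values in the stalk at `π z` and the same boundary values
  obtain ⟨Nz, hNz⟩ : ∃ Nz : M →ₗ[SymAlg k Y] F.stalk (π z), ∀ p {y} (h : G'.Adj (π z) y),
      F.srcMap h (Nz p) = F.tgtMap h (N y p) := by
    choose f hf using fun p => hF.exists_stalk (π z) (hNsec p)
    refine ⟨(D.basis (π z)).constr (SymAlg k Y) fun u => f (D.basis (π z) u), fun p y h => ?_⟩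
    have h0 : (F.srcMap h).toLinearMap ∘ₗ
        ((D.basis (π z)).constr (SymAlg k Y) fun u => f (D.basis (π z) u)) =
        (F.tgtMap h).toLinearMap ∘ₗ N y := by
      refine (D.basis (π z)).ext fun u => ?_
      rw [LinearMap.comp_apply, Module.Basis.constr_basis]
      exact hf _ h
    exact LinearMap.congr_fun h0 p
  let K : Submodule (SymAlg k Y) (F.stalk (π z)) :=
    ⨅ E : {y // G'.Adj (π z) y}, LinearMap.ker (F.srcMap E.2).toLinearMap
  have hKmem : ∀ q, q ∈ K ↔ ∀ {y} (h : G'.Adj (π z) y), F.srcMap h q = 0 := by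
    intro q
    simp only [K, Submodule.mem_iInf, LinearMap.mem_ker, Subtype.forall]
  -- the correction on the vertices of the fibre of `z` above `z`
  have hcast : ∀ {a b c : V'} (e : a = b) (e' : a = c) (e'' : b = c) (m : F.stalk a)
      (m' g : F.stalk b) (l : SymAlg k Y), F.stalkCast e m = m' + l • g →
      F.stalkCast e' m = F.stalkCast e'' m' + l • F.stalkCast e'' g := by
    rintro a _ _ rfl rfl _ m m' g l h
    exact h
  obtain ⟨N', hN'K, hN'⟩ := D.exists_expansion hG (π z) (hdual _) K
    (fun {v v'} h hv hv' q hq => by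
      rw [hKmem] at hq ⊢
      intro y h'
      refine smul_eq_zero_of_edge hG hπ hF hdual h' h hv hv' _ ?_
      rw [← map_smul]
      exact hq h')
    {v | z < v.1} (fun v v' h hv => lt_trans hv (G.lt_of_adj h))
    (fun v => F.stalkCast v.2 (n v.1) - Nz (D.cls v.1))
    (fun v hv => by
      obtain ⟨v, e⟩ := v
      rw [hKmem]
      intro y h'
      obtain ⟨v', h, rfl⟩ := hπ.lift h' e
      have hpush : ∀ {a : V'} (e : π v = a) (h' : G'.Adj a (π v')),
          F.srcMap h' (F.stalkCast e (n v)) = F.tgtMap h' (n v') := by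
        rintro _ rfl h'
        exact (pullRel_of_adj h h').1 (hn h (Or.inl hv) (Or.inl (lt_trans hv (G.lt_of_adj h))))
      have hker' : ∀ {a : V'} (e : π v = a) (h' : G'.Adj a (π v')) (q : F.edge h'),
          linForm k (G.label h) • q = 0 := by
        rintro _ rfl h' q
        exact hker h h' q
      obtain ⟨g, hg⟩ := D.cls_adj h
      rw [map_sub, hpush, hNz, hg, map_add, map_smul, map_add, map_smul, hker' e,
        hNv v' (G'.lt_of_adj h'), add_zero, sub_self])
    (fun v v' h hv hv' => by
      obtain ⟨v, e⟩ := v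
      obtain ⟨v', e'⟩ := v'
      obtain ⟨g, hg⟩ := (pullRel_of_eq h (e.trans e'.symm)).1 (hn h (Or.inl hv) (Or.inl hv'))
      obtain ⟨g', hg'⟩ := D.cls_adj h
      refine ⟨F.stalkCast e' g - Nz g', ?_⟩
      rw [hcast _ e e' _ _ _ _ hg, hg', map_add, map_smul, smul_sub]
      abel)
  refine ⟨Nz (D.cls z) + N' (D.cls z), fun {v} h => ?_⟩
  obtain ⟨g, hg⟩ := D.cls_adj h
  by_cases e : π z = π v
  · rw [pullRel_of_eq h e]
    have h1 := hN' ⟨v, e.symm⟩ (G.lt_of_adj h)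
    refine ⟨F.stalkCast e (Nz g + N' g), ?_⟩
    have h2 : Nz (D.cls z) + N' (D.cls z) =
        F.stalkCast e.symm (n v) + linForm k (G.label h) • (Nz g + N' g) := by
      rw [hg, map_add, map_add, h1, map_smul, map_smul, smul_add]
      abel
    have hcast' : ∀ {a b : V'} (e : a = b) (m g : F.stalk a) (m' : F.stalk b) (l : SymAlg k Y),
        m = F.stalkCast e.symm m' + l • g → F.stalkCast e m = m' + l • F.stalkCast e g := by
      rintro a _ rfl m g m' l h
      exact h
    exact hcast' e _ _ _ _ h2
  · obtain ⟨h', -⟩ := hπ.push h e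
    rw [pullRel_of_adj h h', map_add, (hKmem _).1 (hN'K _) h', add_zero, hNz, hg, map_add, map_smul,
      map_add, map_smul, hker h h', add_zero, hNv v (G'.lt_of_adj h')]

end LerayHirsch

end LerayHirsch

/-! ### Braid relations for twisted products in nil Coxeter algebras of rank two -/

section Involutions

variable {G : Type*} [Monoid G] {s t : G}

lemma pow_two_iff (hs : s * s = 1) (ht : t * t = 1) : (s * t) ^ 2 = 1 ↔ s * t = t * s := by
  have hs' : ∀ x, s * (s * x) = x := fun x => by rw [← mul_assoc, hs, one_mul]
  have ht' : ∀ x, t * (t * x) = x := fun x => by rw [← mul_assoc, ht, one_mul]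
  constructor <;> intro h
  · have h1 := congrArg (· * (t * s)) h
    simpa only [pow_succ, pow_zero, one_mul, mul_assoc, hs, hs', ht', mul_one] using h1
  · rw [pow_two]
    nth_rewrite 2 [h]
    simp only [mul_assoc, hs, ht']

lemma pow_three_iff (hs : s * s = 1) (ht : t * t = 1) :
    (s * t) ^ 3 = 1 ↔ s * t * s = t * s * t := by
  have hs' : ∀ x, s * (s * x) = x := fun x => by rw [← mul_assoc, hs, one_mul]
  have ht' : ∀ x, t * (t * x) = x := fun x => by rw [← mul_assoc, ht, one_mul]
  constructor <;> intro h
  · have h1 := congrArg (· * (t * s * t)) h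
    simpa only [pow_succ, pow_zero, one_mul, mul_assoc, hs', ht', ht, mul_one] using h1
  · rw [show (s * t) ^ 3 = s * t * s * (t * s * t) by simp only [pow_succ, pow_zero, one_mul, mul_assoc],
      ← h]
    simp only [mul_assoc, hs, ht', hs']

lemma pow_four_iff (hs : s * s = 1) (ht : t * t = 1) :
    (s * t) ^ 4 = 1 ↔ s * t * s * t = t * s * t * s := by
  have hs' : ∀ x, s * (s * x) = x := fun x => by rw [← mul_assoc, hs, one_mul]
  have ht' : ∀ x, t * (t * x) = x := fun x => by rw [← mul_assoc, ht, one_mul]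
  constructor <;> intro h
  · have h1 := congrArg (· * (t * s * t * s)) h
    simpa only [pow_succ, pow_zero, one_mul, mul_assoc, hs', ht', hs, mul_one] using h1
  · rw [show (s * t) ^ 4 = s * t * s * t * (s * t * s * t) by
      simp only [pow_succ, pow_zero, one_mul, mul_assoc]]
    nth_rewrite 2 [h]
    simp only [mul_assoc, hs, ht', hs']

lemma pow_six_iff (hs : s * s = 1) (ht : t * t = 1) :
    (s * t) ^ 6 = 1 ↔ s * t * s * t * s * t = t * s * t * s * t * s := by
  have hs' : ∀ x, s * (s * x) = x := fun x => by rw [← mul_assoc, hs, one_mul]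
  have ht' : ∀ x, t * (t * x) = x := fun x => by rw [← mul_assoc, ht, one_mul]
  constructor <;> intro h
  · have h1 := congrArg (· * (t * s * t * s * t * s)) h
    simpa only [pow_succ, pow_zero, one_mul, mul_assoc, hs', ht', hs, mul_one] using h1
  · rw [show (s * t) ^ 6 = s * t * s * t * s * t * (s * t * s * t * s * t) by
      simp only [pow_succ, pow_zero, one_mul, mul_assoc]]
    nth_rewrite 2 [h]
    simp only [mul_assoc, hs, ht', hs']

lemma pow_eq_one_swap (ht : t * t = 1) {m : ℕ} (h : (s * t) ^ m = 1) :
    (t * s) ^ m = 1 := by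
  have h1 : t * (s * t) ^ m * t = 1 := by rw [h, mul_one, ht]
  rwa [← mul_pow_mul, mul_assoc, ht, mul_one] at h1

end Involutions

section YangBaxter

variable {S A W : Type*} [CommRing S] [Ring A] [Group W]

/-- A crossed product situation: `coef` and `grp` embed coefficients and group elements, and `X`, `Y`
are elements of square zero which commute with both. -/
structure NilPair (coef : S →+* A) (σ : W →* (S →+* S)) (grp : W →* A) (X Y : A) : Prop where
  grp_coef : ∀ g f, grp g * coef f = coef (σ g f) * grp g
  coef_left : ∀ f, Commute (coef f) X
  coef_right : ∀ f, Commute (coef f) Y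
  grp_left : ∀ g, Commute (grp g) X
  grp_right : ∀ g, Commute (grp g) Y
  left_sq : X * X = 0
  right_sq : Y * Y = 0

/-- Linear combinations of the alternating words in two letters of length at most six. -/
def altComb (coef : S →+* A) (X Y : A) (c₀ x₁ y₁ x₂ y₂ x₃ y₃ x₄ y₄ x₅ y₅ x₆ y₆ : S) : A :=
  coef c₀ * 1 + coef x₁ * X + coef y₁ * Y + coef x₂ * (X * Y) + coef y₂ * (Y * X) +
    coef x₃ * (X * Y * X) + coef y₃ * (Y * X * Y) + coef x₄ * (X * Y * X * Y) +
    coef y₄ * (Y * X * Y * X) + coef x₅ * (X * Y * X * Y * X) + coef y₅ * (Y * X * Y * X * Y) +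
    coef x₆ * (X * Y * X * Y * X * Y) + coef y₆ * (Y * X * Y * X * Y * X)

variable {coef : S →+* A} {σ : W →* (S →+* S)} {grp : W →* A} {X Y : A}

namespace NilPair

lemma symm (h : NilPair coef σ grp X Y) : NilPair coef σ grp Y X :=
  ⟨h.grp_coef, h.coef_right, h.coef_left, h.grp_right, h.grp_left, h.right_sq, h.left_sq⟩

variable {s t : W} {a b : S} {U V : A}

lemma altComb_mul_left (h : NilPair coef σ grp X Y) (hU : U = (1 - coef a * X) * grp s) (g : W)
    (c₀ x₁ y₁ x₂ y₂ x₃ y₃ x₄ y₄ x₅ y₅ y₆ : S) :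
    altComb coef X Y c₀ x₁ y₁ x₂ y₂ x₃ y₃ x₄ y₄ x₅ y₅ 0 y₆ * grp g * U =
      altComb coef X Y c₀ (x₁ - c₀ * σ g a) y₁ x₂ (y₂ - y₁ * σ g a) (x₃ - x₂ * σ g a) y₃ x₄
        (y₄ - y₃ * σ g a) (x₅ - x₄ * σ g a) y₅ 0 (y₆ - y₅ * σ g a) * grp (g * s) := by
  have h1 : grp g * (1 - coef a * X) = (1 - coef (σ g a) * X) * grp g := by
    rw [mul_sub, sub_mul, mul_one, one_mul, ← mul_assoc, h.grp_coef, mul_assoc, mul_assoc,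
      (h.grp_left g).eq]
  rw [hU, ← mul_assoc, mul_assoc _ (grp g), h1, map_mul, ← mul_assoc, ← mul_assoc]
  congr 2
  set r := σ g a
  have key : ∀ (c : S) (w : A), Commute (coef r) w →
      coef c * w * (1 - coef r * X) = coef c * w - coef (c * r) * (w * X) := by
    intro c w hw
    rw [mul_sub, mul_one, map_mul]
    congr 1
    simp only [mul_assoc]
    rw [← mul_assoc w, ← hw.eq, mul_assoc]
  have hX := h.coef_left r
  have hY := h.coef_right r
  have hXX := h.left_sq
  have e : ∀ w : A, w * X * X = 0 := fun w => by rw [mul_assoc, hXX, mul_zero]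
  simp only [altComb, add_mul _ _ (1 - coef r * X)]
  rw [key _ _ (Commute.one_right _), key _ _ hX, key _ _ hY, key _ _ (hX.mul_right hY),
    key _ _ (hY.mul_right hX), key _ _ ((hX.mul_right hY).mul_right hX),
    key _ _ ((hY.mul_right hX).mul_right hY),
    key _ _ (((hX.mul_right hY).mul_right hX).mul_right hY),
    key _ _ (((hY.mul_right hX).mul_right hY).mul_right hX),
    key _ _ ((((hX.mul_right hY).mul_right hX).mul_right hY).mul_right hX),
    key _ _ ((((hY.mul_right hX).mul_right hY).mul_right hX).mul_right hY),
    key _ _ (((((hX.mul_right hY).mul_right hX).mul_right hY).mul_right hX).mul_right hY),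
    key _ _ (((((hY.mul_right hX).mul_right hY).mul_right hX).mul_right hY).mul_right hX)]
  simp only [e, hXX, mul_zero, one_mul, zero_mul, map_zero, map_sub, sub_mul]
  abel

lemma altComb_swap (c₀ x₁ y₁ x₂ y₂ x₃ y₃ x₄ y₄ x₅ y₅ x₆ y₆ : S) :
    altComb coef X Y c₀ x₁ y₁ x₂ y₂ x₃ y₃ x₄ y₄ x₅ y₅ x₆ y₆ =
      altComb coef Y X c₀ y₁ x₁ y₂ x₂ y₃ x₃ y₄ x₄ y₅ x₅ y₆ x₆ := by
  unfold altComb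
  abel

lemma altComb_mul_right (h : NilPair coef σ grp X Y) (hV : V = (1 - coef b * Y) * grp t) (g : W)
    (c₀ x₁ y₁ x₂ y₂ x₃ y₃ x₄ y₄ x₅ y₅ x₆ : S) :
    altComb coef X Y c₀ x₁ y₁ x₂ y₂ x₃ y₃ x₄ y₄ x₅ y₅ x₆ 0 * grp g * V =
      altComb coef X Y c₀ x₁ (y₁ - c₀ * σ g b) (x₂ - x₁ * σ g b) y₂ x₃ (y₃ - y₂ * σ g b)
        (x₄ - x₃ * σ g b) y₄ x₅ (y₅ - y₄ * σ g b) (x₆ - x₅ * σ g b) 0 * grp (g * t) := by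
  rw [altComb_swap, h.symm.altComb_mul_left hV, altComb_swap]

lemma one_eq_altComb : (1 : A) = altComb coef X Y 1 0 0 0 0 0 0 0 0 0 0 0 0 * grp 1 := by
  simp [altComb]

lemma mul_self (h : NilPair coef σ grp X Y) (hU : U = (1 - coef a * X) * grp s) (hs : s * s = 1)
    (hsa : σ s a = -a) : U * U = 1 := by
  have hσ₁ : ∀ f, σ 1 f = f := fun f => by rw [map_one]; rfl
  rw [← one_mul (U * U), one_eq_altComb (coef := coef) (grp := grp) (X := X) (Y := Y), ← mul_assoc]
  simp only [h.altComb_mul_left hU, hσ₁, one_mul, zero_mul, sub_zero, hsa,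
    zero_sub, sub_neg_eq_add, neg_add_cancel, hs]

/-- The braid relations for the elements `(1 - a X) s` and `(1 - b Y) t`, if `s` and `t` commute. -/
lemma braid_two (h : NilPair coef σ grp X Y) (hU : U = (1 - coef a * X) * grp s)
    (hV : V = (1 - coef b * Y) * grp t) (hsb : σ s b = b) (hta : σ t a = a) (hst : s * t = t * s)
    (hXY : X * Y = Y * X) : U * V = V * U := by
  have hσ₁ : ∀ f, σ 1 f = f := fun f => by rw [map_one]; rfl
  rw [← one_mul (U * V), ← one_mul (V * U),
    one_eq_altComb (coef := coef) (grp := grp) (X := X) (Y := Y), ← mul_assoc, ← mul_assoc]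
  simp only [h.altComb_mul_left hU,
    h.altComb_mul_right hV, hσ₁, one_mul, zero_mul, sub_zero,
    zero_sub, hsb, hta, hst]
  congr 1
  unfold altComb
  rw [hXY]
  simp only [map_zero, zero_mul, add_zero]
  ring_nf

/-- The braid relation of length three. -/
lemma braid_three (h : NilPair coef σ grp X Y) (hU : U = (1 - coef a * X) * grp s)
    (hV : V = (1 - coef b * Y) * grp t) (hsa : σ s a = -a) (htb : σ t b = -b)
    (hsb : σ s b = b + a) (hta : σ t a = a + b) (hst : s * t * s = t * s * t)
    (hXY : X * Y * X = Y * X * Y) : U * V * U = V * U * V := by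
  have hσ₁ : ∀ f, σ 1 f = f := fun f => by rw [map_one]; rfl
  have hσ : ∀ g g' f, σ (g * g') f = σ g (σ g' f) := fun g g' f => by rw [map_mul]; rfl
  rw [← one_mul (U * V * U), ← one_mul (V * U * V),
    one_eq_altComb (coef := coef) (grp := grp) (X := X) (Y := Y)]
  simp only [← mul_assoc, h.altComb_mul_left hU,
    h.altComb_mul_right hV, hσ₁, one_mul, zero_mul,
    sub_zero, zero_sub, hst, hσ, map_add, hsa,
    htb, hsb, hta]
  congr 1
  unfold altComb
  rw [hXY]
  simp only [map_zero, zero_mul, add_zero]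
  ring_nf

/-- The braid relation of length four. -/
lemma braid_four (h : NilPair coef σ grp X Y) (hU : U = (1 - coef a * X) * grp s)
    (hV : V = (1 - coef b * Y) * grp t) (hsa : σ s a = -a) (htb : σ t b = -b)
    (hsb : σ s b = b + 2 * a) (hta : σ t a = a + b) (hst : s * t * s * t = t * s * t * s)
    (hXY : X * Y * X * Y = Y * X * Y * X) : U * V * U * V = V * U * V * U := by
  have hσ₁ : ∀ f, σ 1 f = f := fun f => by rw [map_one]; rfl
  have hσ : ∀ g g' f, σ (g * g') f = σ g (σ g' f) := fun g g' f => by rw [map_mul]; rfl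
  rw [← one_mul (U * V * U * V), ← one_mul (V * U * V * U),
    one_eq_altComb (coef := coef) (grp := grp) (X := X) (Y := Y)]
  simp only [← mul_assoc, h.altComb_mul_left hU,
    h.altComb_mul_right hV, hσ₁, one_mul, zero_mul,
    sub_zero, zero_sub, hst, hσ, map_mul (σ s), map_mul (σ t), map_add, map_neg, hsa,
    htb, hsb, hta, map_ofNat]
  congr 1
  unfold altComb
  rw [hXY]
  simp only [map_zero, zero_mul, add_zero]
  ring_nf

/-- The braid relation of length six. -/
lemma braid_six (h : NilPair coef σ grp X Y) (hU : U = (1 - coef a * X) * grp s)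
    (hV : V = (1 - coef b * Y) * grp t) (hsa : σ s a = -a) (htb : σ t b = -b)
    (hsb : σ s b = b + 3 * a) (hta : σ t a = a + b)
    (hst : s * t * s * t * s * t = t * s * t * s * t * s)
    (hXY : X * Y * X * Y * X * Y = Y * X * Y * X * Y * X) :
    U * V * U * V * U * V = V * U * V * U * V * U := by
  have hσ₁ : ∀ f, σ 1 f = f := fun f => by rw [map_one]; rfl
  have hσ : ∀ g g' f, σ (g * g') f = σ g (σ g' f) := fun g g' f => by rw [map_mul]; rfl
  rw [← one_mul (U * V * U * V * U * V), ← one_mul (V * U * V * U * V * U),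
    one_eq_altComb (coef := coef) (grp := grp) (X := X) (Y := Y)]
  simp only [← mul_assoc, h.altComb_mul_left hU,
    h.altComb_mul_right hV, hσ₁, one_mul, zero_mul,
    sub_zero, zero_sub, hst, hσ, map_mul (σ s), map_mul (σ t), map_add, map_neg, hsa,
    htb, hsb, hta, map_ofNat]
  congr 1
  unfold altComb
  rw [hXY]
  simp only [map_zero, zero_mul, add_zero]
  ring_nf

end NilPair

end YangBaxter

namespace Realization

variable {n : ℕ} {C : SymGCM n} {H : Type u} [AddCommGroup H] [Module ℂ H]
  (R : Realization C H)

/-! ### The action of the Weyl group on the symmetric algebra -/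

/-- The action of the Weyl group on the coroot lattice. -/
def latticeHom (w : R.weylGroup) : R.corootLattice →ₗ[ℤ] R.corootLattice :=
  ((w : H ≃ₗ[ℂ] H).toLinearMap.restrictScalars ℤ).restrict (R.weyl_mem_corootLattice w)

@[simp] lemma coe_latticeHom (w : R.weylGroup) (c : R.corootLattice) :
    (R.latticeHom w c : H) = (w : H ≃ₗ[ℂ] H) c := rfl

lemma latticeHom_mul (w w' : R.weylGroup) (c : R.corootLattice) :
    R.latticeHom (w * w') c = R.latticeHom w (R.latticeHom w' c) := rfl

/-- The simple coroots as elements of the coroot lattice. -/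
def simpleCoroot (i : Fin n) : R.corootLattice := ⟨R.coroot i, Submodule.subset_span ⟨i, rfl⟩⟩

lemma latticeHom_s (i : Fin n) (c : R.corootLattice) :
    ∃ a : ℤ, R.latticeHom (R.s i) c = c + a • R.simpleCoroot i := by
  obtain ⟨c, hc⟩ := c
  induction hc using Submodule.span_induction with
  | mem x hx =>
    obtain ⟨j, rfl⟩ := hx
    refine ⟨-C.A j i, Subtype.ext ?_⟩
    rw [coe_latticeHom, s_apply, R.pairing]
    simp [simpleCoroot, sub_eq_add_neg, Int.cast_smul_eq_zsmul]
  | zero => exact ⟨0, Subtype.ext (by simp)⟩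
  | add x y hx hy ihx ihy =>
    obtain ⟨a, ha⟩ := ihx
    obtain ⟨b, hb⟩ := ihy
    refine ⟨a + b, ?_⟩
    have : (⟨x + y, R.corootLattice.add_mem hx hy⟩ : R.corootLattice) = ⟨x, hx⟩ + ⟨y, hy⟩ := rfl
    rw [this, map_add, ha, hb]
    module
  | smul r x hx ih =>
    obtain ⟨a, ha⟩ := ih
    refine ⟨r * a, ?_⟩
    have : (⟨r • x, R.corootLattice.smul_mem r hx⟩ : R.corootLattice) = r • ⟨x, hx⟩ := rfl
    rw [this, map_smul, ha]
    module

lemma latticeHom_s_simpleCoroot (i j : Fin n) :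
    R.latticeHom (R.s i) (R.simpleCoroot j) = R.simpleCoroot j - C.A j i • R.simpleCoroot i := by
  apply Subtype.ext
  rw [coe_latticeHom, s_apply]
  simp [simpleCoroot, R.pairing, Int.cast_smul_eq_zsmul]

variable (k : Type u) [CommRing k]

/-- The action of an element of the Weyl group on the symmetric algebra. -/
noncomputable def symHom (w : R.weylGroup) :
    SymAlg k R.corootLattice →ₐ[k] SymAlg k R.corootLattice :=
  SymmetricAlgebra.lift
    (SymmetricAlgebra.ι k (k ⊗[ℤ] R.corootLattice) ∘ₗ (R.latticeHom w).baseChange k)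

lemma symHom_ι (w : R.weylGroup) (m : k ⊗[ℤ] R.corootLattice) :
    R.symHom k w (SymmetricAlgebra.ι k _ m) =
      SymmetricAlgebra.ι k _ ((R.latticeHom w).baseChange k m) := by
  rw [symHom, SymmetricAlgebra.lift_ι_apply]
  rfl

lemma symHom_linForm (w : R.weylGroup) (c : R.corootLattice) :
    R.symHom k w (linForm k c) = linForm k (R.latticeHom w c) := by
  rw [linForm, symHom_ι, LinearMap.baseChange_tmul]
  rfl

/-- The action of the Weyl group on the symmetric algebra by ring endomorphisms. -/
noncomputable def symAct : R.weylGroup →* (SymAlg k R.corootLattice →+* SymAlg k R.corootLattice) where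
  toFun w := (R.symHom k w : SymAlg k R.corootLattice →+* SymAlg k R.corootLattice)
  map_one' := by
    have : R.symHom k 1 = AlgHom.id k _ := by
      refine SymmetricAlgebra.algHom_ext (LinearMap.ext fun m => ?_)
      have h1 : R.latticeHom 1 = LinearMap.id := rfl
      change R.symHom k 1 (SymmetricAlgebra.ι k _ m) = SymmetricAlgebra.ι k _ m
      rw [symHom_ι, h1, LinearMap.baseChange_id, LinearMap.id_apply]
    rw [this]
    rfl
  map_mul' w w' := by
    have : R.symHom k (w * w') = (R.symHom k w).comp (R.symHom k w') := by
      refine SymmetricAlgebra.algHom_ext (LinearMap.ext fun m => ?_)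
      have h1 : R.latticeHom (w * w') = R.latticeHom w ∘ₗ R.latticeHom w' := rfl
      change R.symHom k (w * w') (SymmetricAlgebra.ι k _ m) =
        R.symHom k w (R.symHom k w' (SymmetricAlgebra.ι k _ m))
      rw [symHom_ι, h1, LinearMap.baseChange_comp, symHom_ι, symHom_ι, LinearMap.comp_apply]
    rw [this]
    rfl

lemma symAct_linForm (w : R.weylGroup) (c : R.corootLattice) :
    R.symAct k w (linForm k c) = linForm k (R.latticeHom w c) :=
  R.symHom_linForm k w c

lemma dvd_symAct_s_sub (i : Fin n) (f : SymAlg k R.corootLattice) :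
    linForm k (R.simpleCoroot i) ∣ R.symAct k (R.s i) f - f := by
  refine dvd_sub_of_dvd_sub_ι (φ := R.symHom k (R.s i)) (ψ := AlgHom.id k _) (fun m => ?_) f
  induction m using TensorProduct.induction_on with
  | zero => simp
  | tmul r c =>
    obtain ⟨a, ha⟩ := R.latticeHom_s i c
    rw [symHom_ι, LinearMap.baseChange_tmul, ha, AlgHom.id_apply, TensorProduct.tmul_add, map_add,
      add_sub_cancel_left]
    refine ⟨algebraMap k _ (r * a), ?_⟩
    rw [linForm, mul_comm, ← Algebra.smul_def, ← map_smul, TensorProduct.smul_tmul', smul_eq_mul, mul_one,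
      ← TensorProduct.smul_tmul, mul_comm, zsmul_eq_mul]
  | add x y hx hy =>
    rw [map_add, map_add, map_add, add_sub_add_comm]
    exact dvd_add hx hy

/-! ### Equivariant Schubert classes -/

variable (J : Set (Fin n))

open Classical in
/-- The generators of a parabolic subgroup, extended by `1` to all indices. -/
noncomputable def parS (j : Fin n) : R.parabolic J :=
  if h : j ∈ J then ⟨R.s j, R.s_mem_parabolic h⟩ else 1

lemma coe_parS_of_mem {j : Fin n} (h : j ∈ J) : (R.parS J j : R.weylGroup) = R.s j := by
  rw [parS, dif_pos h]

lemma parS_of_notMem {j : Fin n} (h : j ∉ J) : R.parS J j = 1 := by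
  rw [parS, dif_neg h]

lemma parS_mul_self (j : Fin n) : R.parS J j * R.parS J j = 1 := by
  by_cases h : j ∈ J
  · apply Subtype.ext
    rw [Subgroup.coe_mul, R.coe_parS_of_mem J h, s_mul_self, Subgroup.coe_one]
  · rw [R.parS_of_notMem J h, one_mul]

lemma parS_inv (j : Fin n) : (R.parS J j)⁻¹ = R.parS J j :=
  inv_eq_of_mul_eq_one_right (R.parS_mul_self J j)

lemma length_parS_mul (j : Fin n) (u : R.parabolic J) :
    R.length u ≤ R.length (R.parS J j * u : R.parabolic J) + 1 := by
  by_cases h : j ∈ J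
  · rw [Subgroup.coe_mul, R.coe_parS_of_mem J h]
    rcases R.length_s_mul (u : R.weylGroup) j with h | h <;> omega
  · rw [R.parS_of_notMem J h, one_mul]
    omega

/-- Functions on a parabolic subgroup with values in the symmetric algebra: the coefficients of the
elements of the nil Coxeter algebra with respect to its standard basis. -/
abbrev ParFun : Type u := R.parabolic J → SymAlg k R.corootLattice

/-- Multiplication by a generator of the nil Coxeter algebra. -/
noncomputable def nilMul (j : Fin n) : AddMonoid.End (R.ParFun k J) where
  toFun p u := if R.length (R.parS J j * u : R.parabolic J) < R.length u then p (R.parS J j * u) else 0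
  map_zero' := by
    funext u
    simp
  map_add' p q := by
    funext u
    simp only [Pi.add_apply]
    split_ifs <;> simp

lemma nilMul_apply (j : Fin n) (p : R.ParFun k J) (u : R.parabolic J) : R.nilMul k J j p u =
    if R.length (R.parS J j * u : R.parabolic J) < R.length u then p (R.parS J j * u) else 0 := rfl

lemma nilMul_word (l : List (Fin n)) (p : R.ParFun k J) (u : R.parabolic J) :
    (l.map (R.nilMul k J)).prod p u =
      if R.length ((l.map (R.parS J)).prod⁻¹ * u : R.parabolic J) + l.length = R.length u then
        p ((l.map (R.parS J)).prod⁻¹ * u) else 0 := by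
  induction l generalizing u with
  | nil => simp
  | cons j l ih =>
    have hle : ∀ (l : List (Fin n)) (u : R.parabolic J),
        R.length u ≤ R.length ((l.map (R.parS J)).prod⁻¹ * u : R.parabolic J) + l.length := by
      intro l
      induction l with
      | nil => intro u; simp
      | cons j l ih' =>
        intro u
        have h1 := R.length_parS_mul J j u
        have h2 := ih' (R.parS J j * u)
        rw [List.map_cons, List.prod_cons, mul_inv_rev, parS_inv, mul_assoc, List.length_cons]
        omega
    have h1 := R.length_parS_mul J j u
    have h2 := hle l (R.parS J j * u)
    rw [List.map_cons, List.prod_cons, List.map_cons, List.prod_cons, AddMonoid.End.coe_mul, Function.comp_apply,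
      nilMul_apply, ih, mul_inv_rev, parS_inv, mul_assoc, List.length_cons]
    split_ifs <;> first | rfl | omega

lemma nilMul_braid {l l' : List (Fin n)} (hl : l.length = l'.length)
    (h : (l.map (R.parS J)).prod = (l'.map (R.parS J)).prod) :
    (l.map (R.nilMul k J)).prod = (l'.map (R.nilMul k J)).prod := by
  ext p u
  rw [nilMul_word, nilMul_word, h, hl]

lemma nilMul_of_notMem {j : Fin n} (hj : j ∉ J) : R.nilMul k J j = 0 := by
  ext p u
  rw [nilMul_apply, R.parS_of_notMem J hj]
  simp

lemma nilMul_mul_self (j : Fin n) : R.nilMul k J j * R.nilMul k J j = 0 := by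
  have h := fun p u => R.nilMul_word k J [j, j] p u
  ext p u
  have h := R.nilMul_word k J [j, j] p u
  simp only [List.map_cons, List.map_nil, List.prod_cons, List.prod_nil, mul_one, parS_mul_self,
    inv_one, one_mul] at h
  rw [h, if_neg]
  · rfl
  · simp

/-- The coefficientwise action of the Weyl group. -/
noncomputable def coefAct : R.weylGroup →* AddMonoid.End (R.ParFun k J) where
  toFun w :=
    { toFun := fun p u => R.symAct k w (p u)
      map_zero' := by funext u; simp
      map_add' := fun p q => by funext u; simp }
  map_one' := by
    refine AddMonoidHom.ext fun p => funext fun u => ?_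
    change R.symAct k 1 (p u) = p u
    rw [map_one]
    rfl
  map_mul' w w' := by
    refine AddMonoidHom.ext fun p => funext fun u => ?_
    change R.symAct k (w * w') (p u) = R.symAct k w (R.symAct k w' (p u))
    rw [map_mul]
    rfl

lemma coefAct_apply (w : R.weylGroup) (p : R.ParFun k J) (u : R.parabolic J) :
    R.coefAct k J w p u = R.symAct k w (p u) := rfl

/-- Multiplication by elements of the symmetric algebra. -/
noncomputable def coefMul : SymAlg k R.corootLattice →+* AddMonoid.End (R.ParFun k J) :=
  Module.toAddMonoidEnd _ _

lemma coefMul_apply (f : SymAlg k R.corootLattice) (p : R.ParFun k J) :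
    R.coefMul k J f p = f • p := rfl

lemma nilPair (i j : Fin n) : NilPair (R.coefMul k J) (R.symAct k) (R.coefAct k J)
    (R.nilMul k J i) (R.nilMul k J j) := by
  have h1 : ∀ (f) (i : Fin n), Commute (R.coefMul k J f) (R.nilMul k J i) := by
    intro f i
    ext p u
    simp only [AddMonoid.End.coe_mul, Function.comp_apply, coefMul_apply, nilMul_apply, Pi.smul_apply]
    split_ifs <;> simp
  have h2 : ∀ (g) (i : Fin n), Commute (R.coefAct k J g) (R.nilMul k J i) := by
    intro f i
    ext p u
    simp only [AddMonoid.End.coe_mul, Function.comp_apply, coefAct_apply, nilMul_apply]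
    split_ifs <;> simp
  refine ⟨fun g f => ?_, fun f => h1 f i, fun f => h1 f j, fun g => h2 g i, fun g => h2 g j,
    R.nilMul_mul_self k J i, R.nilMul_mul_self k J j⟩
  ext p u
  simp only [AddMonoid.End.coe_mul, Function.comp_apply, coefAct_apply, coefMul_apply, Pi.smul_apply, smul_eq_mul,
    map_mul]

/-- Left multiplication by a simple reflection in the nil Hecke ring, in terms of coefficients. -/
noncomputable def simpleMul (i : Fin n) : AddMonoid.End (R.ParFun k J) :=
  (1 - R.coefMul k J (linForm k (R.simpleCoroot i)) * R.nilMul k J i) * R.coefAct k J (R.s i)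

lemma linForm_add {Y : Type u} [AddCommGroup Y] (c c' : Y) :
    linForm k (c + c') = linForm k c + linForm k c' := by
  rw [linForm, TensorProduct.tmul_add, map_add]
  rfl

lemma linForm_zsmul {Y : Type u} [AddCommGroup Y] (a : ℤ) (c : Y) :
    linForm k (a • c) = a * linForm k c := by
  rw [linForm, TensorProduct.tmul_smul, map_zsmul, zsmul_eq_mul]
  rfl

lemma linForm_neg {Y : Type u} [AddCommGroup Y] (c : Y) : linForm k (-c) = -linForm k c := by
  rw [linForm, TensorProduct.tmul_neg, map_neg]
  rfl

lemma symAct_s_simpleCoroot (i j : Fin n) :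
    R.symAct k (R.s i) (linForm k (R.simpleCoroot j)) =
      linForm k (R.simpleCoroot j) + (-C.A j i : ℤ) * linForm k (R.simpleCoroot i) := by
  rw [symAct_linForm, latticeHom_s_simpleCoroot, sub_eq_add_neg, ← neg_smul, linForm_add,
    linForm_zsmul]

lemma symAct_s_self (i : Fin n) : R.symAct k (R.s i) (linForm k (R.simpleCoroot i)) =
    -linForm k (R.simpleCoroot i) := by
  rw [symAct_s_simpleCoroot, C.diag]
  push_cast
  ring

lemma simpleMul_mul_self (i : Fin n) : R.simpleMul k J i * R.simpleMul k J i = 1 :=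
  (R.nilPair k J i i).mul_self rfl (R.s_mul_self i) (R.symAct_s_self k i)

/-- Alternating words in the generators of the nil Coxeter algebra of `W_J`. -/
lemma nilMul_alternating {i j : Fin n} {l l' : List (Fin n)} (hl : l.length = l'.length)
    (hi : i ∈ l) (hi' : i ∈ l') (hj : j ∈ l) (hj' : j ∈ l') (hlij : ∀ a ∈ l, a = i ∨ a = j)
    (hlij' : ∀ a ∈ l', a = i ∨ a = j) (h : (l.map R.s).prod = (l'.map R.s).prod) :
    (l.map (R.nilMul k J)).prod = (l'.map (R.nilMul k J)).prod := by
  have hzero : ∀ a ∉ J, ∀ l : List (Fin n), a ∈ l → (l.map (R.nilMul k J)).prod = 0 := by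
    intro a ha l hal
    exact List.prod_eq_zero (List.mem_map.2 ⟨a, hal, R.nilMul_of_notMem k J ha⟩)
  by_cases hiJ : i ∈ J
  · by_cases hjJ : j ∈ J
    · refine R.nilMul_braid k J hl (Subtype.ext ?_)
      have hcoe : ∀ l : List (Fin n), (∀ a ∈ l, a = i ∨ a = j) →
          (((l.map (R.parS J)).prod : R.parabolic J) : R.weylGroup) = (l.map R.s).prod := by
        intro l hl
        rw [← Subgroup.coe_subtype, map_list_prod, List.map_map]
        congr 1
        refine List.map_congr_left fun a ha => ?_
        refine R.coe_parS_of_mem J ?_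
        rcases hl a ha with rfl | rfl <;> assumption
      rw [hcoe l hlij, hcoe l' hlij', h]
    · rw [hzero j hjJ l hj, hzero j hjJ l' hj']
  · rw [hzero i hiJ l hi, hzero i hiJ l' hi']

lemma isLiftable_simpleMul : C.coxeterMatrix.IsLiftable (R.simpleMul k J) := by
  -- by symmetry, the second of the two entries of the Cartan matrix may be taken to be the smaller one
  have key : ∀ i j : Fin n, i ≠ j → ((C.A i j = 0 ∧ C.A j i = 0) ∨ (C.A i j = -1 ∧ C.A j i = -1) ∨
      (C.A i j = -1 ∧ C.A j i = -2) ∨ (C.A i j = -1 ∧ C.A j i = -3)) →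
      (R.simpleMul k J i * R.simpleMul k J j) ^ C.coxeterMatrix i j = 1 := by
    intro i j hij hcases
    have hnp := R.nilPair k J i j
    have hbr := R.isLiftable_s i j
    have hsa := R.symAct_s_self k i
    have htb := R.symAct_s_self k j
    have hsb := R.symAct_s_simpleCoroot k i j
    have hta := R.symAct_s_simpleCoroot k j i
    have hss := R.s_mul_self i
    have htt := R.s_mul_self j
    have hUU := R.simpleMul_mul_self k J i
    have hVV := R.simpleMul_mul_self k J j
    have hU : R.simpleMul k J i = _ := rfl
    have hV : R.simpleMul k J j = _ := rfl
    rw [C.coxeterMatrix_apply hij] at hbr ⊢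
    rcases hcases with ⟨h1, h2⟩ | ⟨h1, h2⟩ | ⟨h1, h2⟩ | ⟨h1, h2⟩
    all_goals
      rw [h1, h2] at hbr ⊢
      rw [h2] at hsb
      rw [h1] at hta
      norm_num [cartanOrder] at hbr hsb hta ⊢
    · rw [pow_two_iff hss htt] at hbr
      rw [pow_two_iff hUU hVV]
      refine hnp.braid_two hU hV hsb hta hbr ?_
      simpa [mul_assoc] using R.nilMul_alternating k J (i := i) (j := j) (l := [i, j])
        (l' := [j, i]) rfl (by simp) (by simp) (by simp) (by simp) (by simp) (by simp)
        (by simpa [mul_assoc] using hbr)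
    · rw [pow_three_iff hss htt] at hbr
      rw [pow_three_iff hUU hVV]
      refine hnp.braid_three hU hV hsa htb hsb hta hbr ?_
      simpa [mul_assoc] using R.nilMul_alternating k J (i := i) (j := j) (l := [i, j, i])
        (l' := [j, i, j]) rfl (by simp) (by simp) (by simp) (by simp) (by simp) (by simp)
        (by simpa [mul_assoc] using hbr)
    · rw [pow_four_iff hss htt] at hbr
      rw [pow_four_iff hUU hVV]
      refine hnp.braid_four hU hV hsa htb hsb hta hbr ?_
      simpa [mul_assoc] using R.nilMul_alternating k J (i := i) (j := j) (l := [i, j, i, j])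
        (l' := [j, i, j, i]) rfl (by simp) (by simp) (by simp) (by simp) (by simp) (by simp)
        (by simpa [mul_assoc] using hbr)
    · rw [pow_six_iff hss htt] at hbr
      rw [pow_six_iff hUU hVV]
      refine hnp.braid_six hU hV hsa htb hsb hta hbr ?_
      simpa [mul_assoc] using R.nilMul_alternating k J (i := i) (j := j) (l := [i, j, i, j, i, j])
        (l' := [j, i, j, i, j, i]) rfl (by simp) (by simp) (by simp) (by simp) (by simp) (by simp)
        (by simpa [mul_assoc] using hbr)
  intro i j
  by_cases hij : i = j
  · subst hij
    rw [simpleMul_mul_self, one_pow]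
  · rcases C.entries_cases hij with h | h | h | h | h | h | h
    · exact key i j hij (by tauto)
    · exact key i j hij (by tauto)
    · exact key i j hij (by tauto)
    · rw [C.coxeterMatrix.symmetric]
      exact pow_eq_one_swap (R.simpleMul_mul_self k J i)
        (key j i (Ne.symm hij) (by tauto))
    · exact key i j hij (by tauto)
    · rw [C.coxeterMatrix.symmetric]
      exact pow_eq_one_swap (R.simpleMul_mul_self k J i)
        (key j i (Ne.symm hij) (by tauto))
    · rw [C.coxeterMatrix_apply hij, cartanOrder, if_neg (by omega), if_neg (by omega),
        if_neg (by omega), if_neg (by omega), pow_zero]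

end Realization

namespace Realization

variable {n : ℕ} {C : SymGCM n} {H : Type u} [AddCommGroup H] [Module ℂ H]
  (R : Realization C H) (k : Type u) [CommRing k] (J : Set (Fin n))

/-- Left multiplication by the elements of the Weyl group in the nil Hecke ring, in terms of
coefficients. -/
noncomputable def groupMul : R.weylGroup →* AddMonoid.End (R.ParFun k J) :=
  R.cs.lift ⟨R.simpleMul k J, R.isLiftable_simpleMul k J⟩

lemma groupMul_s (i : Fin n) : R.groupMul k J (R.s i) = R.simpleMul k J i := by
  rw [← cs_simple]
  exact R.cs.lift_apply_simple (R.isLiftable_simpleMul k J) i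

lemma groupMul_mul (v v' : R.weylGroup) (p : R.ParFun k J) :
    R.groupMul k J (v * v') p = R.groupMul k J v (R.groupMul k J v' p) := by
  rw [map_mul]
  rfl

lemma groupMul_inv_groupMul (v : R.weylGroup) (p : R.ParFun k J) :
    R.groupMul k J v⁻¹ (R.groupMul k J v p) = p := by
  rw [← groupMul_mul, inv_mul_cancel, map_one]
  rfl

lemma groupMul_groupMul_inv (v : R.weylGroup) (p : R.ParFun k J) :
    R.groupMul k J v (R.groupMul k J v⁻¹ p) = p := by
  rw [← groupMul_mul, mul_inv_cancel, map_one]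
  rfl

lemma symAct_mul (v v' : R.weylGroup) (f : SymAlg k R.corootLattice) :
    R.symAct k (v * v') f = R.symAct k v (R.symAct k v' f) := by
  rw [map_mul]
  rfl

lemma symAct_one (f : SymAlg k R.corootLattice) : R.symAct k 1 f = f := by
  rw [map_one]
  rfl

lemma simpleMul_apply (i : Fin n) (p : R.ParFun k J) (u : R.parabolic J) :
    R.simpleMul k J i p u = R.symAct k (R.s i) (p u) - linForm k (R.simpleCoroot i) *
      if R.length (R.parS J i * u : R.parabolic J) < R.length u then
        R.symAct k (R.s i) (p (R.parS J i * u)) else 0 := by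
  rw [simpleMul, AddMonoid.End.coe_mul, Function.comp_apply]
  rfl

lemma groupMul_smul (v : R.weylGroup) (f : SymAlg k R.corootLattice) (p : R.ParFun k J) :
    R.groupMul k J v (f • p) = R.symAct k v f • R.groupMul k J v p := by
  induction v using R.cs.simple_induction_left with
  | one =>
    rw [map_one, symAct_one]
    rfl
  | mul_simple_left v i ih =>
    rw [cs_simple, groupMul_mul, groupMul_mul, ih, groupMul_s, symAct_mul]
    funext u
    simp only [simpleMul_apply, Pi.smul_apply, smul_eq_mul, map_mul]
    split_ifs <;> ring

/-- The elements `t - 1` for a reflection `t` are divisible by the coroot of `t`. -/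
lemma exists_groupMul_refl (a : R.weylGroup) (i : Fin n) (p : R.ParFun k J) :
    ∃ g, R.groupMul k J (R.refl a i) p =
      p + linForm k (R.latticeHom a (R.simpleCoroot i)) • g := by
  have h1 : ∀ p, ∃ g, R.groupMul k J (R.s i) p = p + linForm k (R.simpleCoroot i) • g := by
    intro p
    choose g hg using fun u => R.dvd_symAct_s_sub k i (p u)
    refine ⟨fun u => g u - if R.length (R.parS J i * u : R.parabolic J) < R.length u then
        R.symAct k (R.s i) (p (R.parS J i * u)) else 0, ?_⟩
    funext u
    rw [groupMul_s, simpleMul_apply, Pi.add_apply, Pi.smul_apply, smul_eq_mul, mul_sub, ← hg]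
    ring
  obtain ⟨g, hg⟩ := h1 (R.groupMul k J a⁻¹ p)
  refine ⟨R.groupMul k J a g, ?_⟩
  rw [refl, groupMul_mul, groupMul_mul, hg, map_add, groupMul_smul, groupMul_groupMul_inv,
    symAct_linForm]

open Classical in
/-- The values at `v` of the equivariant Schubert classes of the elements of `W_J`. -/
noncomputable def schubert (v : R.weylGroup) : R.ParFun k J :=
  R.groupMul k J v (Pi.single 1 1)

lemma schubert_mul (v v' : R.weylGroup) :
    R.schubert k J (v * v') = R.groupMul k J v (R.schubert k J v') :=
  R.groupMul_mul k J v v' _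

lemma exists_schubert_refl_mul (a v : R.weylGroup) (i : Fin n) :
    ∃ g, R.schubert k J (R.refl a i * v) =
      R.schubert k J v + linForm k (R.latticeHom a (R.simpleCoroot i)) • g := by
  rw [schubert_mul]
  exact R.exists_groupMul_refl k J a i _

/-- Induction along reduced words in the generators of a parabolic subgroup, starting from the
right. -/
lemma parabolic_induction_left {J : Set (Fin n)} {p : R.parabolic J → Prop} (one : p 1)
    (mul : ∀ (v : R.parabolic J) (j : Fin n) (_ : j ∈ J), R.length v < R.length (R.s j * v) →
      p v → p (R.parS J j * v)) (v : R.parabolic J) : p v := by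
  have key : ∀ u (hu : u ∈ R.parabolic J), p (⟨u, hu⟩ : R.parabolic J)⁻¹ := by
    intro u hu
    induction hu using R.parabolic_induction with
    | one =>
      convert one using 1
      exact inv_one
    | mul u hu j hj hlt ih =>
      have h1 := mul _ j hj ?_ ih
      · convert h1 using 1
        apply Subtype.ext
        rw [Subgroup.coe_mul, R.coe_parS_of_mem J hj]
        simp [s_inv]
      · change R.length u⁻¹ < R.length (R.s j * u⁻¹)
        rwa [length_inv, ← R.length_inv (R.s j * u⁻¹), mul_inv_rev, inv_inv, s_inv]
  have := key _ (inv_mem v.2)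
  convert this using 1
  apply Subtype.ext
  simp

lemma schubert_one_one : R.schubert k J 1 1 = 1 := by
  rw [schubert, map_one]
  classical exact Pi.single_eq_same _ _

lemma schubert_one_of_ne {u : R.parabolic J} (hu : u ≠ 1) : R.schubert k J 1 u = 0 := by
  rw [schubert, map_one]
  classical exact Pi.single_eq_of_ne hu _

lemma schubert_parS_mul {j : Fin n} (hj : j ∈ J) (v u : R.parabolic J) :
    R.schubert k J (R.parS J j * v : R.parabolic J) u =
      R.symAct k (R.s j) (R.schubert k J v u) - linForm k (R.simpleCoroot j) *
      if R.length (R.parS J j * u : R.parabolic J) < R.length u then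
        R.symAct k (R.s j) (R.schubert k J v (R.parS J j * u)) else 0 := by
  rw [Subgroup.coe_mul, R.coe_parS_of_mem J hj, schubert_mul, groupMul_s, simpleMul_apply]

/-- The matrix of values of the Schubert classes on `W_J` is triangular. -/
lemma schubert_ne_zero (v u : R.parabolic J) (h : R.schubert k J v u ≠ 0) :
    u = v ∨ R.length u < R.length v := by
  induction v using R.parabolic_induction_left generalizing u with
  | one =>
    left
    by_contra hu
    rw [Subgroup.coe_one, R.schubert_one_of_ne k J hu] at h
    exact h rfl
  | mul v j hj hlt ih =>
    have hlen : R.length (R.parS J j * v : R.parabolic J) = R.length v + 1 := by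
      rw [Subgroup.coe_mul, R.coe_parS_of_mem J hj]
      rcases R.length_s_mul (v : R.weylGroup) j with h | h <;> omega
    rw [R.schubert_parS_mul k J hj] at h
    by_cases h1 : R.schubert k J v u = 0
    · by_cases h2 : R.length (R.parS J j * u : R.parabolic J) < R.length u
      · rw [if_pos h2, h1, map_zero, zero_sub] at h
        have h3 : R.schubert k J v (R.parS J j * u) ≠ 0 := by
          intro h3
          rw [h3, map_zero, mul_zero, neg_zero] at h
          exact h rfl
        rcases ih _ h3 with h4 | h4
        · left
          rw [← h4, ← mul_assoc, parS_mul_self, one_mul]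
        · right
          have := R.length_parS_mul J j u
          omega
      · rw [if_neg h2, h1, map_zero, mul_zero, sub_zero] at h
        exact absurd rfl h
    · right
      rcases ih u h1 with rfl | h2 <;> omega

/-- The value of the Schubert class of `v` at `v` is, up to sign, the product of the positive coroots
whose reflections make `v` shorter. -/
lemma exists_schubert_self (v : R.parabolic J) : ∃ (c : SymAlg k R.corootLattice)
    (L : List (R.parabolic J × Fin n)), IsUnit c ∧ (L.map fun x => R.refl x.1 x.2).Nodup ∧
    (∀ x ∈ L, x.2 ∈ J ∧ R.length (R.refl x.1 x.2 * v) < R.length v) ∧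
    R.schubert k J v v =
      c * (L.map fun x => linForm k (R.latticeHom x.1 (R.simpleCoroot x.2))).prod := by
  induction v using R.parabolic_induction_left with
  | one =>
    refine ⟨1, [], isUnit_one, by simp, by simp, ?_⟩
    rw [Subgroup.coe_one, schubert_one_one]
    simp
  | mul v j hj hlt ih =>
    obtain ⟨c, L, hc, hnd, hL, hdiag⟩ := ih
    have hlen : R.length (R.s j * v) = R.length v + 1 := by
      rcases R.length_s_mul (v : R.weylGroup) j with h | h <;> omega
    have hcoe : ((R.parS J j * v : R.parabolic J) : R.weylGroup) = R.s j * v := by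
      rw [Subgroup.coe_mul, R.coe_parS_of_mem J hj]
    have hrefl : ∀ x : R.parabolic J × Fin n,
        R.refl (R.parS J j * x.1 : R.parabolic J) x.2 = R.s j * R.refl x.1 x.2 * R.s j := by
      intro x
      rw [Subgroup.coe_mul, R.coe_parS_of_mem J hj, refl_conj, s_inv]
    have hrefl1 : R.refl (1 : R.parabolic J) j = R.s j := by
      simp [refl]
    refine ⟨-R.symAct k (R.s j) c, (1, j) :: L.map fun x => (R.parS J j * x.1, x.2),
      (hc.map _).neg, ?_, ?_, ?_⟩
    · rw [List.map_cons, List.nodup_cons, List.map_map]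
      constructor
      · intro hmem
        obtain ⟨x, hx, he⟩ := List.mem_map.1 hmem
        have he' : R.s j * R.refl x.1 x.2 * R.s j = R.s j := by
          rw [← hrefl x, ← hrefl1]
          exact he
        have h1 : R.refl x.1 x.2 = R.s j := by
          rw [mul_assoc] at he'
          have h2 := mul_left_cancel (he'.trans (mul_one _).symm)
          rw [← mul_one (R.refl _ _), ← R.s_mul_self j, ← mul_assoc, h2, one_mul]
        have := (hL x hx).2
        rw [h1] at this
        omega
      · have : (fun x : R.parabolic J × Fin n => R.refl x.1 x.2) ∘
            (fun x : R.parabolic J × Fin n => (R.parS J j * x.1, x.2)) =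
            (fun g => R.s j * g * R.s j) ∘ fun x => R.refl x.1 x.2 := by
          funext x
          exact hrefl x
        rw [this, ← List.map_map]
        refine hnd.map fun g g' h => ?_
        exact mul_left_cancel (mul_right_cancel h)
    · intro x hx
      rw [hcoe]
      rcases List.mem_cons.1 hx with rfl | hx
      · refine ⟨hj, ?_⟩
        change R.length (R.refl (1 : R.parabolic J) j * _) < _
        rw [hrefl1, ← mul_assoc, s_mul_self, one_mul]
        exact hlt
      · obtain ⟨x, hxL, rfl⟩ := List.mem_map.1 hx
        refine ⟨(hL x hxL).1, ?_⟩
        change R.length (R.refl (R.parS J j * x.1 : R.parabolic J) x.2 * _) < _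
        rw [hrefl, mul_assoc, ← mul_assoc (R.s j) (R.s j), s_mul_self, one_mul, mul_assoc]
        have h1 := (hL x hxL).2
        rcases R.length_s_mul (R.refl x.1 x.2 * v) j with h | h <;> omega
    · have h1 : R.schubert k J v (R.parS J j * v) = 0 := by
        by_contra h1
        rcases R.schubert_ne_zero k J _ _ h1 with h | h
        · rw [h] at hcoe
          rw [← hcoe] at hlen
          omega
        · rw [hcoe] at h
          omega
      rw [R.schubert_parS_mul k J hj, h1, map_zero, zero_sub, ← mul_assoc, parS_mul_self, one_mul,
        if_pos (by rw [hcoe]; exact hlt), hdiag, map_mul, map_list_prod, List.map_cons,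
        List.prod_cons, List.map_map, List.map_map]
      have h2 : (R.symAct k (R.s j) : SymAlg k R.corootLattice → SymAlg k R.corootLattice) ∘
          (fun x : R.parabolic J × Fin n => linForm k (R.latticeHom x.1 (R.simpleCoroot x.2))) =
          (fun x : R.parabolic J × Fin n => linForm k (R.latticeHom x.1 (R.simpleCoroot x.2))) ∘
            (fun x : R.parabolic J × Fin n => (R.parS J j * x.1, x.2)) := by
        funext x
        simp only [Function.comp_apply]
        rw [symAct_linForm, Subgroup.coe_mul, R.coe_parS_of_mem J hj, latticeHom_mul]
      have h3 : R.latticeHom ((1 : R.parabolic J) : R.weylGroup) (R.simpleCoroot j) =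
          R.simpleCoroot j := rfl
      rw [h2, h3]
      ring

/-! ### The basis attached to a coset -/

/-- The automorphism of the coefficient module given by the unipotent part of the multiplication by
an element of the Weyl group. -/
noncomputable def unipMul (z : R.weylGroup) :
    R.ParFun k J ≃ₗ[SymAlg k R.corootLattice] R.ParFun k J where
  toFun p := R.groupMul k J z (R.coefAct k J z⁻¹ p)
  map_add' p q := by simp
  map_smul' f p := by
    have h1 : R.coefAct k J z⁻¹ (f • p) = R.symAct k z⁻¹ f • R.coefAct k J z⁻¹ p := by
      funext u
      exact map_mul (R.symAct k z⁻¹) f (p u)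
    rw [h1, groupMul_smul, ← symAct_mul, mul_inv_cancel, symAct_one]
    rfl
  invFun p := R.coefAct k J z (R.groupMul k J z⁻¹ p)
  left_inv p := by
    change R.coefAct k J z (R.groupMul k J z⁻¹ (R.groupMul k J z (R.coefAct k J z⁻¹ p))) = p
    rw [groupMul_inv_groupMul]
    funext u
    rw [coefAct_apply, coefAct_apply, ← symAct_mul, mul_inv_cancel, symAct_one]
  right_inv p := by
    have h1 : ∀ q, R.coefAct k J z⁻¹ (R.coefAct k J z q) = q := by
      intro q
      funext u
      rw [coefAct_apply, coefAct_apply, ← symAct_mul, inv_mul_cancel, symAct_one]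
    change R.groupMul k J z (R.coefAct k J z⁻¹ (R.coefAct k J z (R.groupMul k J z⁻¹ p))) = p
    rw [h1, groupMul_groupMul_inv]

/-- The basis of the coefficient module in which the restrictions of the Schubert classes to the coset
`z W_J` are triangular. -/
noncomputable def cosetBasis [Finite (R.parabolic J)] (z : R.weylGroup) :
    Module.Basis (R.parabolic J) (SymAlg k R.corootLattice) (R.ParFun k J) :=
  (Pi.basisFun (SymAlg k R.corootLattice) (R.parabolic J)).map (R.unipMul k J z)

lemma cosetBasis_repr [Finite (R.parabolic J)] (z v : R.weylGroup) (u : R.parabolic J) :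
    (R.cosetBasis k J z).repr (R.schubert k J (z * v)) u = R.symAct k z (R.schubert k J v u) := by
  rw [cosetBasis, Module.Basis.map_repr, LinearEquiv.trans_apply, Pi.basisFun_repr, schubert_mul]
  change R.coefAct k J z (R.groupMul k J z⁻¹ _) u = _
  rw [groupMul_inv_groupMul, coefAct_apply]

end Realization

namespace Realization

variable {n : ℕ} {C : SymGCM n} {H : Type u} [AddCommGroup H] [Module ℂ H]
  (R : Realization C H)

/-! ### The projection of Bruhat graphs -/

variable {R} in
lemma label_eq {J : Set (Fin n)} {w : R.minReps J} {x y : Set.Iic w}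
    (h : (R.bruhatGraphLE J w).Adj x y) {c : H} (hc : R.IsEdgeLabel J x.1 y.1 c) :
    ((R.bruhatGraphLE J w).label h : H) = c :=
  R.isEdgeLabel_unique h.1 h.2.choose_spec hc

/-- An edge `x → y` of a Bruhat graph of `W` is given by a real coroot. -/
lemma exists_label {w : R.minReps ∅} {x y : Set.Iic w} (h : (R.bruhatGraphLE ∅ w).Adj x y) :
    ∃ (a : R.weylGroup) (i : Fin n), (y.1.1 : R.weylGroup) = R.refl a i * x.1.1 ∧
      (R.bruhatGraphLE ∅ w).label h = R.latticeHom a (R.simpleCoroot i) := by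
  obtain ⟨c, hc⟩ := h.2
  obtain ⟨a, i, -, h1, h2⟩ := R.isEdgeLabel_empty_iff.1 hc
  exact ⟨a, i, h2, Subtype.ext ((label_eq h hc).trans h1)⟩

/-- The action of the Weyl group on the coroot lattice, by automorphisms. -/
def latticeEquiv (a : R.weylGroup) : R.corootLattice ≃ₗ[ℤ] R.corootLattice :=
  LinearEquiv.ofLinearMap (R.latticeHom a) (R.latticeHom a⁻¹)
    (by ext c; rw [LinearMap.comp_apply, ← latticeHom_mul, mul_inv_cancel]; rfl)
    (by ext c; rw [LinearMap.comp_apply, ← latticeHom_mul, inv_mul_cancel]; rfl)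

/-- The basis of simple coroots of the coroot lattice. -/
noncomputable def simpleCorootBasis : Module.Basis (Fin n) ℤ R.corootLattice :=
  Module.Basis.span (R.coroot_linearIndependent.restrict_scalars' ℤ)

lemma simpleCorootBasis_apply (i : Fin n) : R.simpleCorootBasis i = R.simpleCoroot i :=
  Module.Basis.span_apply _ _

/-- The basis of the extended coroot lattice consisting of the images of the simple coroots under an
element of the Weyl group. -/
noncomputable def corootBasis (k : Type u) [CommRing k] (a : R.weylGroup) :
    Module.Basis (Fin n) k (k ⊗[ℤ] R.corootLattice) :=
  (R.simpleCorootBasis.map (R.latticeEquiv a)).baseChange k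

lemma corootBasis_apply (k : Type u) [CommRing k] (a : R.weylGroup) (i : Fin n) :
    R.corootBasis k a i = (1 : k) ⊗ₜ[ℤ] R.latticeHom a (R.simpleCoroot i) := by
  rw [corootBasis, Module.Basis.baseChange_apply, Module.Basis.map_apply, simpleCorootBasis_apply]
  rfl

/-- For a GKM pair the labels at a vertex are coprime: each of them belongs to a basis. -/
lemma hasCoprimeLabels {w : R.minReps ∅} {k : Type u} [CommRing k]
    (hGKM : (R.bruhatGraphLE ∅ w).IsGKM k) : (R.bruhatGraphLE ∅ w).HasCoprimeLabels k := by
  intro v v₁ v₂ h₁ h₂ hne f hf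
  have hli := hGKM h₁ h₂ (fun e => hne (Prod.ext_iff.1 e).2) (Or.inl rfl)
  obtain ⟨a, i, -, hl⟩ := R.exists_label h₁
  rw [hl, linForm, linForm, ← corootBasis_apply] at hf
  rw [hl, ← corootBasis_apply] at hli
  rw [hl, linForm, ← corootBasis_apply]
  exact ι_basis_dvd_of_dvd_mul _ i _ hli hf

variable {J : Set (Fin n)} {wJ : R.weylGroup} (hwJ : R.IsLongest J wJ) (w : R.minReps J)

/-- The projection from the Bruhat graph of `w w_J` to the parabolic Bruhat graph of `w`. -/
noncomputable def cosetMap (v : Set.Iic (R.toMinRepsEmpty (w * wJ))) : Set.Iic w :=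
  ⟨R.minRep J v.1.1, (hwJ.le_mul_iff _ w).1 v.2⟩

lemma isFibration_cosetMap : IsFibration (R.bruhatGraphLE ∅ (R.toMinRepsEmpty (w * wJ)))
    (R.bruhatGraphLE J w) (R.cosetMap hwJ w) where
  mono v v' h := R.minRep_mono J h
  push {v v'} h hne := by
    obtain ⟨c, hc⟩ := h.2
    obtain ⟨hlt, hc'⟩ := R.edge_push h.1 hc fun e => hne (Subtype.ext e)
    have h' : (R.bruhatGraphLE J w).Adj (R.cosetMap hwJ w v) (R.cosetMap hwJ w v') := ⟨hlt, c, hc'⟩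
    exact ⟨h', Subtype.ext ((label_eq h' hc').trans (label_eq h hc).symm)⟩
  lift {x y} h v hv := by
    obtain ⟨c, hc⟩ := h.2
    obtain ⟨v', hv', hlt, hc'⟩ := R.edge_lift h.1 hc (v := v.1.1) (congrArg Subtype.val hv)
    exact ⟨⟨R.toMinRepsEmpty v', (hwJ.le_mul_iff v' w).2 (hv' ▸ y.2)⟩, ⟨hlt, c, hc'⟩,
      Subtype.ext hv'⟩

/-- The coset `x W_J`, parametrized by `W_J` starting from its longest element. -/
noncomputable def fibreEquiv (x : Set.Iic w) :
    R.parabolic J ≃ {v // R.cosetMap hwJ w v = x} where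
  toFun u := ⟨⟨R.toMinRepsEmpty (x.1 * wJ * u), (hwJ.le_mul_iff _ w).2 (by
      change R.minRep J (x.1 * wJ * u) ≤ w
      rw [mul_assoc, R.minRep_mul x.1 (mul_mem hwJ.1 u.2)]
      exact x.2)⟩, Subtype.ext (by
      change R.minRep J (x.1 * wJ * u) = x.1
      rw [mul_assoc, R.minRep_mul x.1 (mul_mem hwJ.1 u.2)])⟩
  invFun v := ⟨(x.1 * wJ)⁻¹ * v.1.1.1, by
    have h := R.minRep_spec J v.1.1.1
    have hv : R.minRep J v.1.1.1 = x.1 := congrArg Subtype.val v.2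
    rw [hv] at h
    rw [mul_inv_rev, mul_assoc]
    exact mul_mem (inv_mem hwJ.1) h⟩
  left_inv u := Subtype.ext (inv_mul_cancel_left _ _)
  right_inv v := Subtype.ext (Subtype.ext (Subtype.ext (mul_inv_cancel_left _ _)))

lemma fibreEquiv_symm_coe (x : Set.Iic w) (v : {v // R.cosetMap hwJ w v = x}) :
    (v.1.1.1 : R.weylGroup) = x.1 * wJ * (R.fibreEquiv hwJ w x).symm v := by
  conv_lhs => rw [← (R.fibreEquiv hwJ w x).apply_symm_apply v]
  rfl

lemma length_fibreEquiv (x : Set.Iic w) (v : {v // R.cosetMap hwJ w v = x}) :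
    R.length v.1.1.1 + R.length ((R.fibreEquiv hwJ w x).symm v : R.parabolic J) =
      R.length x.1 + R.length wJ := by
  rw [R.fibreEquiv_symm_coe hwJ w x v]
  exact hwJ.length_mul x.1.2 (Subtype.prop _)

variable (k : Type u) [CommRing k]

/-- The Schubert classes of the elements of `W_J` as a basis of the cohomology along the cosets of
`W_J`. -/
noncomputable def lerayHirsch [Finite (R.parabolic J)] :
    LerayHirsch k (R.bruhatGraphLE ∅ (R.toMinRepsEmpty (w * wJ))) (R.cosetMap hwJ w)
      (R.ParFun k J) where
  cls v := R.schubert k J v.1.1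
  rank v := R.length v.1.1
  basis x := (R.cosetBasis k J (x.1 * wJ)).reindex (R.fibreEquiv hwJ w x)
  cls_adj {v v'} h := by
    obtain ⟨a, i, h1, hl⟩ := R.exists_label h
    obtain ⟨g, hg⟩ := R.exists_schubert_refl_mul k J a v.1.1 i
    refine ⟨-g, ?_⟩
    rw [h1, hg, hl, smul_neg]
    abel
  rank_lt h := R.length_lt_of_lt h.1
  triangular x u v h := by
    rw [Module.Basis.repr_reindex_apply, R.fibreEquiv_symm_coe hwJ w x v, cosetBasis_repr] at h
    have h1 : R.schubert k J ((R.fibreEquiv hwJ w x).symm v : R.parabolic J)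
        ((R.fibreEquiv hwJ w x).symm u) ≠ 0 := by
      intro h1
      rw [h1, map_zero] at h
      exact h rfl
    rcases R.schubert_ne_zero k J _ _ h1 with h2 | h2
    · exact Or.inl ((R.fibreEquiv hwJ w x).symm.injective h2)
    · right
      have h3 := R.length_fibreEquiv hwJ w x u
      have h4 := R.length_fibreEquiv hwJ w x v
      omega
  diag v := by
    set x := R.cosetMap hwJ w v with hx
    set e := R.fibreEquiv hwJ w x with he
    set u := e.symm ⟨v, rfl⟩ with hu
    set z : R.weylGroup := x.1 * wJ with hz
    have hv : (v.1.1 : R.weylGroup) = z * u := R.fibreEquiv_symm_coe hwJ w x ⟨v, rfl⟩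
    obtain ⟨c, L, hc, hnd, hL, hdiag⟩ := R.exists_schubert_self k J u
    have hmem : ∀ p ∈ L, R.refl p.1 p.2 ∈ R.parabolic J := fun p hp =>
      mul_mem (mul_mem p.1.2 (R.s_mem_parabolic (hL p hp).1)) (inv_mem p.1.2)
    -- the neighbour of `v` for a reflection in the list
    have hE : ∀ p : {p // p ∈ L}, ∃ (v' : {v' // R.cosetMap hwJ w v' = x})
        (h : (R.bruhatGraphLE ∅ (R.toMinRepsEmpty (w * wJ))).Adj v v'.1)
        (ε : SymAlg k R.corootLattice), IsUnit ε ∧ (v'.1.1.1 : R.weylGroup) =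
          z * (R.refl p.1.1 p.1.2 * u) ∧
        linForm k (R.latticeHom z (R.latticeHom p.1.1 (R.simpleCoroot p.1.2))) =
          ε * linForm k ((R.bruhatGraphLE ∅ (R.toMinRepsEmpty (w * wJ))).label h) := by
      rintro ⟨p, hp⟩
      let v' := e (⟨R.refl p.1 p.2, hmem p hp⟩ * u)
      have hv' : (v'.1.1.1 : R.weylGroup) = z * (R.refl p.1 p.2 * u) := rfl
      have hv'' : (v'.1.1.1 : R.weylGroup) = R.refl (z * p.1) p.2 * v.1.1 := by
        rw [hv', hv, refl_conj]
        group
      obtain ⟨d, hd, hd'⟩ := R.exists_isEdgeLabel_refl (z * p.1) p.2 v.1.1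
      have hlen : R.length v.1.1 < R.length v'.1.1.1 := by
        have h1 := hwJ.length_mul x.1.2 u.2
        have h2 := hwJ.length_mul x.1.2 (mul_mem (hmem p hp) u.2)
        have h3 := (hL p hp).2
        rw [← hz, ← hv] at h1
        rw [← hz, ← hv'] at h2
        omega
      have hlt : v.1 < v'.1.1 := by
        change (v.1.1 : R.weylGroup) < v'.1.1.1
        rw [hv''] at hlen ⊢
        exact R.lt_refl_mul hlen
      rw [← hv''] at hd
      have hadj : (R.bruhatGraphLE ∅ (R.toMinRepsEmpty (w * wJ))).Adj v v'.1 := ⟨hlt, d, hd⟩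
      have hlab := label_eq hadj hd
      rcases hd' with hd' | hd'
      · refine ⟨v', hadj, 1, isUnit_one, hv', ?_⟩
        rw [one_mul]
        congr 1
        exact Subtype.ext ((hlab.trans hd').symm)
      · refine ⟨v', hadj, -1, isUnit_one.neg, hv', ?_⟩
        rw [neg_one_mul, ← linForm_neg]
        congr 1
        apply Subtype.ext
        rw [Submodule.coe_neg, hlab, hd', neg_neg]
        rfl
    choose f hadj ε hε hf hlab using hE
    refine ⟨R.symAct k z c * (L.attach.map ε).prod,
      L.attach.map fun p => ⟨(f p).1, hadj p⟩, ?_, ?_, ?_, ?_⟩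
    · refine (hc.map _).mul ?_
      generalize L.attach = L'
      induction L' with
      | nil => simp
      | cons p L' ih =>
        rw [List.map_cons, List.prod_cons]
        exact (hε p).mul ih
    · refine List.Nodup.of_map (fun E => z⁻¹ * (E.1.1.1 : R.weylGroup) * (u : R.weylGroup)⁻¹) ?_
      rw [List.map_map]
      convert hnd using 1
      conv_rhs => rw [← List.attach_map_subtype_val L, List.map_map]
      refine List.map_congr_left fun p _ => ?_
      change z⁻¹ * ((f p).1.1.1 : R.weylGroup) * (u : R.weylGroup)⁻¹ = R.refl p.1.1 p.1.2
      rw [hf]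
      group
    · intro E hEL
      obtain ⟨p, -, rfl⟩ := List.mem_map.1 hEL
      exact (f p).2
    · rw [Module.Basis.repr_reindex_apply, hv, cosetBasis_repr, ← hu, hdiag, map_mul,
        map_list_prod, List.map_map, mul_assoc, List.map_map]
      congr 1
      conv_lhs => rw [← List.attach_map_subtype_val L, List.map_map]
      rw [← List.prod_map_mul]
      congr 1
      refine List.map_congr_left fun p _ => ?_
      simp only [Function.comp_apply]
      rw [symAct_linForm, hlab]

end Realization

end MomentSheaf

theorem theorem6p9 {n : ℕ} (C : MomentSheaf.SymGCM n)
    {H : Type u} [AddCommGroup H] [Module ℂ H] (R : MomentSheaf.Realization C H)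
    (k : Type u) [CommRing k] [IsLocalRing k] (h2 : IsUnit (2 : k))
    (J : Set (Fin n)) (hJ : Finite (R.parabolic J))
    (wJ : R.weylGroup) (hwJ : R.IsLongest J wJ)
    (y w : R.minReps J) (hyw : y ≤ w)
    (hGKM : (R.bruhatGraphLE ∅ (R.toMinRepsEmpty (w * wJ))).IsGKM k)
    (B : MomentSheaf.KSheaf k (R.bruhatGraphLE ∅ (R.toMinRepsEmpty (w * wJ))))
    (hB : B.IsCanonical ⟨R.toMinRepsEmpty (w * wJ), Set.self_mem_Iic⟩)
    (BJ : MomentSheaf.KSheaf k (R.bruhatGraphLE J w))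
    (hBJ : BJ.IsCanonical ⟨w, Set.self_mem_Iic⟩) :
    ∃ hy : R.toMinRepsEmpty (y * wJ) ≤ R.toMinRepsEmpty (w * wJ),
      Nonempty (MomentSheaf.GrIso (B.stalk ⟨R.toMinRepsEmpty (y * wJ), hy⟩)
        (BJ.stalk ⟨y, hyw⟩)) := by
  have hy : R.toMinRepsEmpty (y * wJ) ≤ R.toMinRepsEmpty (w * wJ) := hwJ.mul_mono y.2 w.2 hyw
  refine ⟨hy, ?_⟩
  have hfin : Finite (Set.Iic (R.toMinRepsEmpty (w * wJ))) :=
    Set.Finite.to_subtype (((R.finite_Iic (w * wJ)).preimage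
      Subtype.val_injective.injOn).subset fun v hv => hv)
  have htop : R.cosetMap hwJ w ⟨R.toMinRepsEmpty (w * wJ), Set.self_mem_Iic⟩ =
      ⟨w, Set.self_mem_Iic⟩ := Subtype.ext (R.minRep_mul w hwJ.1)
  have hπy : R.cosetMap hwJ w ⟨R.toMinRepsEmpty (y * wJ), hy⟩ = ⟨y, hyw⟩ :=
    Subtype.ext (R.minRep_mul y hwJ.1)
  have hout : ∀ {J' : Set (Fin n)} {w' : R.minReps J'} (x : Set.Iic w'),
      x ≠ ⟨w', Set.self_mem_Iic⟩ → ∃ x', (R.bruhatGraphLE J' w').Adj x x' := by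
    intro J' w' x hx
    obtain ⟨x', hx', hlt, hc⟩ := R.exists_edge (lt_of_le_of_ne x.2 fun e => hx (Subtype.ext e))
    exact ⟨⟨x', hx'⟩, hlt, hc⟩
  have hfib := R.isFibration_cosetMap hwJ w
  have hcop : (R.bruhatGraphLE ∅ (R.toMinRepsEmpty (w * wJ))).HasCoprimeLabels k :=
    R.hasCoprimeLabels hGKM
  have hdual : ∀ x, (BJ.stalk x).HasDualBasis := by
    intro x
    by_cases hx : x = ⟨w, Set.self_mem_Iic⟩
    · rw [hx]
      exact hBJ.stalk_top.hasDualBasis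
    · obtain ⟨x', h⟩ := hout x hx
      exact (hBJ.projectiveCover h).1.hasDualBasis
  have hext := MomentSheaf.LerayHirsch.hasExtensions hcop (R.lerayHirsch hwJ w k) hfib hBJ hdual
  have hiso := MomentSheaf.nonempty_grIso_of_hasExtensions hfib hB (by rwa [htop]) (fun v => v.2) hout
    (fun x hx => hout x (by rwa [htop] at hx)) hext ⟨R.toMinRepsEmpty (y * wJ), hy⟩
  rwa [hπy] at hiso
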